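/- Let $R$ be a commutative artinian ring, let $\Lambda$ be an artin $R$-algebra (an $R$-algebra that is finitely generated as an $R$-module), and let $\operatorname{mod}\Lambda$ be the abelian category of finitely generated $\Lambda$-modules. Let $n\ge 2$ and let $\mathcal M$ be an $n$-cluster tilting subcategory of $\operatorname{mod}\Lambda$, that is, a full additive, functorially finite, generating and cogenerating subcategory with $$\{X \mid \operatorname{Ext}^i_\Lambda(\mathcal M,X)=0 \text{ for } 0<i<n\}=\mathcal M=\{X \mid \operatorname{Ext}^i_\Lambda(X,\mathcal M)=0 \text{ for } 0<i<n\}.$$ Let $\operatorname{mod}\mathcal M$ (respectively $\mathcal M\text{-}\operatorname{mod}$) denote the abelian category of finitely presented contravariant (respectively covariant) additive functors from $\mathcal M$ to abelian groups. Let $\widetilde{\mathcal P}^{\le 1}(\mathcal M)\subseteq \operatorname{mod}\mathcal M$ and $\widetilde{\mathcal P}^{\le 1}(\mathcal M^{\mathrm{op}})\subseteq \mathcal M\text{-}\operatorname{mod}$ be the full subcategories of functors of projective dimension at most $1$, and let $\widetilde{\mathcal I}^{\le 1}(\mathcal M)\subseteq\operatorname{mod}\mathcal M$ be the full subcategory of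 functors of injective dimension at most $1$. An underline denotes the stable category (morphisms modulo those factoring through a projective object of the ambient functor category), and an overline denotes the costable category (morphisms modulo those factoring through an injective object of the ambient functor category). Then there is a duality $$\underline{\widetilde{\mathcal P}^{\le 1}(\mathcal M)}\;\simeq\;\bigl(\underline{\widetilde{\mathcal P}^{\le 1}(\mathcal M^{\mathrm{op}})}\bigr)^{\mathrm{op}},$$ and there is an equivalence of categories $$\underline{\widetilde{\mathcal P}^{\le 1}(\mathcal M)}\;\simeq\;\overline{\widetilde{\mathcal I}^{\le 1}(\mathcal M)}.$$ -/

import Mathlib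

open CategoryTheory CategoryTheory.Limits

universe v u

namespace HigherCT

noncomputable section

/-! ### `n`-cluster tilting subcategories of an abelian category -/

section ClusterTilting

variable {A : Type u} [Category.{v} A]

/-- `π : X ⟶ Y` is a right `M`-approximation of `Y`. -/
def IsRightApprox (M : ObjectProperty A) {X Y : A} (π : X ⟶ Y) : Prop :=
  M X ∧ ∀ ⦃N : A⦄, M N → ∀ g : N ⟶ Y, ∃ h : N ⟶ X, h ≫ π = g

/-- `ι : Y ⟶ X` is a left `M`-approximation of `Y`. -/
def IsLeftApprox (M : ObjectProperty A) {X Y : A} (ι : Y ⟶ X) : Prop :=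
  M X ∧ ∀ ⦃N : A⦄, M N → ∀ g : Y ⟶ N, ∃ h : X ⟶ N, ι ≫ h = g

/-- Every object has a right and a left `M`-approximation. -/
def IsFunctoriallyFinite (M : ObjectProperty A) : Prop :=
  (∀ Y : A, ∃ (X : A) (π : X ⟶ Y), IsRightApprox M π) ∧
    ∀ Y : A, ∃ (X : A) (ι : Y ⟶ X), IsLeftApprox M ι

/-- Every object is a quotient of an object of `M` and a subobject of an object of `M`. -/
def IsGeneratingCogenerating (M : ObjectProperty A) : Prop :=
  (∀ Y : A, ∃ (X : A) (π : X ⟶ Y), M X ∧ Epi π) ∧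
    ∀ Y : A, ∃ (X : A) (ι : Y ⟶ X), M X ∧ Mono ι

/-- `Extⁱ(X, Y) = 0` in the abelian category `A`. -/
def ExtVanishes [Abelian A] (X Y : A) (i : ℕ) : Prop :=
  letI : HasExt.{max u v} A := HasExt.standard A
  Subsingleton (Abelian.Ext.{max u v} X Y i)

/-- A full subcategory `M` of an abelian category is `n`-cluster tilting if it is functorially
finite, generating-cogenerating, and
`{Y | Extⁱ(M, Y) = 0 for 0 < i < n} = M = {X | Extⁱ(X, M) = 0 for 0 < i < n}`.
(Such an `M` is automatically closed under isomorphisms, finite direct sums and summands.) -/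
structure IsNClusterTilting [Abelian A] (n : ℕ) (M : ObjectProperty A) : Prop where
  functoriallyFinite : IsFunctoriallyFinite M
  generatingCogenerating : IsGeneratingCogenerating M
  mem_iff_right : ∀ Y : A, M Y ↔ ∀ X : A, M X → ∀ i : ℕ, 0 < i → i < n → ExtVanishes X Y i
  mem_iff_left : ∀ X : A, M X ↔ ∀ Y : A, M Y → ∀ i : ℕ, 0 < i → i < n → ExtVanishes X Y i

end ClusterTilting

/-! ### Finitely presented modules over a preadditive category -/

section Modules

variable (C : Type u) [Category.{v} C] [Preadditive C]

/-- A contravariant additive functor `F : C → Ab` is finitely presented if there is an exact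
sequence `C(-, X) ⟶ C(-, X') ⟶ F ⟶ 0`. -/
def isFinPres : ObjectProperty (Cᵒᵖ ⥤ AddCommGrpCat.{v}) := fun F =>
  F.Additive ∧ ∃ (X X' : C) (f : X ⟶ X') (p : preadditiveYoneda.obj X' ⟶ F)
    (w : preadditiveYoneda.map f ≫ p = 0),
    (ShortComplex.mk (preadditiveYoneda.map f) p w).Exact ∧ Epi p

/-- The category `mod C` of finitely presented (right) `C`-modules. The category of
finitely presented left `C`-modules (covariant functors) is `FinPresMod Cᵒᵖ`. -/
abbrev FinPresMod := (isFinPres C).FullSubcategory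

variable {C} in
/-- `0 ⟶ F ⟶ G ⟶ H ⟶ 0` is a short exact sequence of functors. -/
def IsShortExact {F G H : FinPresMod C} (i : F ⟶ G) (p : G ⟶ H) : Prop :=
  ∃ w : i.hom ≫ p.hom = 0, (ShortComplex.mk i.hom p.hom w).ShortExact

/-- The finitely presented `C`-modules of projective dimension at most one in `mod C`: those `F`
with an exact sequence `0 ⟶ P₁ ⟶ P₀ ⟶ F ⟶ 0`, `P₁` and `P₀` projective in `mod C`. -/
def projDimLEOne : ObjectProperty (FinPresMod C) := fun F =>
  ∃ (P₁ P₀ : FinPresMod C) (i : P₁ ⟶ P₀) (p : P₀ ⟶ F),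
    Projective P₁ ∧ Projective P₀ ∧ IsShortExact i p

/-- The finitely presented `C`-modules of injective dimension at most one in `mod C`: those `F`
with an exact sequence `0 ⟶ F ⟶ I₀ ⟶ I₁ ⟶ 0`, `I₀` and `I₁` injective in `mod C`. -/
def injDimLEOne : ObjectProperty (FinPresMod C) := fun F =>
  ∃ (I₀ I₁ : FinPresMod C) (i : F ⟶ I₀) (p : I₀ ⟶ I₁),
    Injective I₀ ∧ Injective I₁ ∧ IsShortExact i p

end Modules

/-! ### Stable and costable categories -/

section Stable

variable {D : Type u} [Category.{v} D] [Preadditive D] (P : ObjectProperty D)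

/-- Two morphisms of the full subcategory `P` of `D` are identified when their difference factors
through a projective object of `D`. -/
def stableRel : HomRel P.FullSubcategory := fun X Y f g =>
  ∃ (Q : D) (a : X.obj ⟶ Q) (b : Q ⟶ Y.obj), Projective Q ∧ f.hom - g.hom = a ≫ b

/-- Two morphisms of the full subcategory `P` of `D` are identified when their difference factors
through an injective object of `D`. -/
def costableRel : HomRel P.FullSubcategory := fun X Y f g =>
  ∃ (Q : D) (a : X.obj ⟶ Q) (b : Q ⟶ Y.obj), Injective Q ∧ f.hom - g.hom = a ≫ b

/-- The stable category of the full subcategory `P` of `D`: morphisms modulo those that factor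
through projective objects. -/
abbrev StableCat := CategoryTheory.Quotient (stableRel P)

/-- The costable category of the full subcategory `P` of `D`: morphisms modulo those that factor
through injective objects. -/
abbrev CostableCat := CategoryTheory.Quotient (costableRel P)

end Stable

/-! ### Artin algebras -/

/-- `M` is an `n`-cluster tilting subcategory of the abelian category `mod Λ` of finitely
generated modules over the artin `R`-algebra `Λ`. -/
def IsNClusterTiltingMod (R : Type u) [CommRing R] [IsArtinianRing R] (Λ : Type u) [Ring Λ]
    [Algebra R Λ] [Module.Finite R Λ] (n : ℕ) (M : ObjectProperty (FGModuleCat.{u} Λ)) : Prop :=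
  haveI : IsNoetherianRing Λ := IsNoetherianRing.of_finite R Λ
  IsNClusterTilting n M

end

end HigherCT

-- Functors and modules are linked by `K ↦ Hom(-, K)`, restricted to `M`. If `0 → X₁ → X₀ → K → 0`
-- is exact with `X₁`, `X₀` in `M`, then `Ext¹(M, X₁) = 0` keeps it exact under `Hom(M, -)`, so
-- `Hom(-, K)` has projective dimension at most one. Conversely, a projective resolution of length
-- one is given by a monomorphism `X₁ ⟶ X₀` of `M`; it stays monic among modules because `M`
-- generates, and `K` is its cokernel. So the stable category of right functors of projective
-- dimension at most one is the category of such `K` modulo maps factoring through `M`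
-- (`IsRigidGenerating.nonempty_equivalence`). Dually, `D ↦ Hom(D, -)` identifies the opposite of
-- the stable category of left functors with the modules `D` having a coresolution `0 → D → X⁰ → X¹
-- → 0` in `M`, modulo `M`.
--
-- By long exact sequences the first class is given by `Extⁱ(M, K) = 0` and the second by `Extⁱ(D,
-- M) = 0`, both for `0 < i < n - 1`. The classes `extOrthogonal M n j`, `0 ≤ j ≤ n - 2`,
-- interpolate between them. Cokernels of left approximations lead from `j` to `j + 1`, kernels of
-- right approximations lead back, and these are inverse modulo `M` (`nonempty_syzygy_equivalence`).
-- Iterating gives the duality.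
--
-- For the second claim, let `E` be a dualizing `R`-module. Since `M` contains the free modules `Λᶜ`
-- and the cofree modules `Hom_R(Λ, E)ᶜ`, the `E`-duals of representable functors are finitely
-- presented. Pointwise duality is then a duality between finitely presented right and left
-- functors; it exchanges injectives with projectives, and hence injective with projective dimension
-- at most one. Composing with the first duality gives the equivalence.

universe w v₁ v₂ u₁ u₂ w₁ w₂

namespace HigherCT

noncomputable section

/-! ### Matlis duality over a commutative artinian ring -/

section Matlis

/-- Every module has an injective essential extension. -/
theorem exists_injective_essential (R : Type u) [Ring R] (K : Type u) [AddCommGroup K]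
    [Module R K] : ∃ (E : Type u) (_ : AddCommGroup E) (_ : Module R E) (_ : Module.Injective R E)
      (i : K →ₗ[R] E), Function.Injective i ∧
        ∀ x : E, x ≠ 0 → ∃ (r : R) (k : K), r • x = i k ∧ r • x ≠ 0 := by
  obtain ⟨⟨Jc, _, j, _⟩⟩ := EnoughInjectives.presentation (ModuleCat.of R K)
  have hJ : Module.Injective R Jc := (Module.injective_iff_injective_object R Jc).2 ‹_›
  have hj : Function.Injective j.hom := (ModuleCat.mono_iff_injective j).1 ‹_›
  -- Inside an injective module containing `K`, take a maximal essential extension `N` of `K`, then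
  -- a maximal `C` with `C ∩ N = 0`. The aim is that `N` is a retract.
  let K₀ : Submodule R Jc := LinearMap.range j.hom
  let P : Set (Submodule R Jc) := {N | K₀ ≤ N ∧ ∀ x ∈ N, x ≠ 0 → ∃ r : R, r • x ∈ K₀ ∧ r • x ≠ 0}
  obtain ⟨N, -, hN⟩ := zorn_le_nonempty₀ P (by
    intro c hc hchain y hy
    refine ⟨sSup c, ⟨(hc hy).1.trans (le_sSup hy), fun x hx h0 => ?_⟩, fun z hz => le_sSup hz⟩
    obtain ⟨z, hz, hxz⟩ := (Submodule.mem_sSup_of_directed ⟨y, hy⟩ hchain.directedOn).1 hx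
    exact (hc hz).2 x hxz h0) K₀ ⟨le_rfl, fun x hx h0 => ⟨1, by simpa using hx, by simpa using h0⟩⟩
  let Q : Set (Submodule R Jc) := {C | ∀ x ∈ C, x ∈ N → x = 0}
  obtain ⟨C, -, hC⟩ := zorn_le_nonempty₀ Q (by
    intro c hc hchain y hy
    refine ⟨sSup c, fun x hx hxN => ?_, fun z hz => le_sSup hz⟩
    obtain ⟨z, hz, hxz⟩ := (Submodule.mem_sSup_of_directed ⟨y, hy⟩ hchain.directedOn).1 hx
    exact hc hz x hxz hxN) ⊥ (fun x hx _ => by simpa using hx)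
  have hinj : Function.Injective (C.mkQ ∘ₗ N.subtype) := by
    rw [← LinearMap.ker_eq_bot, LinearMap.ker_eq_bot']
    intro x hx
    have : (x : Jc) ∈ C := by simpa using hx
    exact Subtype.ext (hC.1 x this x.2)
  obtain ⟨θ, hθ⟩ := hJ.out (C.mkQ ∘ₗ N.subtype) hinj N.subtype
  have hθ' : ∀ x ∈ N, θ (C.mkQ x) = x := fun x hx => hθ ⟨x, hx⟩
  have hker : ∀ z, θ (C.mkQ z) = 0 → z ∈ C := by
    have : LinearMap.ker (θ ∘ₗ C.mkQ) ∈ Q := fun x hx hxN => by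
      rw [← hθ' x hxN]; exact hx
    have h2 := hC.2 this (fun z hz => by
      have : C.mkQ z = 0 := by simpa using hz
      rw [LinearMap.mem_ker, LinearMap.comp_apply, this, map_zero])
    intro z hz
    exact h2 hz
  -- The image of `θ ∘ mkQ` contains `N` and is essential over `K`: if `z ∉ C`, maximality of `C`
  -- gives a nonzero `c + r z` in `N`, and this equals `r` times the image of `z`. Maximality of `N`
  -- then makes the image equal to `N`.
  have hrange : LinearMap.range (θ ∘ₗ C.mkQ) ∈ P := by
    refine ⟨fun x hx => ⟨x, hθ' x (hN.1.1 hx)⟩, ?_⟩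
    rintro _ ⟨z, rfl⟩ h0
    have hzC : z ∉ C := fun hz => h0 (by
      have : C.mkQ z = 0 := by simpa using hz
      rw [LinearMap.comp_apply, this, map_zero])
    have : ¬ (C ⊔ Submodule.span R {z}) ∈ Q := fun hQ =>
      hzC (hC.2 hQ le_sup_left (Submodule.mem_sup_right (Submodule.mem_span_singleton_self z)))
    simp only [Q, Set.mem_ofPred_eq, not_forall] at this
    obtain ⟨x, hx, hxN, hx0⟩ := this
    obtain ⟨c, hc, w, hw, rfl⟩ := Submodule.mem_sup.1 hx
    obtain ⟨r, rfl⟩ := Submodule.mem_span_singleton.1 hw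
    have h1 : r • (θ ∘ₗ C.mkQ) z = c + r • z := by
      rw [← hθ' _ hxN]
      have : C.mkQ c = 0 := by simpa using hc
      rw [map_add, map_add, this]
      simp
    obtain ⟨s, hs, hs0⟩ := hN.1.2 _ hxN hx0
    exact ⟨s * r, by rwa [mul_smul, h1], by rwa [mul_smul, h1]⟩
  have hrN : LinearMap.range (θ ∘ₗ C.mkQ) ≤ N :=
    hN.2 hrange (fun x hx => ⟨x, hθ' x hx⟩)
  let p : Jc →ₗ[R] N := (θ ∘ₗ C.mkQ).codRestrict N (fun x => hrN ⟨x, rfl⟩)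
  refine ⟨N, inferInstance, inferInstance, ⟨fun X Y _ _ _ _ f hf g => ?_⟩,
    j.hom.codRestrict N (fun x => hN.1.1 ⟨x, rfl⟩), ?_, ?_⟩
  · obtain ⟨h, hh⟩ := hJ.out f hf (N.subtype ∘ₗ g)
    refine ⟨p ∘ₗ h, fun x => Subtype.ext ?_⟩
    change θ (C.mkQ (h (f x))) = _
    rw [hh]
    exact hθ' _ (g x).2
  · intro x y hxy
    exact hj (congrArg Subtype.val hxy)
  · intro x h0
    obtain ⟨r, ⟨k, hk⟩, hr0⟩ := hN.1.2 x x.2 (fun h => h0 (Subtype.ext h))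
    exact ⟨r, k, Subtype.ext hk.symm, fun h => hr0 (congrArg Subtype.val h)⟩

/-- `E` is a dualizing module over `R`: it is finitely generated and injective, the linear dual
with values in `E` preserves finite generation, and evaluation into the double dual is bijective
on finitely generated modules. -/
structure IsDualizingModule (R : Type u) [CommRing R] (E : Type u) [AddCommGroup E]
    [Module R E] : Prop where
  injective : Module.Injective R E
  finite_dual : ∀ (N : Type u) [AddCommGroup N] [Module R N] [Module.Finite R N],
    Module.Finite R (N →ₗ[R] E)
  bijective_eval : ∀ (N : Type u) [AddCommGroup N] [Module R N] [Module.Finite R N],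
    Function.Bijective (LinearMap.applyₗ : N →ₗ[R] (N →ₗ[R] E) →ₗ[R] E)

variable (R : Type u) [CommRing R]

/-- If `E` is an essential extension of the product of all simple modules, then the `E`-dual of
a simple module is simple. -/
theorem isSimpleModule_dual (E : Type u) [AddCommGroup E] [Module R E]
    (i : (∀ m : MaximalSpectrum R, R ⧸ m.asIdeal) →ₗ[R] E) (hi : Function.Injective i)
    (hE : ∀ x : E, x ≠ 0 → ∃ (r : R) (k : _), r • x = i k ∧ r • x ≠ 0)
    (S : Type u) [AddCommGroup S] [Module R S] [IsSimpleModule R S] :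
    IsSimpleModule R (S →ₗ[R] E) := by
  classical
  obtain ⟨I, hI, ⟨e⟩⟩ := isSimpleModule_iff_quot_maximal.1 ‹IsSimpleModule R S›
  let m : MaximalSpectrum R := ⟨I, hI⟩
  have hsimple : IsSimpleModule R (R ⧸ I) := isSimpleModule_iff_quot_maximal.2 ⟨I, hI, ⟨.refl _ _⟩⟩
  have : Nontrivial S := IsSimpleModule.nontrivial R S
  obtain ⟨s₀, hs₀⟩ := exists_ne (0 : S)
  have hgen := IsSimpleModule.toSpanSingleton_surjective R hs₀
  have hann : ∀ a ∈ I, ∀ s : S, a • s = 0 := fun a ha s => by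
    apply e.injective
    rw [map_smul, map_zero]
    obtain ⟨b, hb⟩ := Ideal.Quotient.mk_surjective (e s)
    rw [← hb, ← Ideal.Quotient.mk_eq_mk, ← Submodule.Quotient.mk_smul, Submodule.Quotient.mk_eq_zero]
    exact I.mul_mem_right _ ha
  -- The value `f s₀` lies in the copy of `R ⧸ I`: essentiality puts a nonzero multiple of it in the
  -- product, simplicity of `S` removes the scalar, and a coordinate at `n ≠ I` vanishes because
  -- some element of `I` lies outside the prime `n`.
  have key : ∀ f : S →ₗ[R] E, f ≠ 0 → ∃ x : R ⧸ I, x ≠ 0 ∧ f s₀ = i (Pi.single m x) := by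
    intro f hf
    have hf0 : f s₀ ≠ 0 := fun h => hf (by
      ext s
      obtain ⟨r, rfl⟩ := hgen s
      simp [h])
    obtain ⟨r, k, hk, hr⟩ := hE _ hf0
    have hrs : r • s₀ ≠ 0 := fun h => hr (by rw [← map_smul, h, map_zero])
    obtain ⟨t, ht⟩ := IsSimpleModule.toSpanSingleton_surjective R hrs s₀
    have h1 : f s₀ = i (t • k) := by
      rw [map_smul, ← hk, ← map_smul, ← map_smul]; exact congrArg f ht.symm
    have h2 : t • k = Pi.single m ((t • k) m) := by
      ext n
      by_cases hn : n = m
      · subst hn; simp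
      · rw [Pi.single_eq_of_ne hn]
        have hle : ¬ I ≤ n.asIdeal := fun hle =>
          hn (MaximalSpectrum.ext (hI.eq_of_le n.isMaximal.ne_top hle).symm)
        obtain ⟨a, ha, han⟩ := SetLike.not_le_iff_exists.1 hle
        have h3 : a • (t • k) = 0 := hi (by
          rw [map_smul, ← h1, ← map_smul, hann a ha, map_zero, map_zero])
        have h4 : Ideal.Quotient.mk n.asIdeal a * (t • k) n = 0 := congrFun h3 n
        have := n.isMaximal.isPrime
        rcases mul_eq_zero.1 h4 with h5 | h5
        · exact absurd (Ideal.Quotient.eq_zero_iff_mem.1 h5) han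
        · exact h5
    rw [h2] at h1
    refine ⟨_, fun h => hf0 ?_, h1⟩
    rw [h1, h, Pi.single_zero, map_zero]
  rw [isSimpleModule_iff_toSpanSingleton_surjective]
  refine ⟨⟨⟨i ∘ₗ LinearMap.single R _ m ∘ₗ e.toLinearMap, 0, fun h => hs₀ ?_⟩⟩, ?_⟩
  · have := congrArg (fun f => f s₀) h
    apply e.injective
    rw [map_zero]
    exact Pi.single_injective m ((hi (this.trans (map_zero i).symm)).trans (Pi.single_zero m).symm)
  · intro f hf g
    by_cases hg : g = 0
    · exact ⟨0, by simp [hg]⟩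
    obtain ⟨x, hx, hfx⟩ := key f hf
    obtain ⟨y, hy, hgy⟩ := key g hg
    obtain ⟨r, hr⟩ := IsSimpleModule.toSpanSingleton_surjective R hx y
    refine ⟨r, ?_⟩
    have h0 : r • f s₀ = g s₀ := by
      rw [hfx, hgy, ← hr, ← map_smul, ← Pi.single_smul]
      rfl
    ext s
    obtain ⟨t, rfl⟩ := hgen s
    simp [← h0]

/-- Injectivity of `E` makes duality exact, so lengths add up along a composition series whose
simple factors have simple duals. -/
theorem length_dual (E : Type u) [AddCommGroup E] [Module R E] [Module.Injective R E]
    (hE : ∀ (S : Type u) [AddCommGroup S] [Module R S] [IsSimpleModule R S],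
      IsSimpleModule R (S →ₗ[R] E)) (N : Type u) [AddCommGroup N] [Module R N]
    (hN : IsFiniteLength R N) : Module.length R (N →ₗ[R] E) = Module.length R N := by
  induction hN with
  | of_subsingleton => rw [Module.length_eq_zero, Module.length_eq_zero]
  | @of_simple_quotient M _ _ N hs _ ih =>
    rw [Module.length_eq_add_of_exact (LinearMap.lcomp R E N.mkQ) (LinearMap.lcomp R E N.subtype)
      (fun f g h => by ext x; exact LinearMap.congr_fun h x)
      (fun g => by
        obtain ⟨h, hh⟩ := Module.Injective.out (R := R) N.subtype N.injective_subtype g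
        exact ⟨h, LinearMap.ext hh⟩)
      (fun f => ⟨fun h => ⟨N.liftQ f (fun x hx => LinearMap.congr_fun h ⟨x, hx⟩), by
        ext x; rfl⟩, by
          rintro ⟨g, rfl⟩
          ext x
          have : N.mkQ x = 0 := by simp
          change g (N.mkQ x) = 0
          rw [this, map_zero]⟩), ih,
      Module.length_eq_add_of_exact N.subtype N.mkQ N.injective_subtype N.mkQ_surjective
        (LinearMap.exact_subtype_mkQ N)]
    have := hE (M ⧸ N)
    rw [Module.length_eq_one R (M ⧸ N), Module.length_eq_one R ((M ⧸ N) →ₗ[R] E), add_comm]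

/-- Take for `E` an injective essential extension of the product of all simple modules. Evaluation
is injective because a nonzero cyclic module has a simple quotient, which carries a nonzero form;
equality of finite lengths then forces surjectivity. -/
theorem exists_isDualizingModule [IsArtinianRing R] :
    ∃ (E : Type u) (_ : AddCommGroup E) (_ : Module R E), IsDualizingModule R E := by
  classical
  obtain ⟨E, _, _, _, i, hi, hE⟩ :=
    exists_injective_essential R (∀ m : MaximalSpectrum R, R ⧸ m.asIdeal)
  have hs := fun (S : Type u) [AddCommGroup S] [Module R S] [IsSimpleModule R S] =>
    isSimpleModule_dual R E i hi hE S
  have hfin : ∀ (N : Type u) [AddCommGroup N] [Module R N] [Module.Finite R N],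
      IsFiniteLength R N := fun N _ _ _ =>
    isFiniteLength_iff_isNoetherian_isArtinian.2 ⟨inferInstance, inferInstance⟩
  have hlen := fun (N : Type u) [AddCommGroup N] [Module R N] (h : IsFiniteLength R N) =>
    length_dual R E hs N h
  have hd : ∀ (N : Type u) [AddCommGroup N] [Module R N], IsFiniteLength R N →
      IsFiniteLength R (N →ₗ[R] E) := fun N _ _ h => by
    rw [← Module.length_ne_top_iff, hlen N h, Module.length_ne_top_iff]; exact h
  refine ⟨E, _, _, ‹_›, fun N _ _ _ => ?_, fun N _ _ _ => ?_⟩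
  · have := (isFiniteLength_iff_isNoetherian_isArtinian.1 (hd N (hfin N))).1
    infer_instance
  · have hinj : Function.Injective (LinearMap.applyₗ : N →ₗ[R] (N →ₗ[R] E) →ₗ[R] E) := by
      rw [← LinearMap.ker_eq_bot, LinearMap.ker_eq_bot']
      intro x hx
      by_contra h0
      have : Nontrivial (Submodule.span R {x}) :=
        ⟨⟨x, Submodule.mem_span_singleton_self x⟩, 0, fun h => h0 (congrArg Subtype.val h)⟩
      obtain ⟨T, hT⟩ := IsCoatomic.exists_coatom (Submodule R (Submodule.span R {x}))
      have hsimple : IsSimpleModule R (Submodule.span R {x} ⧸ T) :=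
        isSimpleModule_iff_isCoatom.2 hT
      have := (hs (Submodule.span R {x} ⧸ T)).nontrivial
      obtain ⟨f, hf⟩ := exists_ne (0 : (Submodule.span R {x} ⧸ T) →ₗ[R] E)
      obtain ⟨g, hg⟩ := Module.Injective.out (R := R) (Submodule.span R {x}).subtype
        (Submodule.injective_subtype _) (f ∘ₗ T.mkQ)
      apply hf
      ext ⟨y, hy⟩
      obtain ⟨r, rfl⟩ := Submodule.mem_span_singleton.1 hy
      have h1 : g x = 0 := LinearMap.congr_fun hx g
      have h2 := hg ⟨r • x, hy⟩
      refine h2.symm.trans ?_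
      change g (r • x) = 0
      rw [map_smul, h1, smul_zero]
    refine ⟨hinj, ?_⟩
    have hl : Module.length R ((N →ₗ[R] E) →ₗ[R] E) = Module.length R N := by
      rw [hlen _ (hd N (hfin N)), hlen N (hfin N)]
    have hadd := Module.length_eq_add_of_exact (LinearMap.applyₗ : N →ₗ[R] (N →ₗ[R] E) →ₗ[R] E)
      (LinearMap.range (LinearMap.applyₗ : N →ₗ[R] (N →ₗ[R] E) →ₗ[R] E)).mkQ hinj
      (Submodule.mkQ_surjective _) (LinearMap.exact_map_mkQ_range _)
    rw [hl] at hadd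
    have h0 : Module.length R (((N →ₗ[R] E) →ₗ[R] E) ⧸
        LinearMap.range (LinearMap.applyₗ : N →ₗ[R] (N →ₗ[R] E) →ₗ[R] E)) = 0 := by
      have := Module.length_ne_top_iff.2 (hfin N)
      exact ENat.add_right_injective_of_ne_top this (hadd.symm.trans (add_zero _).symm)
    rw [Module.length_eq_zero_iff, Submodule.Quotient.subsingleton_iff,
      LinearMap.range_eq_top] at h0
    exact h0

end Matlis

/-! ### Finitely presented functors in terms of elements -/

section Elements

open Opposite

variable {C : Type u} [Category.{v} C]

/-- The restriction map `F(B) → F(Y)` along `g : Y ⟶ B`. -/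
def res (F : Cᵒᵖ ⥤ AddCommGrpCat.{w}) {Y B : C} (g : Y ⟶ B) : F.obj (op B) →+ F.obj (op Y) :=
  (F.map g.op).hom

/-- The components of a natural transformation. -/
def ap {F G : Cᵒᵖ ⥤ AddCommGrpCat.{w}} (α : F ⟶ G) (Y : C) : F.obj (op Y) →+ G.obj (op Y) :=
  (α.app (op Y)).hom

section

variable (F : Cᵒᵖ ⥤ AddCommGrpCat.{w}) {G H : Cᵒᵖ ⥤ AddCommGrpCat.{w}}

@[simp] lemma res_id (Y : C) (x : F.obj (op Y)) : res F (𝟙 Y) x = x := by simp [res]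

@[simp] lemma res_comp {X Y Z : C} (f : X ⟶ Y) (g : Y ⟶ Z) (x : F.obj (op Z)) :
    res F (f ≫ g) x = res F f (res F g x) := by simp [res]

variable {F}

lemma ap_res (α : F ⟶ G) {Y B : C} (g : Y ⟶ B) (x : F.obj (op B)) :
    ap α Y (res F g x) = res G g (ap α B x) :=
  ConcreteCategory.congr_hom (α.naturality g.op) x

@[simp] lemma ap_comp (α : F ⟶ G) (β : G ⟶ H) (Y : C) (x : F.obj (op Y)) :
    ap (α ≫ β) Y x = ap β Y (ap α Y x) := rfl

@[simp] lemma ap_id (Y : C) (x : F.obj (op Y)) : ap (𝟙 F) Y x = x := rfl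

@[simp] lemma ap_zero (Y : C) (x : F.obj (op Y)) : ap (0 : F ⟶ G) Y x = 0 := rfl

lemma natTrans_ext {α β : F ⟶ G} (h : ∀ Y x, ap α Y x = ap β Y x) : α = β := by
  ext Y x
  exact h Y.unop x

/-- Construct a natural transformation from additive maps compatible with restriction. -/
def homMkAp (φ : ∀ Y : C, F.obj (op Y) →+ G.obj (op Y))
    (h : ∀ {Y B : C} (g : Y ⟶ B) (x), φ Y (res F g x) = res G g (φ B x)) : F ⟶ G where
  app Y := AddCommGrpCat.ofHom (φ Y.unop)
  naturality _ _ g := by ext x; exact h g.unop x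

end

section

variable {F G H : Cᵒᵖ ⥤ AddCommGrpCat.{w}}

lemma exact_iff_ap (α : F ⟶ G) (β : G ⟶ H) (w : α ≫ β = 0) :
    (ShortComplex.mk α β w).Exact ↔ ∀ Y y, ap β Y y = 0 → ∃ x, ap α Y x = y := by
  have key : (ShortComplex.mk α β w).Exact ↔
      ∀ Y, ((ShortComplex.mk α β w).map ((evaluation _ _).obj Y)).Exact := by
    refine ⟨fun h Y => h.map _, fun h => ?_⟩
    rw [ShortComplex.exact_iff_isZero_homology, Functor.isZero_iff]
    intro Y
    exact ((ShortComplex.exact_iff_isZero_homology _).1 (h Y)).of_iso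
      (ShortComplex.mapHomologyIso _ ((evaluation _ _).obj Y)).symm
  rw [key]
  simp_rw [ShortComplex.ab_exact_iff]
  exact ⟨fun h Y y => h (op Y) y, fun h Y y => h Y.unop y⟩

lemma mono_iff_ap (α : F ⟶ G) : Mono α ↔ ∀ Y, Function.Injective (ap α Y) := by
  rw [NatTrans.mono_iff_mono_app]
  simp_rw [AddCommGrpCat.mono_iff_injective]
  exact ⟨fun h Y => h (op Y), fun h Y => h Y.unop⟩

lemma epi_iff_ap (α : F ⟶ G) : Epi α ↔ ∀ Y, Function.Surjective (ap α Y) := by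
  rw [NatTrans.epi_iff_epi_app]
  simp_rw [AddCommGrpCat.epi_iff_surjective]
  exact ⟨fun h Y => h (op Y), fun h Y => h Y.unop⟩

end

/-! ### Representable functors and presentations by an element. -/

variable [Preadditive C] {F G H : Cᵒᵖ ⥤ AddCommGrpCat.{v}}

lemma res_add (hF : F.Additive) {Y B : C} (f g : Y ⟶ B) (x : F.obj (op B)) :
    res F (f + g) x = res F f x + res F g x := by
  simp [res, op_add, F.map_add]

lemma res_sub (hF : F.Additive) {Y B : C} (f g : Y ⟶ B) (x : F.obj (op B)) :
    res F (f - g) x = res F f x - res F g x := by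
  simp [res, op_sub, F.map_sub]

lemma res_zero (hF : F.Additive) {Y B : C} (x : F.obj (op B)) :
    res F (0 : Y ⟶ B) x = 0 := by
  simp [res, F.map_zero]

lemma additive_of_res (h : ∀ {Y B : C} (f g : Y ⟶ B) (x : F.obj (op B)),
    res F (f + g) x = res F f x + res F g x) : F.Additive where
  map_add {X Y f g} := by ext x; exact h f.unop g.unop x

/-- A morphism `Y ⟶ B`, seen as an element of the functor represented by `B`. -/
def yel {Y B : C} (g : Y ⟶ B) : (preadditiveYoneda.obj B).obj (op Y) := g

lemma yel_surjective {Y B : C} (y : (preadditiveYoneda.obj B).obj (op Y)) :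
    ∃ g : Y ⟶ B, yel g = y := ⟨y, rfl⟩

lemma yel_injective {Y B : C} {f g : Y ⟶ B} (h : yel f = yel g) : f = g := h

@[simp] lemma yel_zero {Y B : C} : yel (0 : Y ⟶ B) = 0 := rfl

@[simp] lemma yel_add {Y B : C} (f g : Y ⟶ B) : yel (f + g) = yel f + yel g := rfl

@[simp] lemma res_yel {X Y B : C} (g : X ⟶ Y) (x : Y ⟶ B) :
    res (preadditiveYoneda.obj B) g (yel x) = yel (g ≫ x) := rfl

lemma additive_yoneda (B : C) : (preadditiveYoneda.obj B).Additive :=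
  additive_of_res fun f g x => by
    obtain ⟨x, rfl⟩ := yel_surjective x
    simp

/-- The morphism from a representable functor given by an element. -/
def yonedaHom (hF : F.Additive) {B : C} (x : F.obj (op B)) : preadditiveYoneda.obj B ⟶ F :=
  homMkAp (fun Y => AddMonoidHom.mk' (fun g : Y ⟶ B => res F g x)
    (fun f g => res_add hF f g x)) (fun g h => res_comp F g h x)

@[simp] lemma ap_yonedaHom (hF : F.Additive) {Y B : C} (x : F.obj (op B)) (g : Y ⟶ B) :
    ap (yonedaHom hF x) Y (yel g) = res F g x := rfl

@[simp] lemma ap_yoneda_map {Y A B : C} (f : A ⟶ B) (g : Y ⟶ A) :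
    ap (preadditiveYoneda.map f) Y (yel g) = yel (g ≫ f) := rfl

lemma ap_of_yoneda {B Y : C} (p : preadditiveYoneda.obj B ⟶ F) (g : Y ⟶ B) :
    ap p Y (yel g) = res F g (ap p B (yel (𝟙 B))) := by
  rw [← ap_res, res_yel, Category.comp_id]

lemma yoneda_hom_ext {B : C} {p q : preadditiveYoneda.obj B ⟶ F}
    (h : ap p B (yel (𝟙 B)) = ap q B (yel (𝟙 B))) : p = q := by
  refine natTrans_ext fun Y g => ?_
  obtain ⟨g, rfl⟩ := yel_surjective g
  rw [ap_of_yoneda, h, ← ap_of_yoneda]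

/-- `x ∈ F(B)` generates `F`. -/
def IsGenerator (F : Cᵒᵖ ⥤ AddCommGrpCat.{v}) {B : C} (x : F.obj (op B)) : Prop :=
  ∀ {Y : C} (y : F.obj (op Y)), ∃ g : Y ⟶ B, res F g x = y

/-- `x ∈ F(B)` generates `F`, and its relations are generated by `f : A ⟶ B`. -/
structure IsPresentation (F : Cᵒᵖ ⥤ AddCommGrpCat.{v}) {A B : C} (f : A ⟶ B)
    (x : F.obj (op B)) : Prop where
  res_eq_zero : res F f x = 0
  isGenerator : IsGenerator F x
  exists_factor : ∀ {Y : C} (g : Y ⟶ B), res F g x = 0 → ∃ h : Y ⟶ A, h ≫ f = g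

lemma isFinPres_iff : isFinPres C F ↔
    F.Additive ∧ ∃ (A B : C) (f : A ⟶ B) (x : F.obj (op B)), IsPresentation F f x := by
  refine and_congr_right fun hF => ⟨?_, ?_⟩
  · rintro ⟨A, B, f, p, w, hex, hp⟩
    rw [exact_iff_ap] at hex
    rw [epi_iff_ap] at hp
    refine ⟨A, B, f, ap p B (yel (𝟙 B)), ?_, fun {Y} y => ?_, fun {Y} g hg => ?_⟩
    · rw [← ap_of_yoneda]
      have := congrArg (fun q => ap q A (yel (𝟙 A))) w
      simpa only [ap_comp, ap_yoneda_map, Category.id_comp, ap_zero] using this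
    · obtain ⟨g, hg⟩ := hp Y y
      obtain ⟨g, rfl⟩ := yel_surjective g
      exact ⟨g, by rw [← ap_of_yoneda, hg]⟩
    · rw [← ap_of_yoneda] at hg
      obtain ⟨h, hh⟩ := hex Y _ hg
      exact ⟨h, hh⟩
  · rintro ⟨A, B, f, x, h⟩
    have w : preadditiveYoneda.map f ≫ yonedaHom hF x = 0 := yoneda_hom_ext (by
      simp [h.res_eq_zero])
    refine ⟨A, B, f, yonedaHom hF x, w, ?_, ?_⟩
    · rw [exact_iff_ap]
      intro Y g hg
      obtain ⟨g, rfl⟩ := yel_surjective g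
      obtain ⟨k, hk⟩ := h.exists_factor g hg
      exact ⟨yel k, by rw [ap_yoneda_map, hk]⟩
    · rw [epi_iff_ap]
      exact fun Y y => h.isGenerator y

omit [Preadditive C] in
lemma IsPresentation.hom_ext {A B : C} {f : A ⟶ B} {x : F.obj (op B)} (h : IsPresentation F f x)
    {α β : F ⟶ G} (hαβ : ap α B x = ap β B x) : α = β := by
  refine natTrans_ext fun Y y => ?_
  obtain ⟨g, rfl⟩ := h.isGenerator y
  rw [ap_res, ap_res, hαβ]

/-- The value at `res F g x` has to be `res G g z`; it is well defined because every relation on `x`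
factors through `f`, which kills `z`. -/
lemma IsPresentation.exists_desc {A B : C} {f : A ⟶ B} {x : F.obj (op B)}
    (h : IsPresentation F f x) (hF : F.Additive) (hG : G.Additive) (z : G.obj (op B))
    (hz : res G f z = 0) : ∃ α : F ⟶ G, ap α B x = z := by
  have wd : ∀ {Y : C} (g g' : Y ⟶ B), res F g x = res F g' x → res G g z = res G g' z := by
    intro Y g g' hgg
    obtain ⟨k, hk⟩ := h.exists_factor (g - g') (by rw [res_sub hF, hgg, sub_self])
    rw [← sub_eq_zero, ← res_sub hG, ← hk, res_comp, hz, map_zero]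
  choose s hs using fun (Y : C) (y : F.obj (op Y)) => h.isGenerator y
  refine ⟨homMkAp (fun Y => AddMonoidHom.mk' (fun y => res G (s Y y) z) (fun y y' => ?_)) ?_, ?_⟩
  · rw [← res_add hG]
    exact wd _ _ (by rw [hs, res_add hF, hs, hs])
  · intro Y Z g y
    change res G (s Y _) z = res G g (res G (s Z y) z)
    rw [← res_comp]
    exact wd _ _ (by rw [hs, res_comp, hs])
  · change res G (s B x) z = z
    conv_rhs => rw [← res_id G B z]
    exact wd _ _ (by rw [hs, res_id])

/-! ### Weak pullbacks and closure under kernels and cokernels. -/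

variable (C) in
/-- Every cospan in `C` has a weak pullback. -/
def HasWeakPullbacks : Prop :=
  ∀ ⦃A B D : C⦄ (f : A ⟶ D) (g : B ⟶ D), ∃ (W : C) (a : W ⟶ A) (b : W ⟶ B), a ≫ f = b ≫ g ∧
    ∀ ⦃Y : C⦄ (a' : Y ⟶ A) (b' : Y ⟶ B), a' ≫ f = b' ≫ g → ∃ t : Y ⟶ W, t ≫ a = a' ∧ t ≫ b = b'

/-- The element `res F g x` is killed by `α` exactly when `g ≫ b` factors through the relations `f'`
of `G`, so a weak pullback of `b` and `f'` is a weakly universal choice of `g`. -/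
lemma exists_kernel_generator (hC : HasWeakPullbacks C) (α : F ⟶ G) {B : C}
    {x : F.obj (op B)} (hx : IsGenerator F x) (hG : isFinPres C G) :
    ∃ (W : C) (k : F.obj (op W)), ap α W k = 0 ∧
      ∀ {Y : C} (y : F.obj (op Y)), ap α Y y = 0 → ∃ g : Y ⟶ W, res F g k = y := by
  obtain ⟨-, A', B', f', x', h'⟩ := isFinPres_iff.1 hG
  obtain ⟨b, hb⟩ := h'.isGenerator (ap α B x)
  obtain ⟨W, w₁, w₂, hw, hW⟩ := hC b f'
  refine ⟨W, res F w₁ x, ?_, fun {Y} y hy => ?_⟩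
  · rw [ap_res, ← hb, ← res_comp, hw, res_comp, h'.res_eq_zero, map_zero]
  · obtain ⟨g, rfl⟩ := hx y
    rw [ap_res, ← hb, ← res_comp] at hy
    obtain ⟨h, hh⟩ := h'.exists_factor _ hy
    obtain ⟨t, ht, -⟩ := hW g h hh.symm
    exact ⟨t, by rw [← ht, res_comp]⟩

lemma isGenerator_yel_id (B : C) : IsGenerator (preadditiveYoneda.obj B) (yel (𝟙 B)) := by
  intro Y y
  obtain ⟨g, rfl⟩ := yel_surjective y
  exact ⟨g, by simp⟩

lemma isFinPres_yoneda (B : C) :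
    isFinPres C (preadditiveYoneda.obj B) := by
  refine isFinPres_iff.2 ⟨additive_yoneda B, B, B, 0, yel (𝟙 B), ?_, isGenerator_yel_id B, ?_⟩
  · rw [res_yel, zero_comp, yel_zero]
  · intro Y g hg
    rw [res_yel, Category.comp_id] at hg
    exact ⟨0, by rw [comp_zero]; exact hg.symm⟩

/-- Generators of kernels are produced twice: for the kernel of `β`, then for the relations on the
resulting generator. -/
lemma isFinPres_of_kernel (hC : HasWeakPullbacks C) (α : F ⟶ G) (β : G ⟶ H)
    (hG : isFinPres C G) (hH : isFinPres C H) (hα : ∀ Y, Function.Injective (ap α Y))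
    (hαβ : ∀ Y x, ap β Y (ap α Y x) = 0)
    (hex : ∀ Y y, ap β Y y = 0 → ∃ x, ap α Y x = y) : isFinPres C F := by
  have hF : F.Additive := additive_of_res fun f g x => hα _ (by
    rw [ap_res, res_add hG.1, map_add, ap_res, ap_res])
  obtain ⟨_, A, B, f, x, h⟩ := isFinPres_iff.1 hG
  obtain ⟨W, k, hk, hW⟩ := exists_kernel_generator hC β h.isGenerator hH
  obtain ⟨w, rfl⟩ := hex W k hk
  obtain ⟨W', f', hf', hW'⟩ := exists_kernel_generator hC (yonedaHom hF w ≫ α)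
    (isGenerator_yel_id W) hG
  obtain ⟨f', rfl⟩ := yel_surjective f'
  refine isFinPres_iff.2 ⟨hF, W', W, f', w, ?_, fun {Y} y => ?_, fun {Y} g hg => ?_⟩
  · exact hα _ (by rw [map_zero]; exact hf')
  · obtain ⟨g, hg⟩ := hW (ap α Y y) (hαβ Y y)
    exact ⟨g, hα _ (by rw [ap_res, hg])⟩
  · obtain ⟨h, hh⟩ := hW' (yel g) (by rw [ap_comp, ap_yonedaHom, hg, map_zero])
    exact ⟨h, yel_injective hh⟩

lemma isFinPres_of_cokernel (hC : HasWeakPullbacks C) (α : F ⟶ G) (β : G ⟶ H)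
    (hF : isFinPres C F) (hG : isFinPres C G) (hβ : ∀ Y, Function.Surjective (ap β Y))
    (hαβ : ∀ Y x, ap β Y (ap α Y x) = 0)
    (hex : ∀ Y y, ap β Y y = 0 → ∃ x, ap α Y x = y) : isFinPres C H := by
  have hH : H.Additive := additive_of_res fun f g x => by
    obtain ⟨x, rfl⟩ := hβ _ x
    rw [← ap_res, ← ap_res, ← ap_res, res_add hG.1, map_add]
  obtain ⟨_, A', B', f', x', h'⟩ := isFinPres_iff.1 hF
  obtain ⟨_, A, B, f, x, h⟩ := isFinPres_iff.1 hG
  obtain ⟨b, hb⟩ := h.isGenerator (ap α B' x')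
  -- A weak pullback of two zero morphisms is a weak product; it plays the role of `A ⊕ B'`.
  obtain ⟨W, w₁, w₂, -, hW⟩ := hC (0 : A ⟶ A) (0 : B' ⟶ A)
  refine isFinPres_iff.2 ⟨hH, W, B, w₁ ≫ f + w₂ ≫ b, ap β B x, ?_, fun {Y} y => ?_,
    fun {Y} g hg => ?_⟩
  · rw [← ap_res, res_add hG.1, res_comp, res_comp, h.res_eq_zero, hb, map_zero, zero_add,
      ← ap_res, hαβ]
  · obtain ⟨y, rfl⟩ := hβ _ y
    obtain ⟨g, rfl⟩ := h.isGenerator y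
    exact ⟨g, (ap_res _ _ _).symm⟩
  · rw [← ap_res] at hg
    obtain ⟨y, hy⟩ := hex _ _ hg
    obtain ⟨k, rfl⟩ := h'.isGenerator y
    rw [ap_res, ← hb, ← res_comp] at hy
    obtain ⟨l, hl⟩ := h.exists_factor (g - k ≫ b) (by rw [res_sub hG.1, hy, sub_self])
    obtain ⟨t, ht₁, ht₂⟩ := hW l k (by simp)
    exact ⟨t, by rw [Preadditive.comp_add, ← Category.assoc, ← Category.assoc, ht₁, ht₂, hl,
      sub_add_cancel]⟩

end Elements

/-! ### Projectives and short exact sequences in the category of finitely presented functors -/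

section FinPresMod

open Opposite

variable {C : Type u} [Category.{v} C] [Preadditive C]

lemma FinPresMod.additive (F : FinPresMod C) : F.obj.Additive := F.property.1

variable (C) in
/-- The Yoneda embedding into the category of finitely presented functors. -/
def finPresYoneda : C ⥤ FinPresMod C :=
  (isFinPres C).lift preadditiveYoneda isFinPres_yoneda

/-- The morphism from a representable functor given by an element. -/
def finPresYonedaHom (F : FinPresMod C) {B : C} (x : F.obj.obj (op B)) :
    (finPresYoneda C).obj B ⟶ F :=
  ObjectProperty.homMk (yonedaHom F.additive x)

/-- The element corresponding to a morphism from a representable functor. -/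
def gen {F : FinPresMod C} {B : C} (p : (finPresYoneda C).obj B ⟶ F) : F.obj.obj (op B) :=
  ap (F := preadditiveYoneda.obj B) p.hom B (yel (𝟙 B))

lemma gen_injective {F : FinPresMod C} {B : C} {p q : (finPresYoneda C).obj B ⟶ F}
    (h : gen p = gen q) : p = q :=
  ObjectProperty.hom_ext _ (yoneda_hom_ext h)

@[simp] lemma gen_comp {F G : FinPresMod C} {B : C} (p : (finPresYoneda C).obj B ⟶ F)
    (q : F ⟶ G) : gen (p ≫ q) = ap q.hom B (gen p) := rfl

@[simp] lemma gen_map_comp {F : FinPresMod C} {A B : C} (f : A ⟶ B)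
    (p : (finPresYoneda C).obj B ⟶ F) :
    gen ((finPresYoneda C).map f ≫ p) = res F.obj f (gen p) := by
  refine Eq.trans ?_ (ap_of_yoneda (F := F.obj) (B := B) p.hom f)
  change ap (F := preadditiveYoneda.obj B) p.hom A (ap (preadditiveYoneda.map f) A (yel (𝟙 A))) = _
  rw [ap_yoneda_map, Category.id_comp]

@[simp] lemma gen_zero {F : FinPresMod C} {B : C} : gen (0 : (finPresYoneda C).obj B ⟶ F) = 0 := rfl

@[simp] lemma gen_finPresYonedaHom {F : FinPresMod C} {B : C} (x : F.obj.obj (op B)) :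
    gen (finPresYonedaHom F x) = x := by
  change ap (yonedaHom F.additive x) B (yel (𝟙 B)) = x
  rw [ap_yonedaHom, res_id]

@[simp] lemma gen_map {A B : C} (f : A ⟶ B) : gen ((finPresYoneda C).map f) = yel f := by
  change ap (preadditiveYoneda.map f) A (yel (𝟙 A)) = _
  rw [ap_yoneda_map, Category.id_comp]

lemma exists_eq_finPresYoneda_map {A B : C} (φ : (finPresYoneda C).obj A ⟶ (finPresYoneda C).obj B) :
    ∃ f : A ⟶ B, (finPresYoneda C).map f = φ := by
  obtain ⟨f, hf⟩ := yel_surjective (gen φ)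
  exact ⟨f, gen_injective (by rw [gen_map, hf])⟩

lemma finPresYoneda_map_injective {A B : C} {f g : A ⟶ B}
    (h : (finPresYoneda C).map f = (finPresYoneda C).map g) : f = g := by
  exact yel_injective (by rw [← gen_map f, h, gen_map])

lemma injective_ap_of_mono {F G : FinPresMod C} (i : F ⟶ G) [Mono i] (Y : C) :
    Function.Injective (ap i.hom Y) := by
  rw [injective_iff_map_eq_zero]
  intro x hx
  have h : finPresYonedaHom F x ≫ i = 0 := gen_injective (by
    rw [gen_comp, gen_finPresYonedaHom, hx, gen_zero])
  have h0 : finPresYonedaHom F x = 0 := zero_of_comp_mono i h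
  rw [← gen_finPresYonedaHom x, h0, gen_zero]

/-- The cokernel formed among all functors is again finitely presented, so an epimorphism of `mod C`
already has zero cokernel there. -/
lemma surjective_ap_of_epi (hC : HasWeakPullbacks C) {F G : FinPresMod C} (p : F ⟶ G) [Epi p]
    (Y : C) : Function.Surjective (ap p.hom Y) := by
  have hex := (exact_iff_ap _ _ _).1 (ShortComplex.exact_cokernel p.hom)
  have hs := (epi_iff_ap (cokernel.π p.hom)).1 inferInstance
  have hz : ∀ Y x, ap (cokernel.π p.hom) Y (ap p.hom Y x) = 0 := fun Y x => by
    rw [← ap_comp, cokernel.condition, ap_zero]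
  let Q : FinPresMod C :=
    ⟨cokernel p.hom, isFinPres_of_cokernel hC p.hom _ F.property G.property hs hz hex⟩
  let q : G ⟶ Q := ObjectProperty.homMk (cokernel.π p.hom)
  have hq : q = 0 := zero_of_epi_comp p
    (ObjectProperty.hom_ext _ (natTrans_ext fun Y x => hz Y x))
  intro y
  exact hex Y y (by
    have : cokernel.π p.hom = 0 := congrArg (fun φ => φ.hom) hq
    rw [this, ap_zero])

lemma epi_of_surjective_ap {F G : FinPresMod C} (p : F ⟶ G)
    (h : ∀ Y, Function.Surjective (ap p.hom Y)) : Epi p where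
  left_cancellation a b hab := ObjectProperty.hom_ext _ (natTrans_ext fun Y y => by
    obtain ⟨x, rfl⟩ := h Y y
    exact congrArg (fun φ => ap φ.hom Y x) hab)

lemma projective_finPresYoneda (hC : HasWeakPullbacks C) (B : C) :
    Projective ((finPresYoneda C).obj B) where
  factors {F G} f e he := by
    obtain ⟨x, hx⟩ := surjective_ap_of_epi hC e B (gen f)
    refine ⟨finPresYonedaHom _ x, gen_injective ?_⟩
    rw [gen_comp, gen_finPresYonedaHom, hx]

lemma exists_epi_finPresYoneda (F : FinPresMod C) :
    ∃ (B : C) (p : (finPresYoneda C).obj B ⟶ F), Epi p := by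
  obtain ⟨hF, A, B, f, x, h⟩ := isFinPres_iff.1 F.property
  refine ⟨B, finPresYonedaHom F x, epi_of_surjective_ap _ fun Y y => ?_⟩
  obtain ⟨g, hg⟩ := h.isGenerator y
  exact ⟨yel g, hg⟩

/-- A projective is a retract of a representable; by full faithfulness of the Yoneda embedding the
retraction is an idempotent of `C`, which splits. -/
lemma exists_iso_finPresYoneda [IsIdempotentComplete C] (P : FinPresMod C) [Projective P] :
    ∃ X : C, Nonempty (P ≅ (finPresYoneda C).obj X) := by
  obtain ⟨B, q, _⟩ := exists_epi_finPresYoneda P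
  let s := Projective.factorThru (𝟙 P) q
  have hs : s ≫ q = 𝟙 P := Projective.factorThru_comp _ _
  obtain ⟨e, he⟩ := exists_eq_finPresYoneda_map (q ≫ s)
  obtain ⟨X, i, r, hir, hri⟩ := IsIdempotentComplete.idempotents_split B e
    (finPresYoneda_map_injective (by
      rw [Functor.map_comp, he, Category.assoc, reassoc_of% hs]))
  refine ⟨X, ⟨⟨s ≫ (finPresYoneda C).map r, (finPresYoneda C).map i ≫ q, ?_, ?_⟩⟩⟩
  · rw [Category.assoc, ← Functor.map_comp_assoc, hri, he, Category.assoc, hs, Category.comp_id, hs]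
  · rw [Category.assoc, ← reassoc_of% he, ← Functor.map_comp, ← Functor.map_comp,
      ← hri, Category.assoc, hir, Category.comp_id, hir, CategoryTheory.Functor.map_id]

/-- `i` is a kernel of `p` and `p` is a cokernel of `i`. -/
def IsKernelCokernelPair {D : Type*} [Category D] [Preadditive D] {F G H : D} (i : F ⟶ G)
    (p : G ⟶ H) : Prop :=
  i ≫ p = 0 ∧ (∀ (Z : D) (k : Z ⟶ G), k ≫ p = 0 → ∃! l : Z ⟶ F, l ≫ i = k) ∧
    ∀ (Z : D) (k : G ⟶ Z), i ≫ k = 0 → ∃! l : H ⟶ Z, p ≫ l = k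

lemma isShortExact_iff_ap {F G H : FinPresMod C} (i : F ⟶ G) (p : G ⟶ H) :
    IsShortExact i p ↔ (∀ Y, Function.Injective (ap i.hom Y)) ∧
      (∀ Y, Function.Surjective (ap p.hom Y)) ∧ (∀ Y x, ap p.hom Y (ap i.hom Y x) = 0) ∧
        ∀ Y y, ap p.hom Y y = 0 → ∃ x, ap i.hom Y x = y := by
  constructor
  · rintro ⟨w, h⟩
    refine ⟨(mono_iff_ap _).1 h.mono_f, (epi_iff_ap _).1 h.epi_g, fun Y x => ?_,
      (exact_iff_ap _ _ w).1 h.exact⟩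
    rw [← ap_comp, w, ap_zero]
  · rintro ⟨h₁, h₂, h₃, h₄⟩
    have w : i.hom ≫ p.hom = 0 := natTrans_ext h₃
    have := (mono_iff_ap _).2 h₁
    have := (epi_iff_ap _).2 h₂
    exact ⟨w, .mk' ((exact_iff_ap _ _ w).2 h₄) ‹_› ‹_›⟩

/-- This description is internal to `mod C`, so short exact sequences can be moved along
equivalences and dualities. -/
lemma isShortExact_iff_isKernelCokernelPair (hC : HasWeakPullbacks C) {F G H : FinPresMod C}
    (i : F ⟶ G) (p : G ⟶ H) : IsShortExact i p ↔ IsKernelCokernelPair i p := by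
  constructor
  · rintro ⟨w, h⟩
    have := h.mono_f
    have := h.epi_g
    refine ⟨ObjectProperty.hom_ext _ w, fun Z k hk => ?_, fun Z k hk => ?_⟩
    · have hk' : k.hom ≫ p.hom = 0 := congrArg (fun φ => φ.hom) hk
      refine ⟨ObjectProperty.homMk (h.exact.lift k.hom hk'),
        ObjectProperty.hom_ext _ (h.exact.lift_f k.hom hk'), fun l hl => ?_⟩
      refine ObjectProperty.hom_ext _ ((cancel_mono i.hom).1 ?_)
      exact (congrArg (fun φ => φ.hom) hl).trans (h.exact.lift_f k.hom hk').symm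
    · have hk' : i.hom ≫ k.hom = 0 := congrArg (fun φ => φ.hom) hk
      refine ⟨ObjectProperty.homMk (h.exact.desc k.hom hk'),
        ObjectProperty.hom_ext _ (h.exact.g_desc k.hom hk'), fun l hl => ?_⟩
      refine ObjectProperty.hom_ext _ ((cancel_epi p.hom).1 ?_)
      exact (congrArg (fun φ => φ.hom) hl).trans (h.exact.g_desc k.hom hk').symm
  · rintro ⟨w, h₁, h₂⟩
    have : Mono i := Preadditive.mono_of_cancel_zero _ fun {Z} g hg => by
      obtain ⟨l, -, hl⟩ := h₁ Z 0 (by simp)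
      rw [hl g hg, hl 0 (by simp)]
    have : Epi p := Preadditive.epi_of_cancel_zero _ fun {Z} g hg => by
      obtain ⟨l, -, hl⟩ := h₂ Z 0 (by simp)
      rw [hl g hg, hl 0 (by simp)]
    refine (isShortExact_iff_ap i p).2 ⟨injective_ap_of_mono i, surjective_ap_of_epi hC p,
      fun Y x => congrArg (fun φ => ap φ.hom Y x) w, fun Y y hy => ?_⟩
    obtain ⟨l, hl, -⟩ := h₁ _ (finPresYonedaHom G y) (gen_injective (by
      rw [gen_comp, gen_finPresYonedaHom, hy, gen_zero]))
    exact ⟨gen l, by rw [← gen_comp, hl, gen_finPresYonedaHom]⟩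

end FinPresMod

/-! ### Quotient categories -/

section Quotients

/-- The quotient of `S` by the kernel of a full and essentially surjective functor `V : S ⥤ Y`
is equivalent to `Y`. -/
theorem nonempty_quotient_equivalence {S : Type u₁} [Category.{v₁} S] {Y : Type u₂}
    [Category.{v₂} Y] (r : HomRel S) (V : S ⥤ Y) [V.Full] [V.EssSurj]
    (h : ∀ {X X' : S} (f g : X ⟶ X'), V.map f = V.map g ↔ r f g) :
    Nonempty (CategoryTheory.Quotient r ≌ Y) := by
  obtain rfl : V.homRel = r := by
    funext X X' f g
    exact propext (h f g)
  exact ⟨(CategoryTheory.Quotient.lift V.homRel V (fun _ _ _ _ h => h)).asEquivalence⟩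

variable {D : Type u} [Category.{v} D] [Preadditive D] (P : ObjectProperty D)

/-- A map from any projective lifts along `q`, so one fixed epimorphism detects the relation, which
is thereby visibly closed under sums. -/
lemma stableRel_iff_of_epi {X Y : P.FullSubcategory} (f g : X ⟶ Y) {Q : D} [Projective Q]
    (q : Q ⟶ Y.obj) [Epi q] : stableRel P f g ↔ ∃ a : X.obj ⟶ Q, a ≫ q = f.hom - g.hom := by
  constructor
  · rintro ⟨Q', a, b, _, h⟩
    exact ⟨a ≫ Projective.factorThru b q, by simp [h]⟩
  · rintro ⟨a, h⟩
    exact ⟨Q, a, q, ‹_›, h.symm⟩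

instance [EnoughProjectives D] : Congruence (stableRel P) where
  equivalence {X Y} := by
    refine ⟨fun f => ?_, fun {f g} h => ?_, fun {f g k} h h' => ?_⟩ <;>
    simp only [stableRel_iff_of_epi P _ _ (Projective.π Y.obj)] at *
    · exact ⟨0, by simp⟩
    · obtain ⟨a, h⟩ := h
      exact ⟨-a, by simp [h]⟩
    · obtain ⟨a, h⟩ := h
      obtain ⟨a', h'⟩ := h'
      exact ⟨a + a', by simp [h, h']⟩
  comp_left f g g' := by
    rintro ⟨Q, a, b, hQ, h⟩
    exact ⟨Q, f.hom ≫ a, b, hQ, by simp [← h]⟩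
  comp_right g := by
    rintro ⟨Q, a, b, hQ, h⟩
    exact ⟨Q, a, b ≫ g.hom, hQ, by simp [← reassoc_of% h]⟩

end Quotients

/-! ### Functors of projective dimension at most one and objects with short resolutions -/

section Resolutions

open Opposite

variable {A : Type u₁} [Category.{v} A] [Abelian A] {C : Type u₂} [Category.{v} C] [Preadditive C]

/-- Two morphisms of the full subcategory `P` of `A` are identified when their difference factors
through an object in the image of `ι`. -/
def factorRel (ι : C ⥤ A) (P : ObjectProperty A) : HomRel P.FullSubcategory := fun X Y f g =>
  ∃ (W : C) (a : X.obj ⟶ ι.obj W) (b : ι.obj W ⟶ Y.obj), f.hom - g.hom = a ≫ b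

/-- The objects `K` with a short exact sequence `0 ⟶ X₁ ⟶ X₀ ⟶ K ⟶ 0` with `X₁` and `X₀` in the
image of `ι`. -/
def HasShortResolution (ι : C ⥤ A) : ObjectProperty A := fun K =>
  ∃ (X₁ X₀ : C) (f : X₁ ⟶ X₀) (p : ι.obj X₀ ⟶ K) (w : ι.map f ≫ p = 0),
    (ShortComplex.mk (ι.map f) p w).ShortExact

/-- `ι : C ⥤ A` is the inclusion of a generating subcategory with weak pullbacks, such that short
exact sequences starting in `C` stay exact after applying `Hom(ι Y, -)`. -/
structure IsRigidGenerating (ι : C ⥤ A) : Prop where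
  full : ι.Full
  faithful : ι.Faithful
  additive : ι.Additive
  hasWeakPullbacks : HasWeakPullbacks C
  isIdempotentComplete : IsIdempotentComplete C
  exists_epi : ∀ K : A, ∃ (X : C) (p : ι.obj X ⟶ K), Epi p
  exists_lift : ∀ S : ShortComplex A, S.ShortExact → (∃ X : C, S.X₁ = ι.obj X) →
    ∀ (Y : C) (g : ι.obj Y ⟶ S.X₃), ∃ h : ι.obj Y ⟶ S.X₂, h ≫ S.g = g

/-- The functor `Hom(ι -, K)`. -/
def restrictedHom (ι : C ⥤ A) : A ⥤ Cᵒᵖ ⥤ AddCommGrpCat.{v} :=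
  preadditiveYoneda ⋙ (Functor.whiskeringLeft _ _ _).obj ι.op

variable (ι : C ⥤ A)

/-- A morphism `ι Y ⟶ K`, seen as an element of `Hom(ι -, K)`. -/
def hel {Y : C} {K : A} (g : ι.obj Y ⟶ K) : ((restrictedHom ι).obj K).obj (op Y) := g

variable {ι}

omit [Preadditive C] in
lemma hel_surjective {Y : C} {K : A} (y : ((restrictedHom ι).obj K).obj (op Y)) :
    ∃ g : ι.obj Y ⟶ K, hel ι g = y := ⟨y, rfl⟩

omit [Preadditive C] in
lemma hel_injective {Y : C} {K : A} {f g : ι.obj Y ⟶ K} (h : hel ι f = hel ι g) : f = g := h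

omit [Preadditive C] in
@[simp] lemma hel_zero {Y : C} {K : A} : hel ι (0 : ι.obj Y ⟶ K) = 0 := rfl

omit [Preadditive C] in
@[simp] lemma hel_add {Y : C} {K : A} (f g : ι.obj Y ⟶ K) : hel ι (f + g) = hel ι f + hel ι g := rfl

omit [Preadditive C] in
@[simp] lemma res_hel {X Y : C} {K : A} (f : X ⟶ Y) (g : ι.obj Y ⟶ K) :
    res ((restrictedHom ι).obj K) f (hel ι g) = hel ι (ι.map f ≫ g) := rfl

lemma additive_restrictedHom (hι : ι.Additive) (K : A) : ((restrictedHom ι).obj K).Additive :=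
  additive_of_res fun f g x => by
    obtain ⟨x, rfl⟩ := hel_surjective x
    simp [Functor.map_add]

/-- Left exactness of `Hom` gives the relations; lifting along `p`, where rigidity enters, gives
generation. -/
lemma IsRigidGenerating.isPresentation (h : IsRigidGenerating ι) {X₁ X₀ : C} {f : X₁ ⟶ X₀} {K : A}
    {p : ι.obj X₀ ⟶ K} {w : ι.map f ≫ p = 0} (hS : (ShortComplex.mk (ι.map f) p w).ShortExact) :
    IsPresentation ((restrictedHom ι).obj K) f (hel ι p) := by
  have := h.full
  have := h.faithful
  refine ⟨by rw [res_hel, w, hel_zero], fun {Y} y => ?_, fun {Y} g hg => ?_⟩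
  · obtain ⟨g, rfl⟩ := hel_surjective y
    obtain ⟨k, hk⟩ := h.exists_lift _ hS ⟨_, rfl⟩ Y g
    exact ⟨ι.preimage k, by rw [res_hel, ι.map_preimage]; exact congrArg _ hk⟩
  · rw [res_hel] at hg
    have := hS.mono_f
    have hz : ι.map g ≫ p = 0 := hel_injective hg
    refine ⟨ι.preimage (hS.exact.lift (ι.map g) hz), ι.map_injective ?_⟩
    rw [ι.map_comp, ι.map_preimage]
    exact hS.exact.lift_f _ hz

lemma IsRigidGenerating.isFinPres_restrictedHom (h : IsRigidGenerating ι) {K : A} (hK : HasShortResolution ι K) :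
    isFinPres C ((restrictedHom ι).obj K) := by
  obtain ⟨X₁, X₀, f, p, w, hS⟩ := hK
  exact isFinPres_iff.2 ⟨additive_restrictedHom h.additive K, _, _, _, _, h.isPresentation hS⟩

lemma projDimLEOne_of_isPresentation (hC : HasWeakPullbacks C) (F : FinPresMod C) {X₁ X₀ : C}
    {f : X₁ ⟶ X₀} [Mono f] {x : F.obj.obj (op X₀)} (h : IsPresentation F.obj f x) :
    projDimLEOne C F := by
  refine ⟨_, _, (finPresYoneda C).map f, finPresYonedaHom F x, projective_finPresYoneda hC _,
    projective_finPresYoneda hC _, (isShortExact_iff_ap _ _).2 ⟨fun Y => ?_, fun Y y => ?_,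
      fun Y y => ?_, fun Y y hy => ?_⟩⟩
  · intro a b hab
    obtain ⟨a, rfl⟩ := yel_surjective a
    obtain ⟨b, rfl⟩ := yel_surjective b
    have : a ≫ f = b ≫ f := hab
    rw [(cancel_mono f).1 this]
  · obtain ⟨g, hg⟩ := h.isGenerator y
    exact ⟨yel g, hg⟩
  · obtain ⟨g, rfl⟩ := yel_surjective y
    change res F.obj (g ≫ f) x = 0
    rw [res_comp, h.res_eq_zero, map_zero]
  · obtain ⟨g, rfl⟩ := yel_surjective y
    obtain ⟨k, hk⟩ := h.exists_factor g hy
    exact ⟨yel k, congrArg yel hk⟩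

/-- The functor `K ↦ Hom(ι -, K)` on objects with a short resolution. -/
def IsRigidGenerating.functor (h : IsRigidGenerating ι) :
    (HasShortResolution ι).FullSubcategory ⥤ (projDimLEOne C).FullSubcategory :=
  ObjectProperty.lift _ ((isFinPres C).lift ((HasShortResolution ι).ι ⋙ restrictedHom ι)
    (fun K => h.isFinPres_restrictedHom K.property)) (fun K => by
      obtain ⟨X₁, X₀, f, p, w, hS⟩ := K.property
      have := h.faithful
      have := hS.mono_f
      have : Mono f := ι.mono_of_mono_map (f := f) this
      exact projDimLEOne_of_isPresentation h.hasWeakPullbacks _ (h.isPresentation hS))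

/-- A natural map out of `Hom(ι -, K)` is determined by the image of `p`. This is a morphism killed
by `ι.map f`, so it descends to the cokernel `K`. -/
lemma IsRigidGenerating.full_functor (h : IsRigidGenerating ι) : h.functor.Full where
  map_surjective {K K'} α := by
    obtain ⟨X₁, X₀, f, p, w, hS⟩ := K.property
    have hP := h.isPresentation hS
    have := hS.epi_g
    obtain ⟨k, hk⟩ := hel_surjective (ι := ι) (K := K'.obj) (ap α.hom.hom X₀ (hel ι p))
    have hk0 : ι.map f ≫ k = 0 := hel_injective (by
      rw [← res_hel, hk]
      refine (ap_res α.hom.hom f (hel ι p)).symm.trans ?_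
      have : res ((restrictedHom ι).obj K.obj) f (hel ι p) = 0 := hP.res_eq_zero
      exact (congrArg _ this).trans (map_zero _))
    refine ⟨ObjectProperty.homMk (hS.exact.desc k hk0), ?_⟩
    refine ObjectProperty.hom_ext _ (ObjectProperty.hom_ext _ (hP.hom_ext ?_))
    exact (congrArg (hel ι) (hS.exact.g_desc k hk0)).trans hk

lemma IsPresentation.nonempty_iso {F G : FinPresMod C} {X₁ X₀ : C} {f : X₁ ⟶ X₀}
    {x : F.obj.obj (op X₀)} {y : G.obj.obj (op X₀)} (hx : IsPresentation F.obj f x)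
    (hy : IsPresentation G.obj f y) : Nonempty (F ≅ G) := by
  obtain ⟨α, hα⟩ := hx.exists_desc F.additive G.additive y hy.res_eq_zero
  obtain ⟨β, hβ⟩ := hy.exists_desc G.additive F.additive x hx.res_eq_zero
  exact ⟨ObjectProperty.isoMk _ ⟨α, β, hx.hom_ext (by simp [hα, hβ]),
    hy.hom_ext (by simp [hα, hβ])⟩⟩

/-- Both terms of the resolution are representable because idempotents split, and by Yoneda the map
between them is a monomorphism of `C`. -/
lemma exists_isPresentation_of_projDimLEOne [IsIdempotentComplete C] {F : FinPresMod C}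
    (hF : projDimLEOne C F) : ∃ (X₁ X₀ : C) (f : X₁ ⟶ X₀) (x : F.obj.obj (op X₀)),
      Mono f ∧ IsPresentation F.obj f x := by
  obtain ⟨P₁, P₀, i, p, _, _, hip⟩ := hF
  obtain ⟨X₁, ⟨e₁⟩⟩ := exists_iso_finPresYoneda P₁
  obtain ⟨X₀, ⟨e₀⟩⟩ := exists_iso_finPresYoneda P₀
  obtain ⟨f, hf⟩ := exists_eq_finPresYoneda_map (e₁.inv ≫ i ≫ e₀.hom)
  obtain ⟨h₁, h₂, h₃, h₄⟩ := (isShortExact_iff_ap _ _).1 hip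
  have key : ∀ {Y : C} (g : Y ⟶ X₀), res F.obj g (gen (e₀.inv ≫ p)) =
      ap p.hom Y (gen ((finPresYoneda C).map g ≫ e₀.inv)) := fun {Y} g => by
    rw [← gen_map_comp, ← gen_comp, Category.assoc]
  have hf' : e₁.inv ≫ i = (finPresYoneda C).map f ≫ e₀.inv := by simp [hf]
  have hfac : ∀ {Y : C} (g : Y ⟶ X₁), ap i.hom Y (gen ((finPresYoneda C).map g ≫ e₁.inv)) =
      gen ((finPresYoneda C).map (g ≫ f) ≫ e₀.inv) := fun {Y} g => by
    rw [← gen_comp, Category.assoc, hf', Functor.map_comp, Category.assoc]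
  have hinj : ∀ {Y Z : C} {P : FinPresMod C} (e : P ≅ (finPresYoneda C).obj Z) {g g' : Y ⟶ Z},
      gen ((finPresYoneda C).map g ≫ e.inv) = gen ((finPresYoneda C).map g' ≫ e.inv) → g = g' :=
    fun e _ _ hg => finPresYoneda_map_injective ((cancel_mono e.inv).1 (gen_injective hg))
  have hsurj : ∀ {Y Z : C} {P : FinPresMod C} (e : P ≅ (finPresYoneda C).obj Z)
      (y : P.obj.obj (op Y)), ∃ g : Y ⟶ Z, gen ((finPresYoneda C).map g ≫ e.inv) = y :=
    fun e y => by
      obtain ⟨g, hg⟩ := exists_eq_finPresYoneda_map (finPresYonedaHom _ y ≫ e.hom)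
      exact ⟨g, by rw [hg, Category.assoc, e.hom_inv_id, Category.comp_id, gen_finPresYonedaHom]⟩
  refine ⟨X₁, X₀, f, gen (e₀.inv ≫ p), ⟨fun a b hab => hinj e₁ (h₁ _ ?_)⟩, ?_, fun {Y} y => ?_,
    fun {Y} g hg => ?_⟩
  · rw [hfac, hfac, hab]
  · have := hfac (𝟙 X₁)
    rw [Category.id_comp] at this
    rw [key, ← this, h₃]
  · obtain ⟨z, rfl⟩ := h₂ Y y
    obtain ⟨g, rfl⟩ := hsurj e₀ z
    exact ⟨g, key g⟩
  · rw [key] at hg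
    obtain ⟨z, hz⟩ := h₄ _ _ hg
    obtain ⟨k, rfl⟩ := hsurj e₁ z
    exact ⟨k, hinj e₀ (by rw [← hz, hfac])⟩

lemma IsRigidGenerating.essSurj_functor (h : IsRigidGenerating ι) : h.functor.EssSurj where
  mem_essImage F := by
    have := h.isIdempotentComplete
    have := h.additive
    have := h.full
    obtain ⟨X₁, X₀, f, x, _, hx⟩ := exists_isPresentation_of_projDimLEOne F.property
    -- A morphism killed by `ι.map f` is tested after an epimorphism from an object of `C`, where
    -- `f` is monic.
    have hmono : Mono (ι.map f) := Preadditive.mono_of_cancel_zero _ fun {Z} g hg => by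
      obtain ⟨X, p, _⟩ := h.exists_epi Z
      rw [← cancel_epi p, comp_zero]
      have : ι.preimage (p ≫ g) ≫ f = 0 := h.faithful.map_injective (by
        simp [hg])
      rw [← ι.map_preimage (p ≫ g), zero_of_comp_mono f this, ι.map_zero]
    have hS : (ShortComplex.mk (ι.map f) (cokernel.π (ι.map f)) (cokernel.condition _)).ShortExact :=
      .mk' (ShortComplex.exact_cokernel _) hmono inferInstance
    obtain ⟨e⟩ := IsPresentation.nonempty_iso
      (F := ⟨_, h.isFinPres_restrictedHom ⟨_, _, _, _, _, hS⟩⟩) (h.isPresentation hS) hx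
    exact ⟨⟨cokernel (ι.map f), _, _, _, _, _, hS⟩, ⟨ObjectProperty.isoMk _ e⟩⟩

lemma enoughProjectives_finPresMod (hC : HasWeakPullbacks C) : EnoughProjectives (FinPresMod C) where
  presentation F := by
    obtain ⟨B, p, _⟩ := exists_epi_finPresYoneda F
    exact ⟨{ p := _, projective := projective_finPresYoneda hC B, f := p, epi := ‹_› }⟩

/-- The projective in a factorization may be taken representable, and a map from `Hom(ι -, K)` to
the functor represented by `W` comes from a morphism `K ⟶ ι W`, again by descent to the cokernel. -/
lemma IsRigidGenerating.stableRel_iff (h : IsRigidGenerating ι)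
    {K K' : (HasShortResolution ι).FullSubcategory} (f g : K ⟶ K') :
    stableRel _ (h.functor.map f) (h.functor.map g) ↔ factorRel ι _ f g := by
  have := h.full
  have := h.faithful
  have := h.additive
  obtain ⟨X₁, X₀, k, p, w, hS⟩ := K.property
  have hP := h.isPresentation hS
  have := hS.epi_g
  constructor
  · obtain ⟨X₁', X₀', k', p', w', hS'⟩ := K'.property
    have hP' := h.isPresentation hS'
    let q : (finPresYoneda C).obj X₀' ⟶ (h.functor.obj K').obj := finPresYonedaHom _ (hel ι p')
    have : Epi q := epi_of_surjective_ap _ fun Y y => by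
      obtain ⟨g, hg⟩ := hP'.isGenerator y
      exact ⟨yel g, hg⟩
    have := projective_finPresYoneda h.hasWeakPullbacks X₀'
    rw [stableRel_iff_of_epi _ _ _ q]
    rintro ⟨a, ha⟩
    obtain ⟨u, hu⟩ := yel_surjective (ap a.hom X₀ (hel ι p))
    have hz : k ≫ u = 0 := yel_injective (by
      rw [← res_yel, hu]
      refine (ap_res a.hom k (hel ι p)).symm.trans ?_
      have : res ((restrictedHom ι).obj K.obj) k (hel ι p) = 0 := hP.res_eq_zero
      exact (congrArg _ this).trans (map_zero _))
    have hz' : ι.map k ≫ ι.map u = 0 := by rw [← ι.map_comp, hz, ι.map_zero]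
    refine ⟨X₀', hS.exact.desc (ι.map u) hz', p', (cancel_epi p).1 ?_⟩
    have h1 : p ≫ hS.exact.desc (ι.map u) hz' = ι.map u := hS.exact.g_desc _ _
    rw [reassoc_of% h1, Preadditive.comp_sub]
    have h2 := congrArg (fun α => ap α.hom X₀ (hel ι p)) ha
    have h3 : ap q.hom X₀ (ap a.hom X₀ (hel ι p)) = hel ι (ι.map u ≫ p') := by
      rw [← hu]; rfl
    exact (hel_injective (h3.symm.trans h2)).symm
  · rintro ⟨W, a, b, hab⟩
    have hu : k ≫ ι.preimage (p ≫ a) = 0 := ι.map_injective (by simp [reassoc_of% w])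
    obtain ⟨α, hα⟩ := hP.exists_desc (additive_restrictedHom h.additive _) (additive_yoneda W)
      (yel (ι.preimage (p ≫ a))) (by rw [res_yel, hu, yel_zero])
    refine ⟨(finPresYoneda C).obj W, ObjectProperty.homMk α,
      finPresYonedaHom (h.functor.obj K').obj (hel ι b),
      projective_finPresYoneda h.hasWeakPullbacks W, ?_⟩
    refine ObjectProperty.hom_ext _ (hP.hom_ext ?_)
    have h1 : ap (yonedaHom (h.functor.obj K').obj.additive (hel ι b)) X₀ (ap α X₀ (hel ι p)) =
        hel ι ((p ≫ a) ≫ b) := by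
      rw [hα]
      change hel ι (ι.map (ι.preimage (p ≫ a)) ≫ b) = _
      rw [ι.map_preimage]
    refine Eq.trans ?_ h1.symm
    rw [Category.assoc, ← hab, Preadditive.comp_sub]
    rfl

theorem IsRigidGenerating.nonempty_equivalence (h : IsRigidGenerating ι) :
    Nonempty (CategoryTheory.Quotient (factorRel ι (HasShortResolution ι)) ≌
      StableCat (projDimLEOne C)) := by
  have := h.full_functor
  have := h.essSurj_functor
  have := enoughProjectives_finPresMod h.hasWeakPullbacks
  refine nonempty_quotient_equivalence _
    (h.functor ⋙ CategoryTheory.Quotient.functor (stableRel (projDimLEOne C))) fun f g => ?_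
  rw [Functor.comp_map, Functor.comp_map, CategoryTheory.Quotient.functor_map_eq_iff,
    h.stableRel_iff]

end Resolutions

/-! ### Stable and costable categories under a duality -/

section DualityTransport

open Opposite

variable {D₁ : Type u₁} [Category.{v₁} D₁] [Preadditive D₁] {D₂ : Type u₂} [Category.{v₂} D₂]
  [Preadditive D₂]

lemma IsKernelCokernelPair.map {F G H : D₁} {i : F ⟶ G} {p : G ⟶ H}
    (h : IsKernelCokernelPair i p) (Φ : D₁ ⥤ D₂) [Φ.Full] [Φ.Faithful] [Φ.EssSurj] [Φ.Additive] :
    IsKernelCokernelPair (Φ.map i) (Φ.map p) := by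
  obtain ⟨w, h₁, h₂⟩ := h
  refine ⟨by rw [← Φ.map_comp, w, Φ.map_zero], fun Z k hk => ?_, fun Z k hk => ?_⟩
  · let φ := Φ.objObjPreimageIso Z
    obtain ⟨l, hl, hu⟩ := h₁ _ (Φ.preimage (φ.hom ≫ k)) (Φ.map_injective (by simp [hk]))
    refine ⟨φ.inv ≫ Φ.map l, ?_, fun m hm => ?_⟩
    · change (φ.inv ≫ Φ.map l) ≫ Φ.map i = k
      rw [Category.assoc, ← Φ.map_comp, hl]
      simp
    · rw [← hu (Φ.preimage (φ.hom ≫ m)) (Φ.map_injective (by simp [hm]))]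
      simp
  · let φ := Φ.objObjPreimageIso Z
    obtain ⟨l, hl, hu⟩ := h₂ _ (Φ.preimage (k ≫ φ.inv)) (Φ.map_injective (by
      simp [reassoc_of% hk]))
    refine ⟨Φ.map l ≫ φ.hom, ?_, fun m hm => ?_⟩
    · change Φ.map p ≫ Φ.map l ≫ φ.hom = k
      rw [← Category.assoc, ← Φ.map_comp, hl]
      simp
    · rw [← hu (Φ.preimage (m ≫ φ.inv)) (Φ.map_injective (by simp [reassoc_of% hm]))]
      simp

lemma IsKernelCokernelPair.op {F G H : D₁} {i : F ⟶ G} {p : G ⟶ H}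
    (h : IsKernelCokernelPair i p) : IsKernelCokernelPair p.op i.op := by
  obtain ⟨w, h₁, h₂⟩ := h
  refine ⟨congrArg Quiver.Hom.op w, fun Z k hk => ?_, fun Z k hk => ?_⟩
  · obtain ⟨l, hl, hu⟩ := h₂ _ k.unop (congrArg Quiver.Hom.unop hk)
    exact ⟨l.op, congrArg Quiver.Hom.op hl, fun m hm =>
      congrArg Quiver.Hom.op (hu m.unop (congrArg Quiver.Hom.unop hm))⟩
  · obtain ⟨l, hl, hu⟩ := h₁ _ k.unop (congrArg Quiver.Hom.unop hk)
    exact ⟨l.op, congrArg Quiver.Hom.op hl, fun m hm =>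
      congrArg Quiver.Hom.op (hu m.unop (congrArg Quiver.Hom.unop hm))⟩

lemma IsKernelCokernelPair.unop {F G H : D₁ᵒᵖ} {i : F ⟶ G} {p : G ⟶ H}
    (h : IsKernelCokernelPair i p) : IsKernelCokernelPair p.unop i.unop := by
  obtain ⟨w, h₁, h₂⟩ := h
  refine ⟨congrArg Quiver.Hom.unop w, fun Z k hk => ?_, fun Z k hk => ?_⟩
  · obtain ⟨l, hl, hu⟩ := h₂ _ k.op (congrArg Quiver.Hom.op hk)
    exact ⟨l.unop, congrArg Quiver.Hom.unop hl, fun m hm =>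
      congrArg Quiver.Hom.unop (hu m.op (congrArg Quiver.Hom.op hm))⟩
  · obtain ⟨l, hl, hu⟩ := h₁ _ k.op (congrArg Quiver.Hom.op hk)
    exact ⟨l.unop, congrArg Quiver.Hom.unop hl, fun m hm =>
      congrArg Quiver.Hom.unop (hu m.op (congrArg Quiver.Hom.op hm))⟩

lemma IsKernelCokernelPair.iso_comp {F F' G H : D₁} {i : F ⟶ G} {p : G ⟶ H}
    (h : IsKernelCokernelPair i p) (e : F' ≅ F) : IsKernelCokernelPair (e.hom ≫ i) p := by
  obtain ⟨w, h₁, h₂⟩ := h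
  refine ⟨by rw [Category.assoc, w, comp_zero], fun Z k hk => ?_, fun Z k hk => ?_⟩
  · obtain ⟨l, hl, hu⟩ := h₁ _ k hk
    refine ⟨l ≫ e.inv, by simp [hl], fun m hm => ?_⟩
    rw [← hu (m ≫ e.hom) (by simpa using hm)]
    simp
  · exact h₂ Z k (by rw [← cancel_epi e.hom, comp_zero, ← Category.assoc, hk])

variable (e : D₁ ≌ D₂ᵒᵖ)

omit [Preadditive D₁] [Preadditive D₂] in
lemma projective_unop_of_injective (Q : D₁) [Injective Q] :
    Projective (e.functor.obj Q).unop := by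
  have : Injective (e.functor.obj Q) := (e.map_injective_iff Q).2 ‹_›
  infer_instance

omit [Preadditive D₁] [Preadditive D₂] in
lemma injective_inverse_of_projective (Q : D₂) [Projective Q] :
    Injective (e.inverse.obj (op Q)) := by
  have : Injective (op Q) := inferInstance
  exact (e.symm.map_injective_iff (op Q)).2 this

/-- A duality exchanges factorizations through injectives with factorizations through projectives.
Closure of `P₂` under isomorphisms gives essential surjectivity of the restricted functor. -/
theorem nonempty_costable_equivalence_stable_op [e.functor.Additive] [EnoughProjectives D₂]
    (P₁ : ObjectProperty D₁) (P₂ : ObjectProperty D₂)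
    [P₂.IsClosedUnderIsomorphisms]
    (h : ∀ X, P₁ X ↔ P₂ (e.functor.obj X).unop) :
    Nonempty (CostableCat P₁ ≌ (StableCat P₂)ᵒᵖ) := by
  let L : P₁.FullSubcategory ⥤ P₂.op.FullSubcategory :=
    P₂.op.lift (P₁.ι ⋙ e.functor) (fun X => (h X.obj).1 X.property)
  have : L.Full := ⟨fun φ => ⟨ObjectProperty.homMk (e.functor.preimage φ.hom),
    ObjectProperty.hom_ext _ (e.functor.map_preimage φ.hom)⟩⟩
  have : L.EssSurj := ⟨fun Y => ⟨⟨e.inverse.obj Y.obj, (h _).2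
    (P₂.prop_of_iso (e.counitIso.app Y.obj).unop Y.property)⟩,
    ⟨ObjectProperty.isoMk _ (e.counitIso.app Y.obj)⟩⟩⟩
  refine nonempty_quotient_equivalence _ (L ⋙ P₂.opEquivalence.functor ⋙
    (CategoryTheory.Quotient.functor (stableRel P₂)).op) fun {X Y} f g => ?_
  have key : (L ⋙ P₂.opEquivalence.functor ⋙
      (CategoryTheory.Quotient.functor (stableRel P₂)).op).map f = (L ⋙ P₂.opEquivalence.functor ⋙
      (CategoryTheory.Quotient.functor (stableRel P₂)).op).map g ↔
      stableRel P₂ (P₂.opEquivalence.functor.map (L.map f)).unop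
        (P₂.opEquivalence.functor.map (L.map g)).unop := by
    refine Iff.trans ?_ (CategoryTheory.Quotient.functor_map_eq_iff (stableRel P₂) _ _)
    exact ⟨fun h => congrArg Quiver.Hom.unop h, fun h => congrArg Quiver.Hom.op h⟩
  rw [key]
  constructor
  · rintro ⟨Q, a, b, _, hab⟩
    obtain ⟨b', a', hab'⟩ : ∃ (b' : e.functor.obj X.obj ⟶ op Q) (a' : op Q ⟶ e.functor.obj Y.obj),
      e.functor.map f.hom - e.functor.map g.hom = b' ≫ a' :=
      ⟨b.op, a.op, congrArg Quiver.Hom.op hab⟩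
    refine ⟨e.inverse.obj (op Q), e.functor.preimage (b' ≫ (e.counitIso.app (op Q)).inv),
      e.functor.preimage ((e.counitIso.app (op Q)).hom ≫ a'),
      injective_inverse_of_projective e Q, e.functor.map_injective ?_⟩
    rw [Functor.map_sub, hab', Functor.map_comp, Functor.map_preimage, Functor.map_preimage,
      Category.assoc, Iso.inv_hom_id_assoc]
  · rintro ⟨Q, a, b, _, hab⟩
    refine ⟨(e.functor.obj Q).unop, (e.functor.map b).unop, (e.functor.map a).unop,
      projective_unop_of_injective e Q, ?_⟩
    have := congrArg (fun φ => (e.functor.map φ).unop) hab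
    rw [Functor.map_comp, Functor.map_sub] at this
    exact this

variable {C₁ : Type w₁} [Category.{v₁} C₁] [Preadditive C₁] {C₂ : Type w₂} [Category.{v₂} C₂]
  [Preadditive C₂]

instance : (projDimLEOne C₁).IsClosedUnderIsomorphisms where
  of_iso {F F'} e h := by
    obtain ⟨P₁, P₀, i, p, h₁, h₀, w, hip⟩ := h
    refine ⟨P₁, P₀, i, p ≫ e.hom, h₁, h₀, ?_⟩
    have : i.hom ≫ (p ≫ e.hom).hom = 0 := by
      rw [ObjectProperty.FullSubcategory.comp_hom, reassoc_of% w, zero_comp]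
    refine ⟨this, ShortComplex.shortExact_of_iso (ShortComplex.isoMk
      (S₁ := ShortComplex.mk i.hom p.hom w) (S₂ := ShortComplex.mk i.hom (p ≫ e.hom).hom this)
      (Iso.refl _) (Iso.refl _)
      ((isFinPres C₁).ι.mapIso e) ?_ ?_) hip⟩ <;> simp

/-- Kernel-cokernel pairs are reversed by a duality, and injectives correspond to projectives. -/
theorem injDimLEOne_iff_projDimLEOne (h₁ : HasWeakPullbacks C₁) (h₂ : HasWeakPullbacks C₂)
    (e : FinPresMod C₁ ≌ (FinPresMod C₂)ᵒᵖ) [e.functor.Additive] (F : FinPresMod C₁) :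
    injDimLEOne C₁ F ↔ projDimLEOne C₂ (e.functor.obj F).unop := by
  constructor
  · rintro ⟨I₀, I₁, i, p, _, _, hip⟩
    refine ⟨_, _, (e.functor.map p).unop, (e.functor.map i).unop,
      projective_unop_of_injective e I₁, projective_unop_of_injective e I₀, ?_⟩
    rw [isShortExact_iff_isKernelCokernelPair h₂]
    exact (((isShortExact_iff_isKernelCokernelPair h₁ i p).1 hip).map e.functor).unop
  · rintro ⟨P₁, P₀, i, p, _, _, hip⟩
    refine ⟨_, _, (e.unitIso.app F).hom ≫ e.inverse.map p.op, e.inverse.map i.op,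
      injective_inverse_of_projective e P₀, injective_inverse_of_projective e P₁, ?_⟩
    rw [isShortExact_iff_isKernelCokernelPair h₁]
    exact ((((isShortExact_iff_isKernelCokernelPair h₂ i p).1 hip).op).map e.inverse).iso_comp _

end DualityTransport

/-! ### The duality between finitely presented functors on a dualizing variety -/

section Dualizing

open Opposite

variable (R : Type v) [CommRing R]

/-- An action of the commutative ring `R` on a preadditive category. -/
structure CenterAction (C : Type u) [Category.{v} C] [Preadditive C] where
  /-- The action of a scalar on an object. -/
  act : R → ∀ X : C, X ⟶ X
  one (X : C) : act 1 X = 𝟙 X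
  mul (r s : R) (X : C) : act (r * s) X = act r X ≫ act s X
  add (r s : R) (X : C) : act (r + s) X = act r X + act s X
  comm (r : R) {X Y : C} (f : X ⟶ Y) : act r X ≫ f = f ≫ act r Y

variable {R} {C : Type u} [Category.{v} C] [Preadditive C] (a : CenterAction R C)

/-- The induced action on the opposite category. -/
def CenterAction.op : CenterAction R Cᵒᵖ where
  act r X := (a.act r X.unop).op
  one X := by rw [a.one]; rfl
  mul r s X := by rw [mul_comm, a.mul]; rfl
  add r s X := by rw [a.add]; rfl
  comm r X Y f := by
    rw [← Quiver.Hom.op_unop f, ← op_comp, ← op_comp]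
    exact congrArg _ (a.comm r f.unop).symm

variable (R) in
/-- The underlying abelian group of a finitely generated module. -/
def forgetAb : FGModuleCat.{v} R ⥤ AddCommGrpCat.{v} where
  obj N := AddCommGrpCat.of N
  map f := AddCommGrpCat.ofHom f.hom.hom.toAddMonoidHom

instance : (forgetAb R).Faithful where
  map_injective h := FGModuleCat.hom_ext (LinearMap.ext fun x =>
    ConcreteCategory.congr_hom h x)

/-- The restriction map of a functor to `FGModuleCat R`. -/
def lres (H : Cᵒᵖ ⥤ FGModuleCat.{v} R) {X Y : C} (f : X ⟶ Y) :
    H.obj (op Y) →ₗ[R] H.obj (op X) := (H.map f.op).hom.hom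

omit [Preadditive C] in
lemma res_forgetAb (H : Cᵒᵖ ⥤ FGModuleCat.{v} R) {X Y : C} (f : X ⟶ Y) (x : H.obj (op Y)) :
    res (H ⋙ forgetAb R) f x = lres H f x := rfl

/-- `H` is compatible with the actions of `R`. -/
def IsLinearFunctor (H : Cᵒᵖ ⥤ FGModuleCat.{v} R) : Prop :=
  ∀ (X : C) (r : R) (x : H.obj (op X)), lres H (a.act r X) x = r • x

/-- The finitely presented `R`-linear functors with values in finitely generated modules. -/
def linFinPres : ObjectProperty (Cᵒᵖ ⥤ FGModuleCat.{v} R) := fun H =>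
  IsLinearFunctor a H ∧ isFinPres C (H ⋙ forgetAb R)

/-- Forget the linear structure. -/
def linFinPresForget : (linFinPres a).FullSubcategory ⥤ FinPresMod C :=
  (isFinPres C).lift ((linFinPres a).ι ⋙ (Functor.whiskeringRight _ _ _).obj (forgetAb R))
    (fun H => H.property.2)

instance : (linFinPresForget a).Faithful where
  map_injective {H H'} f g h := by
    refine ObjectProperty.hom_ext _ (NatTrans.ext (funext fun X => (forgetAb R).map_injective ?_))
    exact NatTrans.congr_app (congrArg (fun φ => φ.hom) h) X

instance : (linFinPresForget a).Additive where

variable {a} in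
lemma exists_hom_of_forgetAb {H H' : Cᵒᵖ ⥤ FGModuleCat.{v} R} (hH : IsLinearFunctor a H)
    (hH' : IsLinearFunctor a H') (φ : H ⋙ forgetAb R ⟶ H' ⋙ forgetAb R) :
    ∃ α : H ⟶ H', Functor.whiskerRight α (forgetAb R) = φ := by
  refine ⟨{
    app := fun X => FGModuleCat.ofHom (V := H.obj X) (W := H'.obj X)
      { toFun := fun x => ap φ X.unop x
        map_add' := fun x y => map_add (ap φ X.unop) x y
        map_smul' := fun r x => ?_ }
    naturality := fun X Y f => ?_ }, ?_⟩
  -- Linearity is automatic: scalars act through endomorphisms of the objects, with which natural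
  -- maps commute.
  · change ap φ X.unop (r • x) = r • (show H'.obj X from ap φ X.unop x)
    rw [← hH', ← hH, ← res_forgetAb, ← res_forgetAb]
    exact ap_res φ (a.act r X.unop) x
  · refine FGModuleCat.hom_ext (LinearMap.ext fun x => ?_)
    exact ap_res φ f.unop x
  · exact natTrans_ext fun Y x => rfl

instance : (linFinPresForget a).Full where
  map_surjective {H H'} φ := by
    obtain ⟨α, hα⟩ := exists_hom_of_forgetAb H.property.1 H'.property.1 φ.hom
    exact ⟨ObjectProperty.homMk α, ObjectProperty.hom_ext _ hα⟩

/-- The morphism spaces are finitely generated over `R`. -/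
def IsHomFinite : Prop :=
  ∀ X Y : C, ∃ (n : ℕ) (b : Fin n → (X ⟶ Y)), ∀ f : X ⟶ Y, ∃ c : Fin n → R,
    f = ∑ i, a.act (c i) X ≫ b i

/-! ### The canonical linear structure on a finitely presented functor. -/

section Lift

variable (F : Cᵒᵖ ⥤ AddCommGrpCat.{v}) (hF : F.Additive)

/-- The `R`-module structure on the values of an additive functor. -/
@[reducible] def moduleOfAdditive (X : Cᵒᵖ) : Module R (F.obj X) where
  smul r x := res F (a.act r X.unop) x
  one_smul x := by change res F _ x = x; rw [a.one]; exact res_id F _ x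
  mul_smul r s x := by
    change res F _ x = res F _ (res F _ x)
    rw [a.mul, res_comp]
  smul_zero r := map_zero (res F _)
  smul_add r x y := map_add (res F _) x y
  add_smul r s x := by
    change res F _ x = res F _ x + res F _ x
    rw [a.add, res_add hF]
  zero_smul x := by
    change res F (a.act 0 X.unop) x = 0
    have h : a.act 0 X.unop = 0 := by
      have := a.add 0 0 X.unop
      rwa [add_zero, left_eq_add] at this
    rw [h, res_zero hF]

/-- The value at `X` is a quotient of `Hom(X, B)`, whose finitely many generators give generators of
it. -/
lemma finite_moduleOfAdditive (ha : IsHomFinite a) (h : isFinPres C F) (X : Cᵒᵖ) :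
    @Module.Finite R (F.obj X) _ _ (moduleOfAdditive a F h.1 X) := by
  let := moduleOfAdditive a F h.1 X
  obtain ⟨hF, A, B, f, x, hx⟩ := isFinPres_iff.1 h
  obtain ⟨n, b, hb⟩ := ha X.unop B
  refine Module.Finite.of_surjective (M := Fin n → R)
    (Fintype.linearCombination R (fun i => (res F (b i) x : F.obj X))) fun y => ?_
  obtain ⟨g, rfl⟩ := hx.isGenerator (Y := X.unop) y
  obtain ⟨c, hc⟩ := hb g
  refine ⟨c, ?_⟩
  have hsum : ∀ (s : Finset (Fin n)), res F (∑ i ∈ s, a.act (c i) X.unop ≫ b i) x =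
      ∑ i ∈ s, res F (a.act (c i) X.unop ≫ b i) x := fun s => by
    induction s using Finset.cons_induction with
    | empty => rw [Finset.sum_empty, Finset.sum_empty, res_zero hF]
    | cons i s hi ih => rw [Finset.sum_cons, Finset.sum_cons, res_add hF, ih]
  rw [Fintype.linearCombination_apply, hc, hsum]
  refine Finset.sum_congr rfl fun i _ => ?_
  rw [res_comp]
  rfl

/-- The lift of a finitely presented functor to finitely generated modules. -/
def linearLift (ha : IsHomFinite a) (h : isFinPres C F) : Cᵒᵖ ⥤ FGModuleCat.{v} R where
  obj X :=
    letI := moduleOfAdditive a F h.1 X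
    haveI := finite_moduleOfAdditive a F ha h X
    FGModuleCat.of R (F.obj X)
  map {X Y} f :=
    letI := moduleOfAdditive a F h.1 X
    haveI := finite_moduleOfAdditive a F ha h X
    letI := moduleOfAdditive a F h.1 Y
    haveI := finite_moduleOfAdditive a F ha h Y
    FGModuleCat.ofHom
      { toFun := fun x => F.map f x
        map_add' := fun x y => map_add _ _ _
        map_smul' := fun r x => by
          change res F f.unop (res F _ x) = res F _ (res F f.unop x)
          rw [← res_comp, ← res_comp, a.comm]; rfl }
  map_id X := (forgetAb R).map_injective (F.map_id X)
  map_comp f g := (forgetAb R).map_injective (F.map_comp f g)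

/-- The lift recovers the functor. -/
def linearLiftIso (ha : IsHomFinite a) (h : isFinPres C F) :
    linearLift a F ha h ⋙ forgetAb R ≅ F :=
  NatIso.ofComponents (fun X => Iso.refl _) (fun f => by ext x; rfl)

end Lift

lemma isFinPres_of_iso {F G : Cᵒᵖ ⥤ AddCommGrpCat.{v}} (e : F ≅ G) (h : isFinPres C F) :
    isFinPres C G := by
  obtain ⟨hF, A, B, f, p, w, hex, hp⟩ := h
  have h2 : preadditiveYoneda.map f ≫ p ≫ e.hom = 0 := by rw [reassoc_of% w, zero_comp]
  refine ⟨Functor.additive_of_iso e, A, B, f, p ≫ e.hom, h2, ?_, inferInstance⟩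
  exact ShortComplex.exact_of_iso (ShortComplex.isoMk (S₁ := ShortComplex.mk _ p w)
    (S₂ := ShortComplex.mk _ (p ≫ e.hom) h2) (Iso.refl _) (Iso.refl _) e (by simp) (by simp)) hex

/-- Every finitely presented functor has its canonical linear structure, so nothing is lost by
passing to linear functors, to which Matlis duality applies. -/
lemma essSurj_linFinPresForget (ha : IsHomFinite a) : (linFinPresForget a).EssSurj where
  mem_essImage F := ⟨⟨linearLift a F.obj ha F.property, fun _ _ _ => rfl,
    isFinPres_of_iso (linearLiftIso a F.obj ha F.property).symm F.property⟩,
    ⟨ObjectProperty.isoMk _ (linearLiftIso a F.obj ha F.property)⟩⟩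

/-! ### Matlis duality as a functor. -/

variable {E : Type v} [AddCommGroup E] [Module R E] (hE : IsDualizingModule R E)

/-- Matlis duality on finitely generated modules. -/
def matlisDual : (FGModuleCat.{v} R)ᵒᵖ ⥤ FGModuleCat.{v} R where
  obj N := haveI := hE.finite_dual N.unop; FGModuleCat.of R (N.unop →ₗ[R] E)
  map {N N'} f :=
    haveI := hE.finite_dual N.unop
    haveI := hE.finite_dual N'.unop
    FGModuleCat.ofHom (LinearMap.lcomp R E f.unop.hom.hom)

/-- Evaluation into the double dual. -/
def matlisEval (N : FGModuleCat.{v} R) :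
    N ≅ (matlisDual hE).obj (op ((matlisDual hE).obj (op N))) :=
  haveI := hE.finite_dual N
  haveI := hE.finite_dual (N →ₗ[R] E)
  (LinearEquiv.ofBijective _ (hE.bijective_eval N)).toFGModuleCatIso

instance : (matlisDual hE).Faithful where
  map_injective {N _ _ _} h := Quiver.Hom.unop_inj (FGModuleCat.hom_ext (LinearMap.ext fun y =>
    (hE.bijective_eval N.unop).1 (LinearMap.ext fun ξ =>
      LinearMap.congr_fun (LinearMap.congr_fun (congrArg (fun ψ => ψ.hom.hom) h) ξ) y)))

-- Transpose `φ` and identify the double dual of `N` with `N`.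
include hE in
lemma exists_dual_eq (N N' : Type v) [AddCommGroup N] [Module R N] [Module.Finite R N]
    [AddCommGroup N'] [Module R N'] (φ : (N →ₗ[R] E) →ₗ[R] (N' →ₗ[R] E)) :
    ∃ f : N' →ₗ[R] N, ∀ ξ y, ξ (f y) = φ ξ y := by
  let e := LinearEquiv.ofBijective _ (hE.bijective_eval N)
  refine ⟨e.symm.toLinearMap ∘ₗ LinearMap.lcomp R E φ ∘ₗ LinearMap.applyₗ, fun ξ y => ?_⟩
  exact LinearMap.congr_fun (e.apply_symm_apply (LinearMap.lcomp R E φ (LinearMap.applyₗ y))) ξ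

instance : (matlisDual hE).Full where
  map_surjective {N N'} φ := by
    obtain ⟨f, hf⟩ := exists_dual_eq hE N.unop N'.unop φ.hom.hom
    exact ⟨(FGModuleCat.ofHom (V := N'.unop) (W := N.unop) f).op,
      FGModuleCat.hom_ext (LinearMap.ext fun ξ => LinearMap.ext fun y => hf ξ y)⟩

instance : (matlisDual hE).Additive where
  map_add {N _ f g} := FGModuleCat.hom_ext (LinearMap.ext fun (ξ : N.unop →ₗ[R] E) =>
    show ξ ∘ₗ (f + g).unop.hom.hom = ξ ∘ₗ f.unop.hom.hom + ξ ∘ₗ g.unop.hom.hom from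
      LinearMap.comp_add _ _ _)

end Dualizing

theorem exists_comp_eq_of_surjective {S N N' K : Type*} [Ring S] [AddCommGroup N]
    [Module S N] [AddCommGroup N'] [Module S N'] [AddCommGroup K] [Module S K] (p : N →ₗ[S] N')
    (hp : Function.Surjective p) (ξ : N →ₗ[S] K) (h : ∀ x, p x = 0 → ξ x = 0) :
    ∃ ζ : N' →ₗ[S] K, ζ ∘ₗ p = ξ := by
  refine ⟨(LinearMap.ker p).liftQ ξ (fun x hx => h x hx) ∘ₗ
    (p.quotKerEquivOfSurjective hp).symm.toLinearMap, LinearMap.ext fun x => ?_⟩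
  have : (p.quotKerEquivOfSurjective hp).symm (p x) = (LinearMap.ker p).mkQ x := by
    rw [LinearEquiv.symm_apply_eq]; rfl
  rw [LinearMap.comp_apply, LinearMap.comp_apply, LinearEquiv.coe_coe, this]
  rfl

section DualizingVariety

open Opposite

variable {R : Type v} [CommRing R] {C : Type u} [Category.{v} C] [Preadditive C]
  (a : CenterAction R C) {E : Type v} [AddCommGroup E] [Module R E] (hE : IsDualizingModule R E)

/-- The pointwise dual of a functor. -/
def dualFunctor (H : Cᵒᵖ ⥤ FGModuleCat.{v} R) : Cᵒᵖᵒᵖ ⥤ FGModuleCat.{v} R :=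
  H.op ⋙ matlisDual hE

/-- An element of the dual functor, seen as a linear form. -/
def dualEl {H : Cᵒᵖ ⥤ FGModuleCat.{v} R} {X : Cᵒᵖ} (ξ : (dualFunctor hE H).obj (op X)) :
    H.obj (op X.unop) →ₗ[R] E := ξ

/-- The pointwise dual of a natural transformation. -/
def dualHom {H H' : Cᵒᵖ ⥤ FGModuleCat.{v} R} (α : H ⟶ H') :
    dualFunctor hE H' ⟶ dualFunctor hE H :=
  Functor.whiskerRight (NatTrans.op α) (matlisDual hE)

/-- The dual of a representable linear functor is finitely presented. -/
def DualRepresentableFinPres : Prop :=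
  ∀ (H : Cᵒᵖ ⥤ FGModuleCat.{v} R), IsLinearFunctor a H → ∀ (B : C) (x : H.obj (op B)),
    (∀ (Y : C) (g g' : Y ⟶ B), lres H (g + g') x = lres H g x + lres H g' x) →
    (∀ Y, Function.Bijective (fun g : Y ⟶ B => lres H g x)) →
      isFinPres Cᵒᵖ (dualFunctor hE H ⋙ forgetAb R)

/-- `C` is a dualizing variety. -/
structure IsDualizingVariety : Prop where
  hasWeakPullbacks : HasWeakPullbacks C
  hasWeakPullbacks_op : HasWeakPullbacks Cᵒᵖ
  isHomFinite : IsHomFinite a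
  dual_representable : DualRepresentableFinPres a hE
  dual_corepresentable : DualRepresentableFinPres a.op hE

-- Dualizing `Hom(-, A) → Hom(-, B) → H → 0` exhibits the dual of `H` as a kernel of a map between
-- duals of representables, and finitely presented functors are closed under kernels.
variable {a hE} in
theorem isFinPres_dualFunctor (hC : HasWeakPullbacks Cᵒᵖ) (ha : IsHomFinite a)
    (hrep : DualRepresentableFinPres a hE) {H : Cᵒᵖ ⥤ FGModuleCat.{v} R} (hH : linFinPres a H) :
    isFinPres Cᵒᵖ (dualFunctor hE H ⋙ forgetAb R) := by
  obtain ⟨hF, A, B, f, x, hx⟩ := isFinPres_iff.1 hH.2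
  have hlin : ∀ Z : C, IsLinearFunctor a (linearLift a _ ha (isFinPres_yoneda Z)) :=
    fun Z _ _ _ => rfl
  have hfp : ∀ Z : C, isFinPres Cᵒᵖ (dualFunctor hE (linearLift a _ ha (isFinPres_yoneda Z)) ⋙
      forgetAb R) := fun Z => hrep _ (hlin Z) Z (yel (𝟙 Z))
    (fun Y g g' => res_add (isFinPres_yoneda Z).1 g g' (yel (𝟙 Z))) (fun Y =>
    ⟨fun g g' h => by
      have : g ≫ 𝟙 Z = g' ≫ 𝟙 Z := h
      simpa using this, fun g => by
      obtain ⟨g, rfl⟩ := yel_surjective (B := Z) g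
      exact ⟨g, Category.comp_id g⟩⟩)
  obtain ⟨α, hα⟩ := exists_hom_of_forgetAb (hlin B) hH.1
    ((linearLiftIso a _ ha (isFinPres_yoneda B)).hom ≫ yonedaHom hF x)
  obtain ⟨β, hβ⟩ := exists_hom_of_forgetAb (hlin A) (hlin B)
    ((linearLiftIso a _ ha (isFinPres_yoneda A)).hom ≫ preadditiveYoneda.map f ≫
      (linearLiftIso a _ ha (isFinPres_yoneda B)).inv)
  have hα' : ∀ (Y : C) (g : Y ⟶ B), (α.app (op Y)).hom.hom (yel g) = res _ g x := fun Y g =>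
    congrArg (fun φ => ap φ Y (yel g)) hα
  have hβ' : ∀ (Y : C) (g : Y ⟶ A), (β.app (op Y)).hom.hom (yel g) = yel (g ≫ f) := fun Y g =>
    congrArg (fun φ => ap φ Y (yel g)) hβ
  refine isFinPres_of_kernel hC (Functor.whiskerRight (dualHom hE α) (forgetAb R))
    (Functor.whiskerRight (dualHom hE β) (forgetAb R)) (hfp B) (hfp A) (fun Y => ?_) (fun Y ξ => ?_)
    (fun Y ξ hξ => ?_)
  · intro ξ ξ' h
    refine LinearMap.ext fun y => ?_
    obtain ⟨g, rfl⟩ := hx.isGenerator (Y := Y.unop) y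
    have := LinearMap.congr_fun h (yel g)
    change dualEl hE ξ ((α.app (op Y.unop)).hom.hom (yel g)) = dualEl hE ξ' ((α.app (op Y.unop)).hom.hom (yel g)) at this
    rwa [hα'] at this
  · refine LinearMap.ext fun y => ?_
    obtain ⟨g, rfl⟩ := yel_surjective (Y := Y.unop) (B := A) y
    change dualEl hE ξ ((α.app (op Y.unop)).hom.hom ((β.app (op Y.unop)).hom.hom (yel g))) = 0
    rw [hβ', hα', res_comp, hx.res_eq_zero, map_zero]
    exact map_zero (dualEl hE ξ)
  · obtain ⟨ζ, hζ⟩ := exists_comp_eq_of_surjective (α.app (op Y.unop)).hom.hom (fun y => by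
      obtain ⟨g, rfl⟩ := hx.isGenerator (Y := Y.unop) y
      exact ⟨yel g, hα' _ g⟩) ξ (fun y hy => by
      obtain ⟨g, rfl⟩ := yel_surjective (Y := Y.unop) (B := B) y
      rw [hα'] at hy
      obtain ⟨k, rfl⟩ := hx.exists_factor g hy
      have := LinearMap.congr_fun hξ (yel k)
      change dualEl hE ξ ((β.app (op Y.unop)).hom.hom (yel k)) = 0 at this
      rwa [hβ'] at this)
    exact ⟨ζ, hζ⟩

omit [Preadditive C] in
lemma HasWeakPullbacks.op_op (hC : HasWeakPullbacks C) : HasWeakPullbacks Cᵒᵖᵒᵖ := by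
  intro A B D f g
  obtain ⟨W, p, q, h, hW⟩ := hC f.unop.unop g.unop.unop
  refine ⟨op (op W), p.op.op, q.op.op, congrArg (fun k => k.op.op) h, fun Y a' b' h' => ?_⟩
  obtain ⟨t, ht, ht'⟩ := hW a'.unop.unop b'.unop.unop (congrArg (fun k => k.unop.unop) h')
  exact ⟨t.op.op, congrArg (fun k => k.op.op) ht, congrArg (fun k => k.op.op) ht'⟩

variable {a} in
lemma IsHomFinite.op (ha : IsHomFinite a) : IsHomFinite a.op := by
  intro X Y
  obtain ⟨n, b, hb⟩ := ha Y.unop X.unop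
  refine ⟨n, fun i => (b i).op, fun f => ?_⟩
  obtain ⟨c, hc⟩ := hb f.unop
  refine ⟨c, Quiver.Hom.unop_inj ?_⟩
  rw [hc, unop_sum]
  exact Finset.sum_congr rfl fun i _ => a.comm (c i) (b i)

lemma isFinPres_opOp {K : Cᵒᵖᵒᵖᵒᵖ ⥤ AddCommGrpCat.{v}} (hK : isFinPres Cᵒᵖᵒᵖ K) :
    isFinPres C (opOp Cᵒᵖ ⋙ K) := by
  obtain ⟨hK, A, B, f, x, hx⟩ := isFinPres_iff.1 hK
  refine isFinPres_iff.2 ⟨additive_of_res fun f g y => res_add hK f.op.op g.op.op y,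
    A.unop.unop, B.unop.unop, f.unop.unop, x, hx.res_eq_zero, fun {Y} y => ?_, fun {Y} g hg => ?_⟩
  · obtain ⟨g, hg⟩ := hx.isGenerator (Y := op (op Y)) y
    exact ⟨g.unop.unop, hg⟩
  · obtain ⟨k, hk⟩ := hx.exists_factor g.op.op hg
    exact ⟨k.unop.unop, congrArg (fun k => k.unop.unop) hk⟩

variable {a hE}

lemma IsLinearFunctor.dual {H : Cᵒᵖ ⥤ FGModuleCat.{v} R} (hH : IsLinearFunctor a H) :
    IsLinearFunctor a.op (dualFunctor hE H) := fun X r ξ => by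
  refine LinearMap.ext fun (y : H.obj (op X.unop)) => ?_
  change dualEl hE ξ (lres H (a.act r X.unop) y) = r • dualEl hE ξ y
  rw [hH]
  exact map_smul (dualEl hE ξ) r y

/-- Pointwise duality of finitely presented linear functors. -/
def IsDualizingVariety.dual (h : IsDualizingVariety a hE) :
    (linFinPres a).FullSubcategory ⥤ (linFinPres a.op).FullSubcategoryᵒᵖ where
  obj H := op ⟨dualFunctor hE H.obj, H.property.1.dual,
    isFinPres_dualFunctor h.hasWeakPullbacks_op h.isHomFinite h.dual_representable H.property⟩
  map α := (ObjectProperty.homMk (dualHom hE α.hom)).op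

lemma IsDualizingVariety.faithful_dual (h : IsDualizingVariety a hE) : h.dual.Faithful where
  map_injective {H H'} α β hαβ := by
    refine ObjectProperty.hom_ext _ (NatTrans.ext (funext fun X => ?_))
    have : dualHom hE α.hom = dualHom hE β.hom := congrArg (fun φ => φ.unop.hom) hαβ
    exact Quiver.Hom.op_inj ((matlisDual hE).map_injective (NatTrans.congr_app this (op X)))

lemma IsDualizingVariety.full_dual (h : IsDualizingVariety a hE) : h.dual.Full where
  map_surjective {H H'} φ := by
    let ψ : dualFunctor hE H'.obj ⟶ dualFunctor hE H.obj := φ.unop.hom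
    have hs : ∀ X : Cᵒᵖ, ∃ k : H.obj.obj X ⟶ H'.obj.obj X,
        (matlisDual hE).map k.op = ψ.app (op X) := fun X => by
      obtain ⟨k, hk⟩ := (matlisDual hE).map_surjective (X := op (H'.obj.obj X))
        (Y := op (H.obj.obj X)) (ψ.app (op X))
      exact ⟨k.unop, hk⟩
    choose k hk using hs
    have hn : ∀ {X Y : Cᵒᵖ} (f : X ⟶ Y), H.obj.map f ≫ k Y = k X ≫ H'.obj.map f :=
      fun {X Y} f => Quiver.Hom.op_inj ((matlisDual hE).map_injective (by
        rw [op_comp, op_comp, Functor.map_comp, Functor.map_comp, hk, hk]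
        exact (ψ.naturality f.op).symm))
    exact ⟨ObjectProperty.homMk ⟨k, fun _ _ f => hn f⟩, Quiver.Hom.unop_inj
      (ObjectProperty.hom_ext _ (NatTrans.ext (funext fun X => hk X.unop)))⟩

/-- The preimage of `G` is its own dual, read on `C` through `opOp`; evaluation into the double dual
is the isomorphism. -/
lemma IsDualizingVariety.essSurj_dual (h : IsDualizingVariety a hE) : h.dual.EssSurj where
  mem_essImage G := by
    have hG := isFinPres_dualFunctor h.hasWeakPullbacks.op_op h.isHomFinite.op
      h.dual_corepresentable G.unop.property
    have hlin : IsLinearFunctor a.op.op (dualFunctor hE G.unop.obj) := G.unop.property.1.dual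
    let H : (linFinPres a).FullSubcategory := ⟨opOp Cᵒᵖ ⋙ dualFunctor hE G.unop.obj,
      fun X r x => hlin (op (op X)) r x, isFinPres_opOp hG⟩
    let e : G.unop.obj ≅ dualFunctor hE H.obj :=
      NatIso.ofComponents (fun X => matlisEval hE (G.unop.obj.obj X)) (fun f => rfl)
    exact ⟨H, ⟨(ObjectProperty.isoMk (X := G.unop) _ e).op⟩⟩

lemma IsDualizingVariety.additive_dual (h : IsDualizingVariety a hE) : h.dual.Additive where
  map_add {_ _ α β} := Quiver.Hom.unop_inj (ObjectProperty.hom_ext _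
    (NatTrans.ext (funext fun X => (matlisDual hE).map_add
      (f := (α.hom.app X.unop).op) (g := (β.hom.app X.unop).op))))

/-- The duality between finitely presented right and left modules over a dualizing variety. -/
theorem IsDualizingVariety.exists_duality (h : IsDualizingVariety a hE) :
    ∃ e : FinPresMod C ≌ (FinPresMod Cᵒᵖ)ᵒᵖ, e.functor.Additive := by
  have := essSurj_linFinPresForget a h.isHomFinite
  have := essSurj_linFinPresForget a.op h.isHomFinite.op
  have := h.faithful_dual
  have := h.full_dual
  have := h.essSurj_dual
  have := h.additive_dual
  have h₁ : (linFinPresForget a).IsEquivalence := {}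
  have h₂ : (linFinPresForget a.op).IsEquivalence := {}
  have h₃ : h.dual.IsEquivalence := {}
  let e₁ := (linFinPresForget a).asEquivalence
  have : e₁.functor.Additive := inferInstanceAs (linFinPresForget a).Additive
  have : e₁.inverse.Additive := e₁.inverse_additive
  exact ⟨e₁.symm.trans (h.dual.asEquivalence.trans (linFinPresForget a.op).asEquivalence.op),
    inferInstanceAs (e₁.inverse ⋙ h.dual ⋙ (linFinPresForget a.op).op).Additive⟩

theorem IsDualizingVariety.nonempty_equivalence (h : IsDualizingVariety a hE) :
    Nonempty (CostableCat (injDimLEOne C) ≌ (StableCat (projDimLEOne Cᵒᵖ))ᵒᵖ) := by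
  obtain ⟨e, _⟩ := h.exists_duality
  have := enoughProjectives_finPresMod h.hasWeakPullbacks_op
  exact nonempty_costable_equivalence_stable_op e _ _
    (injDimLEOne_iff_projDimLEOne h.hasWeakPullbacks h.hasWeakPullbacks_op e)

end DualizingVariety

/-! ### Vanishing of `Ext` and short exact sequences -/

section ExtVanishing

open Abelian

variable {A : Type u} [Category.{v} A] [Abelian A] {S : ShortComplex A}

lemma exists_lift_of_extVanishes (hS : S.ShortExact) {Y : A} (h : ExtVanishes Y S.X₁ 1)
    (g : Y ⟶ S.X₃) : ∃ k : Y ⟶ S.X₂, k ≫ S.g = g := by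
  let : HasExt.{max u v} A := HasExt.standard A
  have : Subsingleton (Ext.{max u v} Y S.X₁ 1) := h
  obtain ⟨x, hx⟩ := Ext.covariant_sequence_exact₃ Y hS (Ext.mk₀ g) (zero_add 1)
    (Subsingleton.elim _ _)
  obtain ⟨k, rfl⟩ := (Ext.mk₀_bijective Y S.X₂).2 x
  rw [Ext.mk₀_comp_mk₀] at hx
  exact ⟨k, (Ext.mk₀_bijective Y S.X₃).1 hx⟩

lemma exists_extension_of_extVanishes (hS : S.ShortExact) {Y : A} (h : ExtVanishes S.X₃ Y 1)
    (g : S.X₁ ⟶ Y) : ∃ k : S.X₂ ⟶ Y, S.f ≫ k = g := by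
  let : HasExt.{max u v} A := HasExt.standard A
  have : Subsingleton (Ext.{max u v} S.X₃ Y 1) := h
  obtain ⟨x, hx⟩ := Ext.contravariant_sequence_exact₁ hS Y (Ext.mk₀ g) (add_zero 1)
    (Subsingleton.elim _ _)
  obtain ⟨k, rfl⟩ := (Ext.mk₀_bijective S.X₂ Y).2 x
  rw [Ext.mk₀_comp_mk₀] at hx
  exact ⟨k, (Ext.mk₀_bijective S.X₁ Y).1 hx⟩

lemma extVanishes_X₃ (hS : S.ShortExact) {Y : A} {i : ℕ} (h₂ : ExtVanishes Y S.X₂ i)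
    (h₁ : ExtVanishes Y S.X₁ (i + 1)) : ExtVanishes Y S.X₃ i := by
  let : HasExt.{max u v} A := HasExt.standard A
  have : Subsingleton (Ext.{max u v} Y S.X₁ (i + 1)) := h₁
  have : Subsingleton (Ext.{max u v} Y S.X₂ i) := h₂
  refine subsingleton_of_forall_eq 0 fun x => ?_
  obtain ⟨y, rfl⟩ := Ext.covariant_sequence_exact₃ Y hS x rfl (Subsingleton.elim _ _)
  rw [Subsingleton.elim y 0, Ext.zero_comp]

lemma extVanishes_X₁ (hS : S.ShortExact) {Y : A} {i : ℕ} (h₃ : ExtVanishes Y S.X₃ i)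
    (h₂ : ExtVanishes Y S.X₂ (i + 1)) : ExtVanishes Y S.X₁ (i + 1) := by
  let : HasExt.{max u v} A := HasExt.standard A
  have : Subsingleton (Ext.{max u v} Y S.X₂ (i + 1)) := h₂
  have : Subsingleton (Ext.{max u v} Y S.X₃ i) := h₃
  refine subsingleton_of_forall_eq 0 fun x => ?_
  obtain ⟨y, rfl⟩ := Ext.covariant_sequence_exact₁ Y hS x (Subsingleton.elim _ _) rfl
  rw [Subsingleton.elim y 0, Ext.zero_comp]

/-- In degree one the preceding term is `Hom(Y, X₃)`, which need not vanish. It suffices that the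
connecting map is zero, and this is what lifting along `S.g` provides. -/
lemma extVanishes_X₁_one (hS : S.ShortExact) {Y : A}
    (h₃ : ∀ g : Y ⟶ S.X₃, ∃ k : Y ⟶ S.X₂, k ≫ S.g = g)
    (h₂ : ExtVanishes Y S.X₂ 1) : ExtVanishes Y S.X₁ 1 := by
  let : HasExt.{max u v} A := HasExt.standard A
  have : Subsingleton (Ext.{max u v} Y S.X₂ 1) := h₂
  refine subsingleton_of_forall_eq 0 fun x => ?_
  obtain ⟨y, rfl⟩ := Ext.covariant_sequence_exact₁ Y hS x (Subsingleton.elim _ _) (zero_add 1)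
  obtain ⟨g, rfl⟩ := (Ext.mk₀_bijective Y S.X₃).2 y
  obtain ⟨k, rfl⟩ := h₃ g
  rw [← Ext.mk₀_comp_mk₀, Ext.comp_assoc_of_second_deg_zero, hS.comp_extClass, Ext.comp_zero]

lemma extVanishes_from_X₃ (hS : S.ShortExact) {Y : A} {i : ℕ} (h₁ : ExtVanishes S.X₁ Y i)
    (h₂ : ExtVanishes S.X₂ Y (i + 1)) : ExtVanishes S.X₃ Y (i + 1) := by
  let : HasExt.{max u v} A := HasExt.standard A
  have : Subsingleton (Ext.{max u v} S.X₂ Y (i + 1)) := h₂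
  have : Subsingleton (Ext.{max u v} S.X₁ Y i) := h₁
  refine subsingleton_of_forall_eq 0 fun x => ?_
  obtain ⟨y, rfl⟩ := Ext.contravariant_sequence_exact₃ hS Y x (Subsingleton.elim _ _)
    (add_comm 1 i)
  rw [Subsingleton.elim y 0, Ext.comp_zero]

lemma extVanishes_from_X₃_one (hS : S.ShortExact) {Y : A}
    (h₁ : ∀ g : S.X₁ ⟶ Y, ∃ k : S.X₂ ⟶ Y, S.f ≫ k = g)
    (h₂ : ExtVanishes S.X₂ Y 1) : ExtVanishes S.X₃ Y 1 := by
  let : HasExt.{max u v} A := HasExt.standard A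
  have : Subsingleton (Ext.{max u v} S.X₂ Y 1) := h₂
  refine subsingleton_of_forall_eq 0 fun x => ?_
  obtain ⟨y, rfl⟩ := Ext.contravariant_sequence_exact₃ hS Y x (Subsingleton.elim _ _)
    (add_zero 1)
  obtain ⟨g, rfl⟩ := (Ext.mk₀_bijective S.X₁ Y).2 y
  obtain ⟨k, rfl⟩ := h₁ g
  rw [← Ext.mk₀_comp_mk₀, ← Ext.comp_assoc_of_second_deg_zero, hS.extClass_comp, Ext.zero_comp]

lemma extVanishes_from_X₁ (hS : S.ShortExact) {Y : A} {i : ℕ} (h₂ : ExtVanishes S.X₂ Y i)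
    (h₃ : ExtVanishes S.X₃ Y (i + 1)) : ExtVanishes S.X₁ Y i := by
  let : HasExt.{max u v} A := HasExt.standard A
  have : Subsingleton (Ext.{max u v} S.X₂ Y i) := h₂
  have : Subsingleton (Ext.{max u v} S.X₃ Y (i + 1)) := h₃
  refine subsingleton_of_forall_eq 0 fun x => ?_
  obtain ⟨y, rfl⟩ := Ext.contravariant_sequence_exact₁ hS Y x (add_comm 1 i)
    (Subsingleton.elim _ _)
  rw [Subsingleton.elim y 0, Ext.comp_zero]

lemma extVanishes_of_retract {X Y Y' : A} {i : ℕ} (f : Y' ⟶ Y) (g : Y ⟶ Y') (hfg : f ≫ g = 𝟙 Y')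
    (h : ExtVanishes X Y i) : ExtVanishes X Y' i := by
  let : HasExt.{max u v} A := HasExt.standard A
  have : Subsingleton (Ext.{max u v} X Y i) := h
  refine subsingleton_of_forall_eq 0 fun x => ?_
  rw [← Ext.comp_mk₀_id x, ← hfg, ← Ext.mk₀_comp_mk₀, ← Ext.comp_assoc_of_second_deg_zero,
    Subsingleton.elim (x.comp (Ext.mk₀ f) (add_zero i)) 0, Ext.zero_comp]

end ExtVanishing

/-! ### Syzygies and cosyzygies modulo a cluster tilting subcategory -/

section ClusterTiltingSyzygy

open Opposite

variable {A : Type u} [Category.{v} A] [Abelian A] {M : ObjectProperty A}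

/-- The objects `D` with `Extⁱ(M, D) = 0` for `0 < i < n - j - 1` and `Extⁱ(D, M) = 0` for
`0 < i ≤ j`. -/
def extOrthogonal (M : ObjectProperty A) (n j : ℕ) : ObjectProperty A := fun D =>
  (∀ X, M X → ∀ i, 0 < i → i + j + 1 < n → ExtVanishes X D i) ∧
    ∀ X, M X → ∀ i, 0 < i → i ≤ j → ExtVanishes D X i

variable {n : ℕ}

namespace IsNClusterTilting

lemma extVanishes (hM : IsNClusterTilting n M) {X Y : A} (hX : M X) (hY : M Y) {i : ℕ}
    (h0 : 0 < i) (hi : i < n) : ExtVanishes X Y i :=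
  (hM.mem_iff_right Y).1 hY X hX i h0 hi

lemma exists_right (hM : IsNClusterTilting n M) (Y : A) :
    ∃ (X : A) (π : X ⟶ Y), IsRightApprox M π ∧ Epi π := by
  obtain ⟨X, π, h⟩ := hM.functoriallyFinite.1 Y
  obtain ⟨X', p, hX', _⟩ := hM.generatingCogenerating.1 Y
  obtain ⟨k, hk⟩ := h.2 hX' p
  exact ⟨X, π, h, epi_of_epi_fac hk⟩

lemma exists_left (hM : IsNClusterTilting n M) (Y : A) :
    ∃ (X : A) (i : Y ⟶ X), IsLeftApprox M i ∧ Mono i := by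
  obtain ⟨X, π, h⟩ := hM.functoriallyFinite.2 Y
  obtain ⟨X', p, hX', _⟩ := hM.generatingCogenerating.2 Y
  obtain ⟨k, hk⟩ := h.2 hX' p
  exact ⟨X, π, h, mono_of_mono_fac hk⟩

lemma mem_of_retract (hM : IsNClusterTilting n M) {Y Y' : A} (f : Y' ⟶ Y) (g : Y ⟶ Y')
    (hfg : f ≫ g = 𝟙 Y') (hY : M Y) : M Y' :=
  (hM.mem_iff_right Y').2 fun _ hX _ h0 hi => extVanishes_of_retract f g hfg
    (hM.extVanishes hX hY h0 hi)

lemma mem_of_injective (hM : IsNClusterTilting n M) (J : A) [Injective J] : M J := by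
  obtain ⟨X, i, hX, _⟩ := hM.generatingCogenerating.2 J
  exact hM.mem_of_retract i (Injective.factorThru (𝟙 J) i) (Injective.comp_factorThru _ _) hX

lemma mem_of_projective (hM : IsNClusterTilting n M) (P : A) [Projective P] : M P := by
  obtain ⟨X, p, hX, _⟩ := hM.generatingCogenerating.1 P
  exact hM.mem_of_retract (Projective.factorThru (𝟙 P) p) p (Projective.factorThru_comp _ _) hX

/-- A right approximation of the pullback formed in the abelian category is a weak pullback in `M`.
-/
lemma hasWeakPullbacks (hM : IsNClusterTilting n M) : HasWeakPullbacks M.FullSubcategory := by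
  intro X Y Z f g
  obtain ⟨W, π, hW, -⟩ := hM.exists_right (pullback f.hom g.hom)
  refine ⟨⟨W, hW.1⟩, ObjectProperty.homMk (π ≫ pullback.fst _ _),
    ObjectProperty.homMk (π ≫ pullback.snd _ _), ObjectProperty.hom_ext _ ?_, fun T a b hab => ?_⟩
  · simp [pullback.condition]
  · have hab' : a.hom ≫ f.hom = b.hom ≫ g.hom := congrArg (fun φ => φ.hom) hab
    obtain ⟨t, ht⟩ := hW.2 T.property (pullback.lift a.hom b.hom hab')
    have ht' : ∀ {V : A} (k : _ ⟶ V), t ≫ π ≫ k = pullback.lift a.hom b.hom hab' ≫ k :=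
      fun k => by rw [← ht, Category.assoc]
    exact ⟨ObjectProperty.homMk t,
      ObjectProperty.hom_ext _ ((ht' _).trans (pullback.lift_fst _ _ _)),
      ObjectProperty.hom_ext _ ((ht' _).trans (pullback.lift_snd _ _ _))⟩

lemma hasWeakPullbacks_op (hM : IsNClusterTilting n M) :
    HasWeakPullbacks M.FullSubcategoryᵒᵖ := by
  intro X Y Z f g
  obtain ⟨W, π, hW, -⟩ := hM.exists_left (pushout f.unop.hom g.unop.hom)
  let W' : M.FullSubcategory := ⟨W, hW.1⟩
  let p : X.unop ⟶ W' := ObjectProperty.homMk (pushout.inl f.unop.hom g.unop.hom ≫ π)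
  let q : Y.unop ⟶ W' := ObjectProperty.homMk (pushout.inr f.unop.hom g.unop.hom ≫ π)
  refine ⟨op W', p.op, q.op, Quiver.Hom.unop_inj (ObjectProperty.hom_ext _ ?_), fun T a b hab => ?_⟩
  · simp [p, q, pushout.condition_assoc]
  · have hab' : f.unop.hom ≫ a.unop.hom = g.unop.hom ≫ b.unop.hom :=
      congrArg (fun φ => φ.unop.hom) hab
    obtain ⟨t, ht⟩ := hW.2 T.unop.property (pushout.desc a.unop.hom b.unop.hom hab')
    let t' : W' ⟶ T.unop := ObjectProperty.homMk t
    refine ⟨t'.op, Quiver.Hom.unop_inj (ObjectProperty.hom_ext _ ?_),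
      Quiver.Hom.unop_inj (ObjectProperty.hom_ext _ ?_)⟩
    · exact (Category.assoc _ _ _).trans ((congrArg (_ ≫ ·) ht).trans (pushout.inl_desc _ _ _))
    · exact (Category.assoc _ _ _).trans ((congrArg (_ ≫ ·) ht).trans (pushout.inr_desc _ _ _))

lemma isIdempotentComplete (hM : IsNClusterTilting n M) :
    IsIdempotentComplete M.FullSubcategory where
  idempotents_split X p hp := by
    obtain ⟨Y, i, e, hie, hei⟩ := IsIdempotentComplete.idempotents_split X.obj p.hom
      (congrArg (fun φ => φ.hom) hp)
    exact ⟨⟨Y, hM.mem_of_retract i e hie X.property⟩, ObjectProperty.homMk i,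
      ObjectProperty.homMk e, ObjectProperty.hom_ext _ hie, ObjectProperty.hom_ext _ hei⟩

/-! ### Short resolutions and coresolutions by objects of `M`. -/

lemma isRigidGenerating (hM : IsNClusterTilting n M) (hn : 2 ≤ n) : IsRigidGenerating M.ι where
  full := inferInstance
  faithful := inferInstance
  additive := inferInstance
  hasWeakPullbacks := hM.hasWeakPullbacks
  isIdempotentComplete := hM.isIdempotentComplete
  exists_epi K := by
    obtain ⟨X, p, hX, hp⟩ := hM.generatingCogenerating.1 K
    exact ⟨⟨X, hX⟩, p, hp⟩
  exists_lift S hS := by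
    rintro ⟨X, hX⟩ Y g
    refine exists_lift_of_extVanishes hS ?_ g
    rw [hX]
    exact hM.extVanishes Y.property X.property one_pos (by lia)

lemma isRigidGenerating_op (hM : IsNClusterTilting n M) (hn : 2 ≤ n) :
    IsRigidGenerating M.ι.op where
  full := inferInstance
  faithful := inferInstance
  additive := inferInstance
  hasWeakPullbacks := hM.hasWeakPullbacks_op
  isIdempotentComplete := by
    have := hM.isIdempotentComplete
    infer_instance
  exists_epi K := by
    obtain ⟨X, p, hX, hp⟩ := hM.generatingCogenerating.2 K.unop
    exact ⟨op ⟨X, hX⟩, p.op, inferInstance⟩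
  exists_lift S hS := by
    rintro ⟨X, hX⟩ Y g
    -- In the opposite category lifting means extending along a short exact sequence ending in `M`,
    -- obstructed by `Ext¹(M, M) = 0`.
    obtain ⟨k, hk⟩ := exists_extension_of_extVanishes hS.unop (Y := Y.unop.obj) (by
      change ExtVanishes S.X₁.unop _ _
      rw [hX]
      exact hM.extVanishes X.unop.property Y.unop.property one_pos (by lia)) g.unop
    exact ⟨k.op, Quiver.Hom.unop_inj hk⟩

/-- The kernel of a right approximation of `D` lies in `M`: degree one is the approximation
property, higher degrees follow by dimension shift. Conversely, `Extⁱ(Y, D)` is squeezed between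
`Extⁱ(Y, X₀)` and `Extⁱ⁺¹(Y, X₁)`. -/
lemma hasShortResolution_iff (hM : IsNClusterTilting n M) (D : A) :
    HasShortResolution M.ι D ↔ extOrthogonal M n 0 D := by
  constructor
  · rintro ⟨X₁, X₀, f, p, w, hS⟩
    exact ⟨fun X hX i h0 hi => extVanishes_X₃ hS (hM.extVanishes hX X₀.property h0 (by lia))
      (hM.extVanishes hX X₁.property (by lia) (by lia)), fun X hX i h0 hi => by lia⟩
  · rintro ⟨hD, -⟩
    obtain ⟨X, π, hπ, _⟩ := hM.exists_right D
    have hS : (ShortComplex.mk (kernel.ι π) π (kernel.condition π)).ShortExact :=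
      .mk' (ShortComplex.exact_kernel π) inferInstance inferInstance
    have hK : M (kernel π) := (hM.mem_iff_right _).2 fun Y hY i h0 hi => by
      obtain ⟨i, rfl⟩ := Nat.exists_eq_succ_of_ne_zero h0.ne'
      obtain rfl | hi' := Nat.eq_zero_or_pos i
      · exact extVanishes_X₁_one hS (fun g => hπ.2 hY g) (hM.extVanishes hY hπ.1 h0 hi)
      · exact extVanishes_X₁ hS (hD Y hY i hi' hi) (hM.extVanishes hY hπ.1 h0 hi)
    exact ⟨⟨_, hK⟩, ⟨X, hπ.1⟩, ObjectProperty.homMk (kernel.ι π), π, kernel.condition π, hS⟩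

/-- For `j = n - 2` the condition on `Ext(M, D)` is empty; the other condition says that the
cokernel of a left approximation lies in `M`. -/
lemma hasShortResolution_op_iff (hM : IsNClusterTilting n M) (D : A) :
    HasShortResolution M.ι.op (op D) ↔ extOrthogonal M n (n - 2) D := by
  constructor
  · rintro ⟨X₁, X₀, f, p, w, hS⟩
    exact ⟨fun X hX i h0 hi => by lia, fun X hX i h0 hi => extVanishes_from_X₁ hS.unop
      (hM.extVanishes X₀.unop.property hX h0 (by lia))
      (hM.extVanishes X₁.unop.property hX (by lia) (by lia))⟩
  · rintro ⟨-, hD⟩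
    obtain ⟨X, π, hπ, _⟩ := hM.exists_left D
    have hS : (ShortComplex.mk π (cokernel.π π) (cokernel.condition π)).ShortExact :=
      .mk' (ShortComplex.exact_cokernel π) inferInstance inferInstance
    have hK : M (cokernel π) := (hM.mem_iff_left _).2 fun Y hY i h0 hi => by
      obtain ⟨i, rfl⟩ := Nat.exists_eq_succ_of_ne_zero h0.ne'
      obtain rfl | hi' := Nat.eq_zero_or_pos i
      · exact extVanishes_from_X₃_one hS (fun g => hπ.2 hY g) (hM.extVanishes hπ.1 hY h0 hi)
      · exact extVanishes_from_X₃ hS (hD Y hY i hi' (by lia)) (hM.extVanishes hπ.1 hY h0 hi)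
    let q : (⟨X, hπ.1⟩ : M.FullSubcategory) ⟶ ⟨_, hK⟩ := ObjectProperty.homMk (cokernel.π π)
    exact ⟨op ⟨_, hK⟩, op ⟨X, hπ.1⟩, q.op, π.op, _, hS.op⟩

/-- One right approximation of the target detects all factorizations through `M`, so the relation is
visibly closed under sums. -/
lemma factorRel_iff (P : ObjectProperty A) {X Y : P.FullSubcategory} (f g : X ⟶ Y) {W : A}
    {π : W ⟶ Y.obj} (hπ : IsRightApprox M π) :
    factorRel M.ι P f g ↔ ∃ a : X.obj ⟶ W, a ≫ π = f.hom - g.hom := by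
  constructor
  · rintro ⟨V, a, b, h⟩
    obtain ⟨k, hk⟩ := hπ.2 V.property b
    exact ⟨a ≫ k, by simp [hk, h]⟩
  · rintro ⟨a, h⟩
    exact ⟨⟨W, hπ.1⟩, a, π, h.symm⟩

lemma congruence_factorRel (hM : IsNClusterTilting n M) (P : ObjectProperty A) :
    Congruence (factorRel M.ι P) where
  equivalence {X Y} := by
    obtain ⟨W, π, hπ, -⟩ := hM.exists_right Y.obj
    refine ⟨fun f => ?_, fun {f g} h => ?_, fun {f g k} h h' => ?_⟩ <;>
    simp only [factorRel_iff P _ _ hπ] at *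
    · exact ⟨0, by simp⟩
    · obtain ⟨a, h⟩ := h
      exact ⟨-a, by simp [h]⟩
    · obtain ⟨a, h⟩ := h
      obtain ⟨a', h'⟩ := h'
      exact ⟨a + a', by simp [h, h']⟩
  comp_left f g g' := by
    rintro ⟨Q, a, b, h⟩
    exact ⟨Q, f.hom ≫ a, b, by simp [← h]⟩
  comp_right g := by
    rintro ⟨Q, a, b, h⟩
    exact ⟨Q, a, b ≫ g.hom, by simp [← reassoc_of% h]⟩

/-- A null-homotopy argument: `d.τ₂ - h ≫ T.f` kills `S.f`, hence descends to `S.X₃`. -/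
lemma exists_comp_eq_τ₃ {S T : ShortComplex A} (hS : S.Exact) [Epi S.g] (d : S ⟶ T)
    {h : S.X₂ ⟶ T.X₁} (hh : S.f ≫ h = d.τ₁) : ∃ k : S.X₃ ⟶ T.X₂, k ≫ T.g = d.τ₃ := by
  have hz : S.f ≫ (d.τ₂ - h ≫ T.f) = 0 := by
    rw [Preadditive.comp_sub, reassoc_of% hh, ← d.comm₁₂, sub_self]
  refine ⟨hS.desc _ hz, (cancel_epi S.g).1 ?_⟩
  rw [← Category.assoc, hS.g_desc, Preadditive.sub_comp, Category.assoc, T.zero, comp_zero,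
    sub_zero, d.comm₂₃]

lemma exists_comp_eq_τ₁ {S T : ShortComplex A} (hT : T.Exact) [Mono T.f] (d : S ⟶ T)
    {k : S.X₃ ⟶ T.X₂} (hk : k ≫ T.g = d.τ₃) : ∃ h : S.X₂ ⟶ T.X₁, S.f ≫ h = d.τ₁ := by
  have hz : (d.τ₂ - S.g ≫ k) ≫ T.g = 0 := by
    rw [Preadditive.sub_comp, Category.assoc, hk, d.comm₂₃, sub_self]
  refine ⟨hT.lift _ hz, (cancel_mono T.f).1 ?_⟩
  rw [Category.assoc, hT.lift_f, Preadditive.comp_sub, S.zero_assoc, zero_comp, sub_zero, d.comm₁₂]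

/-- The short exact sequences `0 ⟶ D ⟶ X ⟶ D' ⟶ 0` relating two consecutive orthogonal classes. -/
def syzygySequence (M : ObjectProperty A) (n j : ℕ) : ObjectProperty (ShortComplex A) := fun S =>
  S.ShortExact ∧ M S.X₂ ∧ extOrthogonal M n j S.X₁ ∧ extOrthogonal M n (j + 1) S.X₃

/-- The shift trades one vanishing degree of `Ext(M, -)` for one of `Ext(-, M)`, whose degree one
part is the approximation property. -/
lemma syzygySequence_of_left (hM : IsNClusterTilting n M) {j : ℕ} (hj : j + 2 < n)
    {S : ShortComplex A} (hS : S.ShortExact) (hf : IsLeftApprox M S.f)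
    (h : extOrthogonal M n j S.X₁) : syzygySequence M n j S := by
  refine ⟨hS, hf.1, h, fun X hX i h0 hi => ?_, fun X hX i h0 hi => ?_⟩
  · exact extVanishes_X₃ hS (hM.extVanishes hX hf.1 h0 (by lia))
      (h.1 X hX (i + 1) (by lia) (by lia))
  · obtain ⟨i, rfl⟩ := Nat.exists_eq_succ_of_ne_zero h0.ne'
    obtain rfl | hi' := Nat.eq_zero_or_pos i
    · exact extVanishes_from_X₃_one hS (fun g => hf.2 hX g) (hM.extVanishes hf.1 hX h0 (by lia))
    · exact extVanishes_from_X₃ hS (h.2 X hX i hi' (by lia)) (hM.extVanishes hf.1 hX h0 (by lia))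

lemma syzygySequence_of_right (hM : IsNClusterTilting n M) {j : ℕ} (hj : j + 2 < n)
    {S : ShortComplex A} (hS : S.ShortExact) (hf : IsRightApprox M S.g)
    (h : extOrthogonal M n (j + 1) S.X₃) : syzygySequence M n j S := by
  refine ⟨hS, hf.1, ⟨fun X hX i h0 hi => ?_, fun X hX i h0 hi => ?_⟩, h⟩
  · obtain ⟨i, rfl⟩ := Nat.exists_eq_succ_of_ne_zero h0.ne'
    obtain rfl | hi' := Nat.eq_zero_or_pos i
    · exact extVanishes_X₁_one hS (fun g => hf.2 hX g) (hM.extVanishes hX hf.1 h0 (by lia))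
    · exact extVanishes_X₁ hS (h.1 X hX i hi' (by lia)) (hM.extVanishes hX hf.1 h0 (by lia))
  · exact extVanishes_from_X₁ hS (hM.extVanishes hf.1 hX h0 (by lia))
      (h.2 X hX (i + 1) (by lia) (by lia))

/-- The category of sequences `0 → D → X → D' → 0` mediates between both sides, so approximations
need not be chosen functorially. Maps of left ends extend to sequences since `Ext¹(D', M) = 0`, maps
of right ends since `Ext¹(M, D) = 0`. By the null-homotopy lemmas, two maps of sequences agree
modulo `M` on the left exactly when they do on the right, so both categories are the same quotient.
-/
theorem nonempty_syzygy_equivalence (hM : IsNClusterTilting n M) {j : ℕ} (hj : j + 2 < n) :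
    Nonempty (CategoryTheory.Quotient (factorRel M.ι (extOrthogonal M n j)) ≌
      CategoryTheory.Quotient (factorRel M.ι (extOrthogonal M n (j + 1)))) := by
  let U : (syzygySequence M n j).FullSubcategory ⥤ (extOrthogonal M n j).FullSubcategory :=
    ObjectProperty.lift _ ((syzygySequence M n j).ι ⋙ ShortComplex.π₁) (fun S => S.property.2.2.1)
  let V : (syzygySequence M n j).FullSubcategory ⥤ (extOrthogonal M n (j + 1)).FullSubcategory :=
    ObjectProperty.lift _ ((syzygySequence M n j).ι ⋙ ShortComplex.π₃) (fun S => S.property.2.2.2)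
  -- The bound `j + 2 < n` is what puts degree one in the vanishing range of `Ext(M, X₁)`.
  have lift : ∀ (S : (syzygySequence M n j).FullSubcategory) {Y : A}, M Y →
      ∀ g : Y ⟶ S.obj.X₃, ∃ k : Y ⟶ S.obj.X₂, k ≫ S.obj.g = g := fun S Y hY =>
    exists_lift_of_extVanishes S.property.1 (S.property.2.2.1.1 Y hY 1 one_pos (by lia))
  have extend : ∀ (S : (syzygySequence M n j).FullSubcategory) {Y : A}, M Y →
      ∀ g : S.obj.X₁ ⟶ Y, ∃ k : S.obj.X₂ ⟶ Y, S.obj.f ≫ k = g := fun S Y hY =>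
    exists_extension_of_extVanishes S.property.1 (S.property.2.2.2.2 Y hY 1 one_pos (by lia))
  have hU : U.Full := ⟨fun {S T} φ => by
    have := S.property.1.epi_g
    obtain ⟨k, hk⟩ := extend S T.property.2.1 (φ.hom ≫ T.obj.f)
    have hz : S.obj.f ≫ k ≫ T.obj.g = 0 := by
      rw [reassoc_of% hk]
      exact (Category.assoc _ _ _).trans ((congrArg (φ.hom ≫ ·) T.obj.zero).trans comp_zero)
    exact ⟨ObjectProperty.homMk ⟨φ.hom, k, S.property.1.exact.desc _ hz, hk.symm,
      (S.property.1.exact.g_desc _ hz).symm⟩, rfl⟩⟩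
  have hV : V.Full := ⟨fun {S T} φ => by
    have := T.property.1.mono_f
    obtain ⟨k, hk⟩ := lift T S.property.2.1 (S.obj.g ≫ φ.hom)
    have hz : (S.obj.f ≫ k) ≫ T.obj.g = 0 := by
      rw [Category.assoc, hk]
      exact S.obj.zero_assoc _ |>.trans zero_comp
    exact ⟨ObjectProperty.homMk ⟨T.property.1.exact.lift _ hz, k, φ.hom,
      T.property.1.exact.lift_f _ hz, hk⟩, rfl⟩⟩
  have hU' : U.EssSurj := ⟨fun D => by
    obtain ⟨X, i, hi, _⟩ := hM.exists_left D.obj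
    have hS : (ShortComplex.mk i (cokernel.π i) (cokernel.condition i)).ShortExact :=
      .mk' (ShortComplex.exact_cokernel i) inferInstance inferInstance
    exact ⟨⟨_, hM.syzygySequence_of_left hj hS hi D.property⟩, ⟨Iso.refl _⟩⟩⟩
  have hV' : V.EssSurj := ⟨fun D => by
    obtain ⟨X, p, hp, _⟩ := hM.exists_right D.obj
    have hS : (ShortComplex.mk (kernel.ι p) p (kernel.condition p)).ShortExact :=
      .mk' (ShortComplex.exact_kernel p) inferInstance inferInstance
    exact ⟨⟨_, hM.syzygySequence_of_right hj hS hp D.property⟩, ⟨Iso.refl _⟩⟩⟩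
  have key : ∀ {S T : (syzygySequence M n j).FullSubcategory} (f g : S ⟶ T),
      factorRel M.ι _ (U.map f) (U.map g) ↔ factorRel M.ι _ (V.map f) (V.map g) := by
    intro S T f g
    have := S.property.1.epi_g
    have := T.property.1.mono_f
    let d : S.obj ⟶ T.obj := f.hom - g.hom
    constructor
    · rintro ⟨W, a, b, hab⟩
      obtain ⟨h, hh⟩ := extend S W.property a
      obtain ⟨k, hk⟩ := exists_comp_eq_τ₃ S.property.1.exact d (h := h ≫ b)
        ((Category.assoc _ _ _).symm.trans ((congrArg (· ≫ b) hh).trans hab.symm))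
      exact ⟨⟨_, T.property.2.1⟩, k, T.obj.g, hk.symm⟩
    · rintro ⟨W, a, b, hab⟩
      obtain ⟨h, hh⟩ := lift T W.property b
      obtain ⟨k, hk⟩ := exists_comp_eq_τ₁ T.property.1.exact d (k := a ≫ h)
        ((Category.assoc _ _ _).trans ((congrArg (a ≫ ·) hh).trans hab.symm))
      exact ⟨⟨_, S.property.2.1⟩, S.obj.f, k, hk.symm⟩
  have := hM.congruence_factorRel (extOrthogonal M n j)
  have := hM.congruence_factorRel (extOrthogonal M n (j + 1))
  let r : HomRel (syzygySequence M n j).FullSubcategory := fun _ _ f g =>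
    factorRel M.ι _ (U.map f) (U.map g)
  obtain ⟨e₁⟩ := nonempty_quotient_equivalence r
    (U ⋙ CategoryTheory.Quotient.functor (factorRel M.ι (extOrthogonal M n j)))
    fun f g => CategoryTheory.Quotient.functor_map_eq_iff _ (U.map f) (U.map g)
  obtain ⟨e₂⟩ := nonempty_quotient_equivalence r
    (V ⋙ CategoryTheory.Quotient.functor (factorRel M.ι (extOrthogonal M n (j + 1))))
    fun f g => (CategoryTheory.Quotient.functor_map_eq_iff _ (V.map f) (V.map g)).trans
      (key f g).symm
  exact ⟨e₁.symm.trans e₂⟩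

theorem nonempty_iterated_syzygy_equivalence (hM : IsNClusterTilting n M) (j : ℕ)
    (hj : j + 1 < n) :
    Nonempty (CategoryTheory.Quotient (factorRel M.ι (extOrthogonal M n 0)) ≌
      CategoryTheory.Quotient (factorRel M.ι (extOrthogonal M n j))) := by
  induction j with
  | zero => exact ⟨.refl⟩
  | succ j ih =>
    obtain ⟨e⟩ := ih (by lia)
    obtain ⟨e'⟩ := hM.nonempty_syzygy_equivalence (j := j) (by lia)
    exact ⟨e.trans e'⟩

end IsNClusterTilting

/-- The dual of `IsRigidGenerating.nonempty_equivalence`. -/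
theorem IsRigidGenerating.nonempty_equivalence_op {C : Type w} [Category.{v} C] [Preadditive C]
    {ι : C ⥤ A} (h : IsRigidGenerating ι.op) (P : ObjectProperty A)
    (hP : ∀ D, HasShortResolution ι.op (op D) ↔ P D) :
    Nonempty (CategoryTheory.Quotient (factorRel ι P) ≌ (StableCat (projDimLEOne Cᵒᵖ))ᵒᵖ) := by
  have := h.full_functor
  have := h.essSurj_functor
  have := enoughProjectives_finPresMod h.hasWeakPullbacks
  obtain rfl : (HasShortResolution ι.op).unop = P := by
    funext D
    exact propext (hP D)
  let L : (HasShortResolution ι.op).unop.FullSubcategoryᵒᵖ ⥤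
      (HasShortResolution ι.op).FullSubcategory :=
    (ObjectProperty.opEquivalence (HasShortResolution ι.op).unop).inverse
  have : L.Full := inferInstanceAs (ObjectProperty.opEquivalence _).inverse.Full
  have : L.EssSurj := inferInstanceAs (ObjectProperty.opEquivalence _).inverse.EssSurj
  let V : (HasShortResolution ι.op).unop.FullSubcategoryᵒᵖ ⥤ StableCat (projDimLEOne Cᵒᵖ) :=
    L ⋙ h.functor ⋙ CategoryTheory.Quotient.functor (stableRel (projDimLEOne Cᵒᵖ))
  have : V.rightOp.EssSurj := ⟨fun Y => by
    obtain ⟨X, ⟨e⟩⟩ := Functor.EssSurj.mem_essImage (F := V) Y.unop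
    exact ⟨X.unop, ⟨e.symm.op⟩⟩⟩
  refine nonempty_quotient_equivalence _ V.rightOp fun {X Y} f g => ?_
  have h1 : V.rightOp.map f = V.rightOp.map g ↔ V.map f.op = V.map g.op :=
    ⟨fun h => congrArg Quiver.Hom.unop h, fun h => congrArg Quiver.Hom.op h⟩
  rw [h1]
  refine (CategoryTheory.Quotient.functor_map_eq_iff _ _ _).trans
    ((h.stableRel_iff (L.map f.op) (L.map g.op)).trans ⟨?_, ?_⟩)
  · rintro ⟨W, a, b, hab⟩
    exact ⟨W.unop, b.unop, a.unop, congrArg Quiver.Hom.unop hab⟩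
  · rintro ⟨W, a, b, hab⟩
    exact ⟨op W, b.op, a.op, congrArg Quiver.Hom.op hab⟩

end ClusterTiltingSyzygy

/-! ### Forms on modules over an artin algebra -/

section ArtinAlgebraModules

variable {R : Type u} [CommRing R] {Λ : Type u} [Ring Λ] [Algebra R Λ]
  {E : Type u} [AddCommGroup E] [Module R E]
  {X Y : Type u} [AddCommGroup X] [Module R X] [Module Λ X] [IsScalarTower R Λ X]
  [AddCommGroup Y] [Module R Y] [Module Λ Y] [IsScalarTower R Λ Y]

variable (R Λ E) in
/-- The left `Λ`-module `Hom_R(Λ, E)`. -/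
def AlgDual : Type u := Λ →ₗ[R] E

namespace AlgDual

instance : AddCommGroup (AlgDual R Λ E) := inferInstanceAs (AddCommGroup (Λ →ₗ[R] E))

instance : FunLike (AlgDual R Λ E) Λ E := inferInstanceAs (FunLike (Λ →ₗ[R] E) Λ E)

instance : LinearMapClass (AlgDual R Λ E) R Λ E :=
  inferInstanceAs (LinearMapClass (Λ →ₗ[R] E) R Λ E)

@[ext] lemma ext {φ ψ : AlgDual R Λ E} (h : ∀ l, φ l = ψ l) : φ = ψ := DFunLike.ext _ _ h

lemma add_apply (φ ψ : AlgDual R Λ E) (l : Λ) : (φ + ψ) l = φ l + ψ l := rfl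

lemma zero_apply (l : Λ) : (0 : AlgDual R Λ E) l = 0 := rfl

instance : SMul Λ (AlgDual R Λ E) where
  smul m φ := (show Λ →ₗ[R] E from φ) ∘ₗ LinearMap.mulRight R m

lemma smul_apply (m : Λ) (φ : AlgDual R Λ E) (l : Λ) : (m • φ) l = φ (l * m) := rfl

instance : Module Λ (AlgDual R Λ E) where
  one_smul φ := ext fun l => by rw [smul_apply, mul_one]
  mul_smul m m' φ := ext fun l => by simp only [smul_apply, mul_assoc]
  smul_zero m := rfl
  smul_add m φ ψ := rfl
  add_smul m m' φ := ext fun l => by simp only [smul_apply, add_apply, mul_add, map_add]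
  zero_smul φ := ext fun l => by rw [smul_apply, mul_zero, map_zero, zero_apply]

lemma finite (hE : IsDualizingModule R E) [Module.Finite R Λ] :
    Module.Finite Λ (AlgDual R Λ E) := by
  let : Module R (AlgDual R Λ E) := inferInstanceAs (Module R (Λ →ₗ[R] E))
  have : Module.Finite R (AlgDual R Λ E) := hE.finite_dual Λ
  have : IsScalarTower R Λ (AlgDual R Λ E) := ⟨fun r m φ => ext fun l => by
    rw [smul_apply, mul_smul_comm]
    exact map_smul (show Λ →ₗ[R] E from φ) r _⟩
  exact Module.Finite.of_restrictScalars_finite R Λ _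

/-- The `Λ`-linear map to `Hom_R(Λ, E)` corresponding to an `R`-linear form. -/
def lift (ψ : Y →ₗ[R] E) : Y →ₗ[Λ] AlgDual R Λ E where
  toFun y := ψ ∘ₗ LinearMap.toSpanSingleton Λ Y y |>.restrictScalars R
  map_add' y y' := ext fun l => by
    change ψ (l • (y + y')) = ψ (l • y) + ψ (l • y')
    rw [smul_add, map_add]
  map_smul' m y := ext fun l => by
    change ψ (l • m • y) = ψ ((l * m) • y)
    rw [mul_smul]

variable (R Λ E) in
/-- Evaluation at one of a coordinate. -/
def evalOne {b : ℕ} [Module R (Fin b → AlgDual R Λ E)] [IsScalarTower R Λ (Fin b → AlgDual R Λ E)]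
    (i : Fin b) : (Fin b → AlgDual R Λ E) →ₗ[R] E where
  toFun φ := φ i 1
  map_add' φ ψ := rfl
  map_smul' r φ := by
    rw [← algebraMap_smul Λ r φ, Pi.smul_apply, smul_apply, one_mul, RingHom.id_apply,
      Algebra.algebraMap_eq_smul_one, map_smul]

omit [Module R Y] [IsScalarTower R Λ Y] in
lemma hom_ext {b : ℕ} {g g' : Y →ₗ[Λ] (Fin b → AlgDual R Λ E)}
    (h : ∀ i y, g y i 1 = g' y i 1) : g = g' := by
  refine LinearMap.ext fun y => funext fun i => ext fun l => ?_
  simpa only [map_smul, Pi.smul_apply, smul_apply, one_mul] using h i (l • y)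

end AlgDual

lemma exists_extension_form (hE : IsDualizingModule R E) {N V : Type u} [AddCommGroup N]
    [Module R N] [AddCommGroup V] [Module R V] (i : N →ₗ[R] V) (hi : Function.Injective i)
    (θ : N →ₗ[R] E) : ∃ ω : V →ₗ[R] E, ω ∘ₗ i = θ :=
  let ⟨ω, hω⟩ := hE.injective.out i hi θ
  ⟨ω, LinearMap.ext hω⟩

/-- The form descends to the range of `s` and extends from there by injectivity of `E`. -/
lemma exists_factor_form (hE : IsDualizingModule R E) {V W : Type u} [AddCommGroup V]
    [Module R V] [AddCommGroup W] [Module R W] (s : V →ₗ[R] W) (ω : V →ₗ[R] E)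
    (h : ∀ x, s x = 0 → ω x = 0) : ∃ ω' : W →ₗ[R] E, ω' ∘ₗ s = ω := by
  obtain ⟨ζ, hζ⟩ := exists_comp_eq_of_surjective s.rangeRestrict s.surjective_rangeRestrict ω
    fun x hx => h x (congrArg Subtype.val hx)
  obtain ⟨ω', rfl⟩ := exists_extension_form hE s.range.subtype Subtype.val_injective ζ
  exact ⟨ω', hζ⟩

/-- By evaluation at one, `Λ`-linear maps into `Hom_R(Λ, E)` are `R`-linear forms, so injectivity is
inherited from `E`. -/
lemma AlgDual.exists_extension (hE : IsDualizingModule R E) {b : ℕ} (f : X →ₗ[Λ] Y)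
    (hf : Function.Injective f) (g : X →ₗ[Λ] (Fin b → AlgDual R Λ E)) :
    ∃ h : Y →ₗ[Λ] (Fin b → AlgDual R Λ E), h ∘ₗ f = g := by
  let : Module R (Fin b → AlgDual R Λ E) := Module.compHom _ (algebraMap R Λ)
  have : IsScalarTower R Λ (Fin b → AlgDual R Λ E) := ⟨fun r l y => by
    rw [Algebra.smul_def, mul_smul]
    rfl⟩
  choose ψ hψ using fun i => exists_extension_form hE (f.restrictScalars R) hf
    (evalOne R Λ E i ∘ₗ g.restrictScalars R)
  refine ⟨LinearMap.pi fun i => lift (ψ i), hom_ext fun i y => ?_⟩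
  exact (congrArg (ψ i) (one_smul Λ _)).trans (LinearMap.congr_fun (hψ i) y)

lemma exists_finite_generators [IsNoetherianRing R] {N : Type u} [AddCommGroup N] [Module R N]
    [Module.Finite R N] (K : Submodule R N) :
    ∃ (a : ℕ) (r : Fin a → N), Submodule.span R (Set.range r) = K := by
  obtain ⟨a, r, hr⟩ := Submodule.fg_iff_exists_fin_generating_family.1
    (IsNoetherian.noetherian K)
  exact ⟨a, r, hr⟩

lemma form_pi_apply {b : ℕ} (ω : (Fin b → Y) →ₗ[R] E) (y : Fin b → Y) :
    ω y = ∑ i, (ω ∘ₗ LinearMap.single R (fun _ => Y) i) (y i) := by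
  conv_lhs => rw [← Finset.univ_sum_single y]
  rw [map_sum]
  rfl

/-- A presentation of the functor `Y ↦ D Hom(X, Y)`. -/
theorem exists_presentation_dual_hom_from [IsNoetherianRing R] [Module.Finite R Λ]
    [Module.Finite Λ X] (hE : IsDualizingModule R E) :
    ∃ (a b : ℕ) (x : Fin b → X) (r : Fin a → Fin b → Λ),
      ∀ (Y : Type u) [AddCommGroup Y] [Module R Y] [Module Λ Y] [IsScalarTower R Λ Y],
        (∀ θ : (X →ₗ[Λ] Y) →ₗ[R] E, ∃ ψ : Fin b → (Y →ₗ[R] E), ∀ u, θ u = ∑ i, ψ i (u (x i))) ∧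
        ∀ ψ : Fin b → (Y →ₗ[R] E), (∀ u : X →ₗ[Λ] Y, ∑ i, ψ i (u (x i)) = 0) ↔
          ∃ ρ : Fin a → (Y →ₗ[R] E), ∀ i y, ψ i y = ∑ j, ρ j (r j i • y) := by
  -- For a presentation `Λᵃ → Λᵇ → X → 0`, the module `Hom(X, Y)` is the kernel of `Yᵇ → Yᵃ`; by
  -- exactness of duality its dual is the cokernel of `(DY)ᵃ → (DY)ᵇ`.
  obtain ⟨b, x, hx⟩ := Module.Finite.exists_fin (R := Λ) (M := X)
  let p := Fintype.linearCombination Λ x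
  have hp : Function.Surjective p := by
    rw [← LinearMap.range_eq_top, ← hx]
    exact Fintype.range_linearCombination Λ x
  obtain ⟨a, r, hr⟩ := exists_finite_generators (p.restrictScalars R).ker
  have hrx : ∀ j, ∑ i, r j i • x i = 0 := fun j => by
    have : r j ∈ (p.restrictScalars R).ker := hr ▸ Submodule.subset_span ⟨j, rfl⟩
    exact this
  refine ⟨a, b, x, r, fun Y _ _ _ _ => ⟨fun θ => ?_, fun ψ => ⟨fun h => ?_, ?_⟩⟩⟩
  · let ev : (X →ₗ[Λ] Y) →ₗ[R] (Fin b → Y) :=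
      { toFun := fun u i => u (x i)
        map_add' := fun u u' => rfl
        map_smul' := fun r u => rfl }
    obtain ⟨ω, rfl⟩ := exists_extension_form hE ev (fun u u' h =>
      LinearMap.ext_on_range hx fun i => congrFun h i) θ
    exact ⟨_, fun u => form_pi_apply ω _⟩
  · let s : (Fin b → Y) →ₗ[R] (Fin a → Y) :=
      { toFun := fun y j => ∑ i, r j i • y i
        map_add' := fun y y' => funext fun j => by
          simp only [Pi.add_apply, smul_add, Finset.sum_add_distrib]
        map_smul' := fun c y => funext fun j => by
          simp only [Pi.smul_apply, RingHom.id_apply, Finset.smul_sum, smul_comm c] }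
    -- A tuple killed by `s` satisfies all relations among the `x i`, hence is the image of `x`
    -- under a homomorphism.
    obtain ⟨ω, hω⟩ := exists_factor_form hE s (∑ i, ψ i ∘ₗ LinearMap.proj i) fun y hy => by
      obtain ⟨u, hu⟩ := exists_comp_eq_of_surjective p hp (Fintype.linearCombination Λ y)
        fun l hl => by
          have : l ∈ Submodule.span R (Set.range r) := hr ▸ hl
          refine Submodule.span_induction (p := fun l _ => Fintype.linearCombination Λ y l = 0)
            ?_ (map_zero _) (fun l l' _ _ h h' => by rw [map_add, h, h', add_zero])
            (fun c l _ h => by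
              rw [← algebraMap_smul Λ c l, map_smul, h, smul_zero]) this
          rintro _ ⟨j, rfl⟩
          exact congrFun hy j
      have hux : ∀ i, u (x i) = y i := fun i => by
        have := LinearMap.congr_fun hu (Pi.single i 1)
        simpa [p, Fintype.linearCombination_apply_single] using this
      have := h u
      simp only [hux] at this
      simpa using this
    refine ⟨fun j => ω ∘ₗ LinearMap.single R (fun _ => Y) j, fun i y => ?_⟩
    have := LinearMap.congr_fun hω (Pi.single i y)
    rw [LinearMap.comp_apply, form_pi_apply] at this
    have hs : ∀ j, s (Pi.single i y) j = r j i • y := fun j => by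
      change ∑ i', r j i' • (Pi.single i y : Fin b → Y) i' = _
      rw [Finset.sum_eq_single i (fun i' _ h => by rw [Pi.single_eq_of_ne h, smul_zero]) (by simp),
        Pi.single_eq_same]
    simp only [hs] at this
    rw [this, LinearMap.sum_apply, Finset.sum_eq_single i (fun i' _ h => by
      rw [LinearMap.comp_apply, LinearMap.proj_apply, Pi.single_eq_of_ne h, map_zero]) (by simp)]
    simp
  · rintro ⟨ρ, h⟩ u
    simp only [h]
    rw [Finset.sum_comm]
    refine Finset.sum_eq_zero fun j _ => ?_
    rw [← map_sum]
    simp only [← map_smul]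
    rw [← map_sum, hrx, map_zero, map_zero]

/-- The linear combinations, with coefficients in `Λ`, of a family of forms. -/
def formCombination {b : ℕ} (ψ : Fin b → (Y →ₗ[R] E)) : (Fin b → Λ) →ₗ[R] (Y →ₗ[R] E) where
  toFun l := ∑ i, ψ i ∘ₗ (Algebra.lsmul R R Y (l i) : Y →ₗ[R] Y)
  map_add' l l' := by
    simp only [Pi.add_apply, map_add, LinearMap.comp_add, Finset.sum_add_distrib]
  map_smul' c l := by
    simp only [Pi.smul_apply, map_smul, LinearMap.comp_smul, Finset.smul_sum, RingHom.id_apply]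

lemma formCombination_apply {b : ℕ} (ψ : Fin b → (Y →ₗ[R] E)) (l : Fin b → Λ) (y : Y) :
    formCombination ψ l y = ∑ i, ψ i (l i • y) := by
  simp [formCombination]

lemma formCombination_single {b : ℕ} (ψ : Fin b → (Y →ₗ[R] E)) (i : Fin b) :
    formCombination ψ (Pi.single i (1 : Λ)) = ψ i := by
  refine LinearMap.ext fun y => ?_
  rw [formCombination_apply, Finset.sum_eq_single i (fun i' _ h => by
    rw [Pi.single_eq_of_ne h, zero_smul, map_zero]) (by simp), Pi.single_eq_same, one_smul]

/-- If `φ` generates the dual of `X`, a family of forms on `Y` satisfying the relations of `φ`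
is the restriction of `φ` along a unique homomorphism. -/
lemma exists_hom_of_formCombination [Module.Finite R X] (hE : IsDualizingModule R E) {b : ℕ}
    (φ : Fin b → (X →ₗ[R] E)) (hφ : Function.Surjective (formCombination (Λ := Λ) φ))
    (ψ : Fin b → (Y →ₗ[R] E)) (h : ∀ l : Fin b → Λ, formCombination φ l = 0 →
      formCombination ψ l = 0) : ∃ u : Y →ₗ[Λ] X, ∀ i, φ i ∘ₗ u.restrictScalars R = ψ i := by
  -- Sending `φ` to `ψ` defines a map from the dual of `X` to the dual of `Y`, which is the
  -- transpose of some `f : Y → X`.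
  obtain ⟨T, hT⟩ := exists_comp_eq_of_surjective _ hφ (formCombination ψ) h
  obtain ⟨f, hf⟩ := exists_dual_eq hE X Y T
  have hfl : ∀ (l : Fin b → Λ) (y : Y), ∑ i, φ i (l i • f y) = ∑ i, ψ i (l i • y) := fun l y => by
    rw [← formCombination_apply, hf, ← LinearMap.comp_apply, hT, formCombination_apply]
  refine ⟨{ toFun := f, map_add' := map_add f, map_smul' := fun m y => ?_ }, fun i => ?_⟩
  -- Forms separate points of `X`, so `Λ`-linearity is checked on combinations of `φ`.
  · refine (hE.bijective_eval X).1 (LinearMap.ext fun ξ => ?_)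
    obtain ⟨l, rfl⟩ := hφ ξ
    have := (hfl l (m • y)).trans ((Finset.sum_congr rfl fun i _ => by rw [mul_smul]).trans
      (hfl (fun i => l i * m) y).symm)
    simpa only [LinearMap.applyₗ_apply_apply, formCombination_apply, mul_smul,
      RingHom.id_apply] using this
  · refine LinearMap.ext fun y => ?_
    rw [← formCombination_single (Λ := Λ) φ i, ← formCombination_single (Λ := Λ) ψ i]
    rw [LinearMap.comp_apply, formCombination_apply, formCombination_apply]
    exact hfl (Pi.single i 1) y

lemma exists_eq_sum_apply [Module.Finite R Y] (hE : IsDualizingModule R E) {b : ℕ}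
    (ω : (Fin b → (Y →ₗ[R] E)) →ₗ[R] E) : ∃ y : Fin b → Y, ∀ ψ, ω ψ = ∑ i, ψ i (y i) := by
  choose y hy using fun i => (hE.bijective_eval Y).2
    (ω ∘ₗ LinearMap.single R (fun _ => Y →ₗ[R] E) i)
  refine ⟨y, fun ψ => (form_pi_apply ω ψ).trans (Finset.sum_congr rfl fun i _ => ?_)⟩
  rw [← hy i]
  rfl

/-- A presentation of the functor `Y ↦ D Hom(Y, X)`. -/
theorem exists_presentation_dual_hom_to [IsNoetherianRing R] [Module.Finite R Λ]
    [Module.Finite R X] (hE : IsDualizingModule R E) :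
    ∃ (a b : ℕ) (φ : Fin b → (X →ₗ[R] E)) (r : Fin a → Fin b → Λ),
      ∀ (Y : Type u) [AddCommGroup Y] [Module R Y] [Module Λ Y] [IsScalarTower R Λ Y]
        [Module.Finite R Y],
        (∀ θ : (Y →ₗ[Λ] X) →ₗ[R] E, ∃ y : Fin b → Y, ∀ u, θ u = ∑ i, φ i (u (y i))) ∧
        ∀ y : Fin b → Y, (∀ u : Y →ₗ[Λ] X, ∑ i, φ i (u (y i)) = 0) ↔
          ∃ z : Fin a → Y, ∀ i, y i = ∑ j, r j i • z j := by
  have := hE.finite_dual X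
  -- Conceptually, `D Hom(Y, X)` is `DX ⊗ Y`; a presentation `Λᵃ → Λᵇ → DX → 0` of right modules
  -- makes it the cokernel of `Yᵃ → Yᵇ`.
  obtain ⟨b, φ, hφ⟩ := Module.Finite.exists_fin (R := R) (M := X →ₗ[R] E)
  have hX : ∀ {x x' : X}, (∀ i, φ i x = φ i x') → x = x' := fun {x x'} h =>
    (hE.bijective_eval X).1 (LinearMap.ext_on_range hφ h)
  have hq : Function.Surjective (formCombination (Λ := Λ) φ) := by
    rw [← LinearMap.range_eq_top, eq_top_iff, ← hφ, Submodule.span_le]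
    rintro _ ⟨i, rfl⟩
    exact ⟨_, formCombination_single φ i⟩
  obtain ⟨a, r, hr⟩ := exists_finite_generators (formCombination (Λ := Λ) φ).ker
  have hrφ : ∀ j, formCombination φ (r j) = 0 := fun j => by
    have : r j ∈ (formCombination φ).ker := hr ▸ Submodule.subset_span ⟨j, rfl⟩
    exact this
  refine ⟨a, b, φ, r, fun Y _ _ _ _ _ => ⟨fun θ => ?_, fun y => ⟨fun h => ?_, ?_⟩⟩⟩
  · let ev : (Y →ₗ[Λ] X) →ₗ[R] (Fin b → (Y →ₗ[R] E)) :=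
      { toFun := fun u i => φ i ∘ₗ u.restrictScalars R
        map_add' := fun u u' => funext fun i => LinearMap.ext fun y => map_add (φ i) (u y) (u' y)
        map_smul' := fun c u => funext fun i => LinearMap.ext fun y => map_smul (φ i) c (u y) }
    obtain ⟨ω, rfl⟩ := exists_extension_form hE ev (fun u u' h =>
      LinearMap.ext fun y => hX fun i => LinearMap.congr_fun (congrFun h i) y) θ
    obtain ⟨y, hy⟩ := exists_eq_sum_apply hE ω
    exact ⟨y, fun u => hy _⟩
  · let s : (Fin b → (Y →ₗ[R] E)) →ₗ[R] (Fin a → (Y →ₗ[R] E)) :=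
      { toFun := fun ψ j => formCombination ψ (r j)
        map_add' := fun ψ ψ' => funext fun j => LinearMap.ext fun y => by
          simp only [formCombination_apply, Pi.add_apply, LinearMap.add_apply,
            Finset.sum_add_distrib]
        map_smul' := fun c ψ => funext fun j => LinearMap.ext fun y => by
          simp only [formCombination_apply, Pi.smul_apply, LinearMap.smul_apply,
            Finset.smul_sum, RingHom.id_apply] }
    let ω : (Fin b → (Y →ₗ[R] E)) →ₗ[R] E :=
      ∑ i, LinearMap.applyₗ (y i) ∘ₗ LinearMap.proj i
    have hω : ∀ ψ, ω ψ = ∑ i, ψ i (y i) := fun ψ => by simp [ω]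
    obtain ⟨ω', hω'⟩ := exists_factor_form hE s ω fun ψ hψ => by
      obtain ⟨u, hu⟩ := exists_hom_of_formCombination hE φ hq ψ fun l hl => by
        have : l ∈ Submodule.span R (Set.range r) := hr ▸ hl
        refine (Submodule.span_le (p := (formCombination ψ).ker)).2 ?_ this
        rintro _ ⟨j, rfl⟩
        exact congrFun hψ j
      rw [hω, ← h u]
      exact Finset.sum_congr rfl fun i _ => (LinearMap.congr_fun (hu i) (y i)).symm
    obtain ⟨z, hz⟩ := exists_eq_sum_apply hE ω'
    refine ⟨z, fun i => (hE.bijective_eval Y).1 (LinearMap.ext fun η => ?_)⟩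
    have hs : ∀ j, s (Pi.single i η) j (z j) = η (r j i • z j) := fun j => by
      change formCombination (Pi.single i η) (r j) (z j) = _
      rw [formCombination_apply, Finset.sum_eq_single i (fun i' _ h => by
        rw [Pi.single_eq_of_ne h, LinearMap.zero_apply]) (by simp), Pi.single_eq_same]
    have := LinearMap.congr_fun hω' (Pi.single i η)
    rw [LinearMap.comp_apply, hz, hω, Finset.sum_eq_single i (fun i' _ h => by
        rw [Pi.single_eq_of_ne h, LinearMap.zero_apply]) (by simp), Pi.single_eq_same] at this
    rw [LinearMap.applyₗ_apply_apply, LinearMap.applyₗ_apply_apply, ← this, map_sum]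
    exact Finset.sum_congr rfl fun j _ => hs j
  · rintro ⟨z, h⟩ u
    simp only [h, map_sum, map_smul]
    rw [Finset.sum_comm]
    refine Finset.sum_eq_zero fun j _ => ?_
    rw [← formCombination_apply, hrφ, LinearMap.zero_apply]

end ArtinAlgebraModules

/-! ### Subcategories of the module category of an artin algebra -/

section ArtinAlgebra

open Opposite

variable {R : Type u} [CommRing R] {Λ : Type u} [Ring Λ] [Algebra R Λ]

/-- A `Λ`-module, with the induced module structure over the base ring. -/
def AlgModule (_ : Type u) {Λ : Type u} [Ring Λ] (Y : FGModuleCat.{u} Λ) : Type u := Y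

namespace AlgModule

variable (Y : FGModuleCat.{u} Λ)

instance : AddCommGroup (AlgModule R Y) := inferInstanceAs (AddCommGroup Y)

instance : Module Λ (AlgModule R Y) := inferInstanceAs (Module Λ Y)

instance : Module R (AlgModule R Y) := Module.compHom Y (algebraMap R Λ)

instance : IsScalarTower R Λ (AlgModule R Y) where
  smul_assoc r l y := by
    rw [Algebra.smul_def, mul_smul]
    rfl

instance : Module.Finite Λ (AlgModule R Y) := inferInstanceAs (Module.Finite Λ Y)

instance [Module.Finite R Λ] : Module.Finite R (AlgModule R Y) := Module.Finite.trans Λ _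

end AlgModule

variable {M : ObjectProperty (FGModuleCat.{u} Λ)}

variable (R) in
/-- The linear map underlying a morphism. -/
def toLin {X Y : M.FullSubcategory} (f : X ⟶ Y) : AlgModule R X.obj →ₗ[Λ] AlgModule R Y.obj :=
  f.hom.hom.hom

/-- The morphism associated with a linear map. -/
def ofLin {X Y : M.FullSubcategory} (f : AlgModule R X.obj →ₗ[Λ] AlgModule R Y.obj) : X ⟶ Y :=
  ObjectProperty.homMk (ObjectProperty.homMk (ModuleCat.ofHom f))

omit [CommRing R] [Algebra R Λ] in
lemma ofLin_toLin {X Y : M.FullSubcategory} (f : X ⟶ Y) : ofLin (toLin R f) = f := rfl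

variable (R M) in
/-- The action of the base ring on a category of modules over an algebra. -/
def algebraAction : CenterAction R M.FullSubcategory where
  act r X := ofLin (R := R) (r • LinearMap.id)
  one X := by rw [one_smul]; rfl
  mul r s X := by
    rw [mul_comm, mul_smul]
    rfl
  add r s X := by rw [add_smul]; rfl
  comm r X Y f := ObjectProperty.hom_ext _ (FGModuleCat.hom_ext (LinearMap.ext fun x => by
    exact LinearMap.map_smul_of_tower (toLin R f) r x))

lemma act_comp (r : R) {X Y : M.FullSubcategory}
    (f : AlgModule R X.obj →ₗ[Λ] AlgModule R Y.obj) :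
    (algebraAction R M).act r X ≫ ofLin f = ofLin (r • f) := by
  rw [(algebraAction R M).comm]
  rfl

lemma isHomFinite_algebraAction [IsNoetherianRing R] [Module.Finite R Λ] :
    IsHomFinite (algebraAction R M) := by
  intro X Y
  have : Module.Finite R (AlgModule R X.obj →ₗ[R] AlgModule R Y.obj) :=
    Module.IsNoetherian.finite R _
  have : Module.Finite R (AlgModule R X.obj →ₗ[Λ] AlgModule R Y.obj) :=
    Module.Finite.of_injective (LinearMap.restrictScalarsₗ R Λ _ _ R)
      (LinearMap.restrictScalars_injective R)
  obtain ⟨n, b, hb⟩ := Module.Finite.exists_fin (R := R)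
    (M := AlgModule R X.obj →ₗ[Λ] AlgModule R Y.obj)
  refine ⟨n, fun i => ofLin (b i), fun f => ?_⟩
  obtain ⟨c, hc⟩ := (Submodule.mem_span_range_iff_exists_fun R).1
    (hb ▸ Submodule.mem_top : toLin R f ∈ Submodule.span R (Set.range b))
  refine ⟨c, ?_⟩
  simp only [act_comp]
  have hsum : ∀ s : Finset (Fin n), ofLin (R := R) (∑ i ∈ s, c i • b i) =
      ∑ i ∈ s, (ofLin (c i • b i) : X ⟶ Y) := fun s => by
    induction s using Finset.cons_induction with
    | empty => rfl
    | cons i s hi ih => rw [Finset.sum_cons, Finset.sum_cons, ← ih]; rfl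
  rw [← hsum, hc, ofLin_toLin]

variable {E : Type u} [AddCommGroup E] [Module R E] (hE : IsDualizingModule R E)

/-- A linear functor represented by `B` is identified with the linear maps to `B`. -/
def linEquivOfRepresentable {H : M.FullSubcategoryᵒᵖ ⥤ FGModuleCat.{u} R}
    (hH : IsLinearFunctor (algebraAction R M) H) {B : M.FullSubcategory} (x : H.obj (op B))
    (hadd : ∀ (Y : M.FullSubcategory) (g g' : Y ⟶ B), lres H (g + g') x = lres H g x + lres H g' x)
    (hx : ∀ Y, Function.Bijective (fun g : Y ⟶ B => lres H g x)) (Y : M.FullSubcategory) :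
    (AlgModule R Y.obj →ₗ[Λ] AlgModule R B.obj) ≃ₗ[R] H.obj (op Y) :=
  LinearEquiv.ofBijective
    { toFun := fun g => lres H (ofLin g) x
      map_add' := fun g g' => hadd Y (ofLin g) (ofLin g')
      map_smul' := fun r g => by
        rw [← act_comp, RingHom.id_apply, ← hH Y r]
        exact congrArg (fun φ => φ.hom.hom x) (H.map_comp (ofLin g).op
          ((algebraAction R M).act r Y).op) }
    ⟨fun g g' h => congrArg (toLin R) ((hx Y).1 h), fun y =>
      let ⟨g, hg⟩ := (hx Y).2 y
      ⟨toLin R g, hg⟩⟩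

lemma lres_linEquivOfRepresentable {H : M.FullSubcategoryᵒᵖ ⥤ FGModuleCat.{u} R}
    (hH : IsLinearFunctor (algebraAction R M) H) {B : M.FullSubcategory} (x : H.obj (op B))
    (hadd : ∀ (Y : M.FullSubcategory) (g g' : Y ⟶ B), lres H (g + g') x = lres H g x + lres H g' x)
    (hx : ∀ Y, Function.Bijective (fun g : Y ⟶ B => lres H g x)) {Y Z : M.FullSubcategory}
    (f : Y ⟶ Z) (u : AlgModule R Z.obj →ₗ[Λ] AlgModule R B.obj) :
    lres H f (linEquivOfRepresentable hH x hadd hx Z u) =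
      linEquivOfRepresentable hH x hadd hx Y (u ∘ₗ toLin R f) :=
  (congrArg (fun φ => φ.hom.hom x) (H.map_comp (ofLin u).op f.op)).symm

variable (R) in
/-- `P` is a free module with basis `s`. -/
def IsFreeOn (P : M.FullSubcategory) {c : ℕ} (s : Fin c → AlgModule R P.obj) : Prop :=
  ∀ (Y : M.FullSubcategory) (y : Fin c → AlgModule R Y.obj),
    ∃! g : P ⟶ Y, ∀ i, toLin R g (s i) = y i

/-- `J` is a cofree module with cobasis `t`. -/
def IsCofreeOn (J : M.FullSubcategory) {c : ℕ} (t : Fin c → (AlgModule R J.obj →ₗ[R] E)) : Prop :=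
  ∀ (Y : M.FullSubcategory) (ψ : Fin c → (AlgModule R Y.obj →ₗ[R] E)),
    ∃! g : Y ⟶ J, ∀ i y, t i (toLin R g y) = ψ i y

omit [CommRing R] [Algebra R Λ] in
lemma exists_isFreeOn (c : ℕ) (h : M (FGModuleCat.of Λ (Fin c → Λ))) :
    ∃ (P : M.FullSubcategory) (s : Fin c → AlgModule R P.obj), IsFreeOn R P s :=
  ⟨⟨_, h⟩, fun i => (Pi.single i 1 : Fin c → Λ), fun _ y =>
    ⟨ofLin (R := R) (Fintype.linearCombination Λ y), fun i =>
      (Fintype.linearCombination_apply_single Λ y i 1).trans (one_smul _ _), fun g hg =>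
      congrArg (ofLin (R := R)) (LinearMap.pi_ext' (f := toLin R g) fun i => LinearMap.ext_ring
        ((hg i).trans ((Fintype.linearCombination_apply_single Λ y i 1).trans
          (one_smul _ _)).symm))⟩⟩

lemma exists_isCofreeOn [Module.Finite Λ (AlgDual R Λ E)] (c : ℕ)
    (h : M (FGModuleCat.of Λ (Fin c → AlgDual R Λ E))) :
    ∃ (J : M.FullSubcategory) (t : Fin c → (AlgModule R J.obj →ₗ[R] E)), IsCofreeOn J t := by
  let : Module R (Fin c → AlgDual R Λ E) := Module.compHom _ (algebraMap R Λ)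
  have : IsScalarTower R Λ (Fin c → AlgDual R Λ E) := ⟨fun r l y => by
    rw [Algebra.smul_def, mul_smul]
    rfl⟩
  exact ⟨⟨_, h⟩, AlgDual.evalOne R Λ E, fun Y ψ =>
    ⟨ofLin (R := R) (LinearMap.pi fun i => AlgDual.lift (ψ i)), fun i y =>
      congrArg (ψ i) (one_smul Λ y), fun g hg =>
      congrArg (ofLin (R := R)) (AlgDual.hom_ext (g := toLin R g) fun i y =>
        (hg i y).trans (congrArg (ψ i) (one_smul Λ y)).symm)⟩⟩

/-- Homomorphisms from a free module of rank `c` to `Y` are the elements of `Yᶜ`, so the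
presentation `Yᵃ → Yᵇ → D Hom(Y, B) → 0` consists of functors represented by objects of `M`. -/
theorem dualRepresentableFinPres_algebraAction [IsNoetherianRing R] [Module.Finite R Λ]
    (hM : ∀ c : ℕ, ∃ (P : M.FullSubcategory) (s : Fin c → AlgModule R P.obj), IsFreeOn R P s) :
    DualRepresentableFinPres (algebraAction R M) hE := by
  intro H hH B x hadd hx
  let e := linEquivOfRepresentable hH x hadd hx
  have he : ∀ {Y Z : M.FullSubcategory} (f : Y ⟶ Z) u, lres H f (e Z u) = e Y (u ∘ₗ toLin R f) :=
    fun f u => lres_linEquivOfRepresentable hH x hadd hx f u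
  obtain ⟨a, b, φ, r, hr⟩ := exists_presentation_dual_hom_to (Λ := Λ) (X := AlgModule R B.obj) hE
  obtain ⟨P, s, hs⟩ := hM b
  obtain ⟨Q, t, ht⟩ := hM a
  let ω : (AlgModule R P.obj →ₗ[Λ] AlgModule R B.obj) →ₗ[R] E :=
    { toFun := fun u => ∑ i, φ i (u (s i))
      map_add' := fun u u' => by simp only [LinearMap.add_apply, map_add, Finset.sum_add_distrib]
      map_smul' := fun c u => by
        simp only [LinearMap.smul_apply, map_smul, Finset.smul_sum, RingHom.id_apply] }
  let G := dualFunctor hE H ⋙ forgetAb R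
  let ξ : G.obj (op (op P)) := ω ∘ₗ (e P).symm.toLinearMap
  have hξ : ∀ {Y : M.FullSubcategory} (g : P ⟶ Y) u,
      dualEl hE (res G g.op ξ) (e Y u) = ∑ i, φ i (u (toLin R g (s i))) := fun {Y} g u => by
    change ω ((e P).symm (lres H g (e Y u))) = _
    rw [he, LinearEquiv.symm_apply_apply]
    rfl
  have ext : ∀ {Y : M.FullSubcategory} {θ θ' : G.obj (op (op Y))},
      (∀ u, dualEl hE θ (e Y u) = dualEl hE θ' (e Y u)) → θ = θ' := fun {Y θ θ'} h =>
    LinearMap.ext fun y => by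
      obtain ⟨u, rfl⟩ := (e Y).surjective y
      exact h u
  -- Precomposition with `f` sends a tuple `z` to the tuple `∑ j, r j i • z j`, the relation map of
  -- the presentation.
  obtain ⟨f, hf, -⟩ := hs Q fun i => ∑ j, r j i • t j
  refine isFinPres_iff.2 ⟨additive_of_res fun {Y Z} f g θ => ext (Y := Y.unop) fun u => ?_,
    op Q, op P, f.op, ξ, ext fun u => ?_, fun {Y} θ => ?_, fun {Y} g hg => ?_⟩
  · change dualEl hE θ (lres H (f.unop + g.unop) (e _ u)) =
      dualEl hE θ (lres H f.unop (e _ u)) + dualEl hE θ (lres H g.unop (e _ u))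
    rw [he, he, he, ← map_add, ← map_add, ← LinearMap.comp_add]
    rfl
  · rw [hξ]
    exact ((hr _).2 _).2 ⟨t, hf⟩ u
  · obtain ⟨y, hy⟩ := (hr _).1 (dualEl hE (X := op Y.unop) θ ∘ₗ (e Y.unop).toLinearMap)
    obtain ⟨g, hg, -⟩ := hs Y.unop y
    refine ⟨g.op, ext (Y := Y.unop) fun u => ?_⟩
    exact (hξ g u).trans ((Finset.sum_congr rfl fun i _ => by rw [hg]).trans (hy u).symm)
  · obtain ⟨z, hz⟩ := ((hr _).2 fun i => toLin R g.unop (s i)).1 fun u => by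
      rw [← hξ (Y := Y.unop) g.unop u, Quiver.Hom.op_unop, hg]
      rfl
    obtain ⟨k, hk, -⟩ := ht Y.unop z
    refine ⟨k.op, Quiver.Hom.unop_inj ((hs Y.unop _).unique (fun i => ?_) hz)⟩
    change toLin R k (toLin R f (s i)) = _
    rw [hf, map_sum]
    exact Finset.sum_congr rfl fun j _ => by rw [map_smul, hk]

/-- A linear functor corepresented by `B` is identified with the linear maps from `B`. -/
def linEquivOfCorepresentable {H : M.FullSubcategoryᵒᵖᵒᵖ ⥤ FGModuleCat.{u} R}
    (hH : IsLinearFunctor (algebraAction R M).op H) {B : M.FullSubcategoryᵒᵖ} (x : H.obj (op B))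
    (hadd : ∀ (Y : M.FullSubcategoryᵒᵖ) (g g' : Y ⟶ B),
      lres H (g + g') x = lres H g x + lres H g' x)
    (hx : ∀ Y, Function.Bijective (fun g : Y ⟶ B => lres H g x)) (Y : M.FullSubcategory) :
    (AlgModule R B.unop.obj →ₗ[Λ] AlgModule R Y.obj) ≃ₗ[R] H.obj (op (op Y)) :=
  LinearEquiv.ofBijective
    { toFun := fun g => lres H (ofLin (X := B.unop) g).op x
      map_add' := fun g g' => hadd (op Y) (ofLin (X := B.unop) g).op (ofLin (X := B.unop) g').op
      map_smul' := fun r g => by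
        rw [RingHom.id_apply, ← hH (op Y) r]
        exact congrArg (fun φ => φ.hom.hom x) (H.map_comp (ofLin (X := B.unop) g).op.op
          ((algebraAction R M).op.act r (op Y)).op) }
    ⟨fun g g' h => congrArg (fun g : op Y ⟶ B => toLin R g.unop) ((hx (op Y)).1 h), fun y =>
      let ⟨g, hg⟩ := (hx (op Y)).2 y
      ⟨toLin R g.unop, hg⟩⟩

lemma lres_linEquivOfCorepresentable {H : M.FullSubcategoryᵒᵖᵒᵖ ⥤ FGModuleCat.{u} R}
    (hH : IsLinearFunctor (algebraAction R M).op H) {B : M.FullSubcategoryᵒᵖ} (x : H.obj (op B))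
    (hadd : ∀ (Y : M.FullSubcategoryᵒᵖ) (g g' : Y ⟶ B),
      lres H (g + g') x = lres H g x + lres H g' x)
    (hx : ∀ Y, Function.Bijective (fun g : Y ⟶ B => lres H g x)) {Y Z : M.FullSubcategory}
    (f : Y ⟶ Z) (u : AlgModule R B.unop.obj →ₗ[Λ] AlgModule R Y.obj) :
    lres H f.op (linEquivOfCorepresentable hH x hadd hx Y u) =
      linEquivOfCorepresentable hH x hadd hx Z (toLin R f ∘ₗ u) :=
  (congrArg (fun φ => φ.hom.hom x) (H.map_comp (ofLin (X := B.unop) u).op.op f.op.op)).symm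

/-- Here `Y ↦ (DY)ᶜ` is represented by a cofree module, and the presentation is `(DY)ᵃ → (DY)ᵇ → D
Hom(B, Y) → 0`. -/
theorem dualRepresentableFinPres_algebraAction_op [IsNoetherianRing R] [Module.Finite R Λ]
    (hM : ∀ c : ℕ, ∃ (J : M.FullSubcategory) (t : Fin c → (AlgModule R J.obj →ₗ[R] E)),
      IsCofreeOn J t) :
    DualRepresentableFinPres (algebraAction R M).op hE := by
  intro H hH B x hadd hx
  let e := linEquivOfCorepresentable hH x hadd hx
  have he : ∀ {Y Z : M.FullSubcategory} (f : Y ⟶ Z) u, lres H f.op (e Y u) =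
      e Z (toLin R f ∘ₗ u) := fun f u => lres_linEquivOfCorepresentable hH x hadd hx f u
  obtain ⟨a, b, x, r, hr⟩ :=
    exists_presentation_dual_hom_from (Λ := Λ) (X := AlgModule R B.unop.obj) hE
  obtain ⟨J, s, hs⟩ := hM b
  obtain ⟨K, t, ht⟩ := hM a
  let ω : (AlgModule R B.unop.obj →ₗ[Λ] AlgModule R J.obj) →ₗ[R] E :=
    { toFun := fun u => ∑ i, s i (u (x i))
      map_add' := fun u u' => by simp only [LinearMap.add_apply, map_add, Finset.sum_add_distrib]
      map_smul' := fun c u => by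
        simp only [LinearMap.smul_apply, map_smul, Finset.smul_sum, RingHom.id_apply] }
  let G := dualFunctor hE H ⋙ forgetAb R
  let ξ : G.obj (op (op (op J))) := ω ∘ₗ (e J).symm.toLinearMap
  have hξ : ∀ {Y : M.FullSubcategory} (g : Y ⟶ J) u,
      dualEl hE (res G g.op.op ξ) (e Y u) = ∑ i, s i (toLin R g (u (x i))) := fun {Y} g u => by
    change ω ((e J).symm (lres H g.op (e Y u))) = _
    rw [he, LinearEquiv.symm_apply_apply]
    rfl
  have ext : ∀ {Y : M.FullSubcategory} {θ θ' : G.obj (op (op (op Y)))},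
      (∀ u, dualEl hE θ (e Y u) = dualEl hE θ' (e Y u)) → θ = θ' := fun {Y θ θ'} h =>
    LinearMap.ext fun y => by
      obtain ⟨u, rfl⟩ := (e Y).surjective y
      exact h u
  obtain ⟨f, hf, -⟩ := hs K fun i => ∑ j, t j ∘ₗ (Algebra.lsmul R R (AlgModule R K.obj) (r j i) :
    AlgModule R K.obj →ₗ[R] AlgModule R K.obj)
  replace hf : ∀ i y, s i (toLin R f y) = ∑ j, t j (r j i • y) := fun i y => by
    rw [hf, LinearMap.sum_apply]
    rfl
  refine isFinPres_iff.2 ⟨additive_of_res fun {Y Z} f g θ => ext (Y := Y.unop.unop) fun u => ?_,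
    op (op K), op (op J), f.op.op, ξ, ext fun u => ?_, fun {Y} θ => ?_, fun {Y} g hg => ?_⟩
  · change dualEl hE θ (lres H (f.unop.unop + g.unop.unop).op (e _ u)) =
      dualEl hE θ (lres H f.unop.unop.op (e _ u)) + dualEl hE θ (lres H g.unop.unop.op (e _ u))
    rw [he, he, he, ← map_add, ← map_add, ← LinearMap.add_comp]
    rfl
  · rw [hξ]
    exact ((hr _).2 fun i => s i ∘ₗ (toLin R f).restrictScalars R).2 ⟨t, hf⟩ u
  · obtain ⟨ψ, hψ⟩ := (hr _).1 (dualEl hE (X := op (op Y.unop.unop)) θ ∘ₗ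
      (e Y.unop.unop).toLinearMap)
    obtain ⟨g, hg, -⟩ := hs Y.unop.unop ψ
    refine ⟨g.op.op, ext (Y := Y.unop.unop) fun u => ?_⟩
    exact (hξ g u).trans ((Finset.sum_congr rfl fun i _ => hg i _).trans (hψ u).symm)
  · obtain ⟨ρ, hρ⟩ := ((hr _).2 fun i => s i ∘ₗ (toLin R g.unop.unop).restrictScalars R).1
      fun u => (hξ g.unop.unop u).symm.trans
        ((congrArg (fun ζ => dualEl hE ζ (e _ u)) hg))
    obtain ⟨k, hk, -⟩ := ht Y.unop.unop ρ
    refine ⟨k.op.op, Quiver.Hom.unop_inj (Quiver.Hom.unop_inj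
      ((hs Y.unop.unop (fun i => s i ∘ₗ (toLin R g.unop.unop).restrictScalars R)).unique
        (fun i y => ?_) fun _ _ => rfl))⟩
    change s i (toLin R f (toLin R k y)) = _
    rw [hf, hρ]
    exact Finset.sum_congr rfl fun j _ => by rw [← map_smul, hk]

/-- Modules `Λᶜ` are projective and modules `Hom_R(Λ, E)ᶜ` are injective, so `M` contains the free
and cofree modules needed for the presentations. -/
lemma isDualizingVariety_algebraAction [IsNoetherianRing R] [Module.Finite R Λ]
    (h : HasWeakPullbacks M.FullSubcategory) (h' : HasWeakPullbacks M.FullSubcategoryᵒᵖ)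
    (hP : ∀ P : FGModuleCat.{u} Λ, Projective P → M P)
    (hI : ∀ J : FGModuleCat.{u} Λ, Injective J → M J) :
    IsDualizingVariety (algebraAction R M) hE where
  hasWeakPullbacks := h
  hasWeakPullbacks_op := h'
  isHomFinite := isHomFinite_algebraAction
  dual_representable := by
    have : IsNoetherianRing Λ := IsNoetherianRing.of_finite R Λ
    refine dualRepresentableFinPres_algebraAction hE fun c => exists_isFreeOn c (hP _ ⟨?_⟩)
    intro X Y f g hg
    have : Epi ((forget₂ (FGModuleCat Λ) (ModuleCat Λ)).map g) := inferInstance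
    obtain ⟨k, hk⟩ := Module.projective_lifting_property (P := Fin c → Λ) g.hom.hom f.hom.hom
      ((ModuleCat.epi_iff_surjective _).1 this)
    exact ⟨FGModuleCat.ofHom k, FGModuleCat.hom_ext hk⟩
  dual_corepresentable := by
    have : IsNoetherianRing Λ := IsNoetherianRing.of_finite R Λ
    have := AlgDual.finite (Λ := Λ) hE
    refine dualRepresentableFinPres_algebraAction_op hE fun c => exists_isCofreeOn c (hI _ ⟨?_⟩)
    intro X Y g f hf
    have : Mono ((forget₂ (FGModuleCat Λ) (ModuleCat Λ)).map f) := inferInstance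
    have hf' : Function.Injective f.hom.hom := (ModuleCat.mono_iff_injective _).1 this
    let f' : AlgModule R X →ₗ[Λ] AlgModule R Y := f.hom.hom
    let g' : AlgModule R X →ₗ[Λ] (Fin c → AlgDual R Λ E) := g.hom.hom
    obtain ⟨k, hk⟩ := AlgDual.exists_extension hE f' hf' g'
    exact ⟨FGModuleCat.ofHom (V := Y) k, FGModuleCat.hom_ext hk⟩

end ArtinAlgebra

end

end HigherCT

/-! ### Composition of the equivalences. -/

theorem mainTheorem12 (R : Type u) [CommRing R] [IsArtinianRing R] (Λ : Type u) [Ring Λ]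
    [Algebra R Λ] [Module.Finite R Λ] (n : ℕ) (hn : 2 ≤ n)
    (M : ObjectProperty (FGModuleCat.{u} Λ)) (hM : HigherCT.IsNClusterTiltingMod R Λ n M) :
    Nonempty
      (HigherCT.StableCat (HigherCT.projDimLEOne M.FullSubcategory) ≌
        (HigherCT.StableCat (HigherCT.projDimLEOne M.FullSubcategoryᵒᵖ))ᵒᵖ) ∧
    Nonempty
      (HigherCT.StableCat (HigherCT.projDimLEOne M.FullSubcategory) ≌
        HigherCT.CostableCat (HigherCT.injDimLEOne M.FullSubcategory)) := by
  have : IsNoetherianRing Λ := IsNoetherianRing.of_finite R Λ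
  have h : HigherCT.IsNClusterTilting n M := hM
  obtain ⟨E, _, _, hE⟩ := HigherCT.exists_isDualizingModule R
  obtain ⟨e₁⟩ := (h.isRigidGenerating hn).nonempty_equivalence
  rw [show HigherCT.HasShortResolution M.ι = HigherCT.extOrthogonal M n 0 from
    funext fun D => propext (h.hasShortResolution_iff D)] at e₁
  -- From modules with short resolutions, `j = 0`, to modules with short coresolutions, `j = n - 2`;
  -- for `n = 2` the two classes coincide.
  obtain ⟨e₂⟩ := h.nonempty_iterated_syzygy_equivalence (n - 2) (by lia)
  obtain ⟨e₃⟩ := (h.isRigidGenerating_op hn).nonempty_equivalence_op _ h.hasShortResolution_op_iff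
  obtain ⟨e₄⟩ := (HigherCT.isDualizingVariety_algebraAction hE h.hasWeakPullbacks
    h.hasWeakPullbacks_op (fun P _ => h.mem_of_projective P)
    (fun J _ => h.mem_of_injective J)).nonempty_equivalence
  let e := e₁.symm.trans (e₂.trans e₃)
  exact ⟨⟨e⟩, ⟨e.trans e₄.symm⟩⟩
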